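/- For all constants $c,k$ there are constants $K,B$, depending only on $c$ and $k$, such that the following holds. Let $\mathcal C$ be a finite color space and let $\varepsilon>0$. There is a deterministic synchronous message passing algorithm that, on every finite graph $G=(V,E)$ with $n$ nodes, maximum degree $\Delta$ and arboricity $a\ge 1$ (the minimum number of forests that cover $E$) such that $|\mathcal C|\le c\,\Delta^c$, for every assignment of unique identifiers $\mathrm{ID}(v)\le n^k$ to the nodes, and for every $\lceil(2+\varepsilon)a\rceil$-list coloring instance (each node $v$ is given a list $L_v\subseteq\mathcal C$ with $|L_v|\ge\lceil(2+\varepsilon)a\rceil$), computes colors $x_v\in L_v$ with $x_u\ne x_v$ for every edge $\{u,v\}\in E$, such that 1. all messages have at most $B\log_2 n$ bits, i.e., the algorithm works in the CONGEST model, and 2. every node $v$ irrevocably outputs its color $x_v$ after at most $$\max\Big\{1,\frac1\varepsilon\Big\}\cdot K\cdot 2^{K\sqrt{\log_2 a}}\cdot\log_2^2 n$$ rounds, i.e., the running time is $\frac1\varepsilon\cdot 2^{O(\sqrt{\log a})}\cdot\log^2 n$ for $\varepsilon=O(1)$. Here, in each round every node sends a possibly different message to each of its neighbors, receives the messages of its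 neighbors, and performs an arbitrary deterministic internal computation. Initially, a node knows $n$, $\Delta$, $a$, its identifier, the identifiers of its neighbors, and its own list. -/

import Mathlib

namespace SimpleGraph

/-- The edges of `G` can be covered by `k` forests. -/
def CoveredByForests {V : Type*} (G : SimpleGraph V) (k : ℕ) : Prop :=
  ∃ F : Fin k → SimpleGraph V, (∀ i, (F i).IsAcyclic) ∧ ⨆ i, F i = G

/-- The arboricity of a (finite) graph: the minimum number of forests that are needed to cover
all its edges. -/
noncomputable def arboricity {V : Type*} (G : SimpleGraph V) : ℕ :=
  sInf {k | G.CoveredByForests k}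

end SimpleGraph

/-- A list coloring instance, given by the lists `L v`, is solved by the colors `x v`. -/
def IsListColoring {V 𝒞 : Type} (G : SimpleGraph V) (L : V → Finset 𝒞) (x : V → 𝒞) : Prop :=
  (∀ v, x v ∈ L v) ∧ ∀ u v, G.Adj u v → x u ≠ x v

/-- A deterministic synchronous message passing algorithm for list coloring with colors from the
color space `𝒞`. Internal computations are arbitrary, and messages are bit strings. -/
structure DistAlg (𝒞 : Type) where
  /-- The local states of a node. -/
  State : Type
  /-- The initial state of a node that knows the number `n` of nodes, the maximum degree `Δ` and
  the arboricity `a` of the network, its own identifier, the identifiers of its neighbors, and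
  its own list of colors. -/
  init : (n Δ a : ℕ) → (ident : ℕ) → (nbrs : Finset ℕ) → (list : Finset 𝒞) → State
  /-- The message that a node in the given state sends to its neighbor with the given
  identifier. The messages to different neighbors may differ. -/
  send : State → ℕ → List Bool
  /-- The state after a round, from the state before it and the messages received in it, each
  paired with the identifier of its sender. -/
  receive : State → Finset (ℕ × List Bool) → State
  /-- The output of a node, `none` as long as it has not decided. -/
  output : State → Option 𝒞

namespace DistAlg

variable {𝒞 V : Type} [Fintype V]

/-- The state of every node after `t` rounds, in the run of `A` on the network `G` with
identifiers `ident` and lists `L`. -/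
noncomputable def state (A : DistAlg 𝒞) (G : SimpleGraph V) [DecidableRel G.Adj]
    (ident : V → ℕ) (L : V → Finset 𝒞) : ℕ → V → A.State
  | 0, v => A.init (Fintype.card V) G.maxDegree G.arboricity (ident v)
      ((G.neighborFinset v).image ident) (L v)
  | t + 1, v => A.receive (state A G ident L t v)
      ((G.neighborFinset v).image fun u => (ident u, A.send (state A G ident L t u) (ident v)))

/-- In the run of `A`, every message that is ever sent along an edge has at most `b` bits. -/
def MessagesAtMost (A : DistAlg 𝒞) (G : SimpleGraph V) [DecidableRel G.Adj]
    (ident : V → ℕ) (L : V → Finset 𝒞) (b : ℝ) : Prop :=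
  ∀ (t : ℕ) (u v : V), G.Adj u v →
    ((A.send (A.state G ident L t u) (ident v)).length : ℝ) ≤ b

/-- The run of `A` solves the list coloring instance `L` within `T` rounds: every node `v` decides
after some number `s ≤ T` of rounds, irrevocably, on a color `x v`, and these colors solve the
instance. -/
def SolvesWithin (A : DistAlg 𝒞) (G : SimpleGraph V) [DecidableRel G.Adj]
    (ident : V → ℕ) (L : V → Finset 𝒞) (T : ℝ) : Prop :=
  ∃ x : V → 𝒞, IsListColoring G L x ∧
    ∀ v, ∃ s : ℕ, (s : ℝ) ≤ T ∧
      ∀ t : ℕ, A.output (A.state G ident L t v) = if t < s then none else some (x v)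

end DistAlg

/-! Layers. A graph of arboricity `a` has average degree at most `2a` on every vertex set `S`.
Hence, with δ = min(ε, 1) and D = ⌈(2+δ)a⌉ - 1 (capped at `n`), at most |S|/(1+δ/2) vertices of `S`
have more than D neighbors in `S`. Removing the others, round after round, gives O(log n / δ) layers
such that a node has at most D neighbors in its own and later layers (`Known.exists_layers`). Lists
have more than D colors, so the layers can be colored from the last to the first: in each of them
the remaining lists exceed the degree inside the layer, which is at most D (`Known.color_layers`).

One partial coloring. Inside a layer, a randomized process would let nodes become active with
probability 1/16, choose a random candidate bit by bit, and keep it if no active neighbor has the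
same one. It is derandomized by conditional expectations. To let many nodes decide at once, a
defective coloring splits them into q² classes such that only an e/q fraction of the conflict weight
lies inside classes; classes decide one after another (`greedy_cost_le`, `Known.exists_bits`). With
candidates of `r` bits, every bit raises the conflicts by a factor of at most 1 + 1/r
(`Known.split`), hence by at most 3 altogether, and a 1/64 fraction of the weight gets colored
(`Known.exists_candidates`).

Few bits. Colors may need about log Δ bits, which is too slow. Available colors are therefore hashed
to O(log D) bits by a family of T = O(log n) functions, one per iteration, whose existence follows
by counting (`exists_hash`). A node participates only if the current function is nearly injective on
its base set. The base set is replaced at most O(log D) times, each time by one less than half as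
large, and each base set meets few bad functions, so a node that stays uncolored participates in at
least half of the iterations. Weights (64/63)^g, with `g` the number of participations, make the
total weight of uncolored nodes nonincreasing; a node with too many participations would exceed it
(`LayerInv.alive_eq_empty`).

The time per layer is polylogarithmic in `a` times log n, and a power of log a is at most 2^{O(√log
a)} (`scale_pow_le`). The algorithm may depend on n, Δ, a in an arbitrary way, so the hash family is
simply fixed in advance; `Known` keeps track of rounds and message sizes. -/

/-! ### Broadcast protocols, views and what nodes can know after some rounds -/

/-- A network with identifiers and color lists. -/
structure Network (𝒞 : Type) where
  V : Type
  fintypeV : Fintype V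
  G : SimpleGraph V
  decAdj : DecidableRel G.Adj
  ident : V → ℕ
  ident_injective : Function.Injective ident
  L : V → Finset 𝒞

attribute [instance] Network.fintypeV Network.decAdj

namespace Network

variable {𝒞 : Type}

/-- The identifier and the list of a node, and the messages received so far, last round first. -/
abbrev View (𝒞 : Type) : Type := (ℕ × Finset 𝒞) × List (Finset (ℕ × List Bool))

/-- The neighbors of a node. -/
abbrev nbr (N : Network 𝒞) (v : N.V) : Finset N.V := N.G.neighborFinset v

/-- The view of a node after `t` rounds in which all nodes broadcast messages according to `σ`. -/
noncomputable def view (N : Network 𝒞) (σ : View 𝒞 → List Bool) : ℕ → N.V → View 𝒞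
  | 0, v => ((N.ident v, N.L v), [])
  | t + 1, v => ((view N σ t v).1,
      ((N.nbr v).image fun u => (N.ident u, σ (view N σ t u))) :: (view N σ t v).2)

theorem view_length (N : Network 𝒞) (σ : View 𝒞 → List Bool) (t : ℕ) (v : N.V) :
    (N.view σ t v).2.length = t := by
  induction t generalizing v with
  | zero => rfl
  | succ t ih => simp [view, ih]

theorem view_congr (N : Network 𝒞) {σ σ' : View 𝒞 → List Bool} {T : ℕ}
    (h : ∀ w : View 𝒞, w.2.length < T → σ w = σ' w) {t : ℕ} (ht : t ≤ T) (v : N.V) :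
    N.view σ t v = N.view σ' t v := by
  induction t generalizing v with
  | zero => rfl
  | succ t ih =>
    have e : ∀ u, N.view σ t u = N.view σ' t u := fun u => ih (by omega) u
    simp only [view, e]
    congr 3
    ext1 u
    rw [h _ (by rw [view_length]; omega)]

theorem view_drop (N : Network 𝒞) (σ : View 𝒞 → List Bool) (T s : ℕ) (v : N.V) :
    ((N.view σ (T + s) v).1, (N.view σ (T + s) v).2.drop s) = N.view σ T v := by
  induction s with
  | zero => simp
  | succ s ih =>
    rw [← ih]
    simp [view]

/-- The value `X N v` is known to every node `v` of every network `N` in the class `P` after `t`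
rounds with messages of at most `b` bits. -/
def Known (P : Network 𝒞 → Prop) (b t : ℕ) {α : Type} (X : ∀ N : Network 𝒞, N.V → α) : Prop :=
  ∃ (σ : View 𝒞 → List Bool) (g : View 𝒞 → α),
    (∀ N, P N → ∀ v, X N v = g (N.view σ t v)) ∧
    ∀ N, P N → ∀ s < t, ∀ v, (σ (N.view σ s v)).length ≤ b

theorem known_zero (P : Network 𝒞 → Prop) (b : ℕ) :
    Known P b 0 (fun N v => (N.ident v, N.L v)) :=
  ⟨fun _ => [], fun w => w.1, fun _ _ _ => rfl, fun _ _ _ h => absurd h (by simp)⟩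

theorem Known.map {P : Network 𝒞 → Prop} {b t : ℕ} {α β : Type} {X : ∀ N : Network 𝒞, N.V → α}
    (h : Known P b t X) (f : α → β) {Y : ∀ N : Network 𝒞, N.V → β}
    (hY : ∀ N, P N → ∀ v, Y N v = f (X N v)) : Known P b t Y := by
  obtain ⟨σ, g, h1, h2⟩ := h
  exact ⟨σ, f ∘ g, fun N hN v => by rw [hY N hN, h1 N hN]; rfl, h2⟩

theorem bits_injective : Function.Injective Nat.bits := by
  intro m n h
  have := congrArg (fun l : List Bool => l.map fun b => bif b then 1 else 0) h
  simp only [← Nat.digits_two_eq_bits] at this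
  exact Nat.digits_inj_iff.1 this

open Classical in
/-- Inverse of an encoding of messages as bit strings, in the presence of sender identifiers. -/
noncomputable def decodeMessages {δ : Type} [Encodable δ] (s : Finset (ℕ × List Bool)) :
    Multiset δ :=
  s.val.filterMap fun p =>
    if h : ∃ x : δ, (Encodable.encode x).bits = p.2 then some h.choose else none

/-- Messages arrive as a set, but the distinct sender identifiers keep equal messages apart, so the
multiset of the neighbors' data is recovered with multiplicities. -/
theorem decodeMessages_image {δ V : Type} [Encodable δ] (s : Finset V) (ident : V → ℕ)
    (hinj : Function.Injective ident) (d : V → δ) :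
    decodeMessages (s.image fun u => (ident u, (Encodable.encode (d u)).bits)) =
      s.val.map d := by
  classical
  have hi : Set.InjOn (fun u => (ident u, (Encodable.encode (d u)).bits)) (s : Set V) := by
    intro u _ v _ h
    exact hinj (Prod.ext_iff.1 h).1
  rw [decodeMessages, Finset.image_val_of_injOn hi, Multiset.filterMap_map,
    ← Multiset.filterMap_eq_map]
  congr 1
  ext1 u
  have h : ∃ x : δ, (Encodable.encode x).bits = (Encodable.encode (d u)).bits := ⟨_, rfl⟩
  simp only [Function.comp]
  rw [dif_pos h]
  exact congrArg some (Encodable.encode_injective (bits_injective h.choose_spec))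

/-- The composition rule behind all algorithms below: one round in which each node broadcasts `d` of
its knowledge and then computes from the multiset of data received. -/
theorem Known.step {P : Network 𝒞 → Prop} {b t : ℕ} {α β δ : Type} [Encodable δ]
    {X : ∀ N : Network 𝒞, N.V → α} (h : Known P b t X) (d : α → δ)
    (hd : ∀ N, P N → ∀ v, Encodable.encode (d (X N v)) < 2 ^ b)
    (F : α → Multiset δ → β) {Y : ∀ N : Network 𝒞, N.V → β}
    (hY : ∀ N, P N → ∀ v, Y N v = F (X N v) ((N.nbr v).val.map fun u => d (X N u))) :
    Known P b (t + 1) Y := by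
  obtain ⟨σ, g, h1, h2⟩ := h
  -- The length of the history is the current round, so a protocol can be extended at round `t`
  -- without changing the earlier ones.
  let σ' : View 𝒞 → List Bool :=
    fun w => if w.2.length = t then (Encodable.encode (d (g w))).bits else σ w
  have hσ : ∀ N : Network 𝒞, ∀ s ≤ t, ∀ v, N.view σ' s v = N.view σ s v := by
    intro N s hs v
    refine N.view_congr (T := t) (fun w hw => ?_) hs v
    simp only [σ', if_neg hw.ne]
  have hm : ∀ N, P N → ∀ v, σ' (N.view σ' t v) = (Encodable.encode (d (X N v))).bits := by
    intro N hN v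
    simp only [σ', view_length, if_true]
    rw [hσ N t le_rfl, h1 N hN]
  refine ⟨σ', fun w => F (g (w.1, w.2.tail)) (decodeMessages (w.2.headD ∅)), ?_, ?_⟩
  · intro N hN v
    rw [hY N hN]
    simp only [view, List.tail_cons, List.headD_cons, Prod.mk.eta]
    rw [hσ N t le_rfl, ← h1 N hN]
    simp only [hm N hN]
    rw [decodeMessages_image _ _ N.ident_injective]
  · intro N hN s hs v
    rcases Nat.lt_succ_iff_lt_or_eq.1 hs with hs | rfl
    · rw [hσ N s hs.le]
      simp only [σ', view_length, if_neg hs.ne]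
      exact h2 N hN s hs v
    · rw [hm N hN, Nat.size_eq_bits_len, Nat.size_le]
      exact hd N hN v

/-- An algorithm for each triple of global parameters gives a distributed algorithm. -/
theorem exists_distAlg (P : ℕ → ℕ → ℕ → Network 𝒞 → Prop) (b T : ℕ → ℕ → ℕ → ℕ)
    (hA : ∀ n Δ a, ∃ col : ∀ N : Network 𝒞, N.V → Option 𝒞,
      (∀ N, P n Δ a N → ∃ x, IsListColoring N.G N.L x ∧ ∀ v, col N v = some (x v)) ∧
      Known (P n Δ a) (b n Δ a) (T n Δ a) col) :
    ∃ A : DistAlg 𝒞, ∀ N : Network 𝒞,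
      P (Fintype.card N.V) N.G.maxDegree N.G.arboricity N →
      A.MessagesAtMost N.G N.ident N.L
        (b (Fintype.card N.V) N.G.maxDegree N.G.arboricity : ℝ) ∧
      A.SolvesWithin N.G N.ident N.L
        (T (Fintype.card N.V) N.G.maxDegree N.G.arboricity : ℝ) := by
  classical
  choose col hcol σ g hg hb using hA
  let σ' : ℕ × ℕ × ℕ → View 𝒞 → List Bool := fun q w =>
    if w.2.length < T q.1 q.2.1 q.2.2 then σ q.1 q.2.1 q.2.2 w else []
  let A : DistAlg 𝒞 :=
    { State := (ℕ × ℕ × ℕ) × View 𝒞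
      init := fun n Δ a i _ L => ((n, Δ, a), ((i, L), []))
      send := fun s _ => σ' s.1 s.2
      receive := fun s m => (s.1, (s.2.1, m :: s.2.2))
      -- Newest rounds stand first in the history. Dropping all but the oldest `T` of them makes the
      -- output constant from round `T` on.
      output := fun s =>
        if s.2.2.length < T s.1.1 s.1.2.1 s.1.2.2 then none
        else g s.1.1 s.1.2.1 s.1.2.2
          (s.2.1, s.2.2.drop (s.2.2.length - T s.1.1 s.1.2.1 s.1.2.2)) }
  refine ⟨A, fun N hN => ?_⟩
  set n := Fintype.card N.V
  set Δ := N.G.maxDegree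
  set a := N.G.arboricity
  have hst : ∀ t v, A.state N.G N.ident N.L t v = ((n, Δ, a), N.view (σ' (n, Δ, a)) t v) := by
    intro t
    induction t with
    | zero => intro v; rfl
    | succ t ih =>
      intro v
      simp only [DistAlg.state, ih, A, view]
  have hag : ∀ t ≤ T n Δ a, ∀ v, N.view (σ' (n, Δ, a)) t v = N.view (σ n Δ a) t v := by
    intro t ht v
    exact N.view_congr (T := T n Δ a) (fun w hw => by simp only [σ', if_pos hw]) ht v
  constructor
  · intro t u v _
    rw [hst]
    simp only [A, σ', view_length]
    split_ifs with h
    · rw [hag t h.le]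
      exact_mod_cast hb n Δ a N hN t h u
    · simp
  · obtain ⟨x, hx, hxc⟩ := hcol n Δ a N hN
    refine ⟨x, hx, fun v => ⟨T n Δ a, le_rfl, fun t => ?_⟩⟩
    rw [hst]
    simp only [A, view_length]
    split_ifs with h
    · rfl
    · obtain ⟨s, rfl⟩ := Nat.exists_eq_add_of_le (not_lt.1 h)
      rw [Nat.add_sub_cancel_left, view_drop, hag _ le_rfl, ← hg n Δ a N hN, hxc]

/-! ### Polynomial codes over prime fields -/

/-- Evaluation at `y` of the polynomial over `ZMod q` whose coefficients are the `e + 1` lowest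
binary digits of `m`. -/
noncomputable def code (q e m y : ℕ) : ℕ :=
  ((∑ i ∈ Finset.range (e + 1),
    Polynomial.C (if m.testBit i then (1 : ZMod q) else 0) * Polynomial.X ^ i).eval (y : ZMod q)).val

theorem code_lt {q : ℕ} (hq : q.Prime) (e m y : ℕ) : code q e m y < q := by
  have : NeZero q := ⟨hq.ne_zero⟩
  exact ZMod.val_lt _

/-- Different numbers have different binary digits, hence give different polynomials of degree at
most `e`, since 0 ≠ 1 in `ZMod q`. Their difference has at most `e` roots. -/
theorem card_code_eq_le {q e m m' : ℕ} (hq : q.Prime) (hm : m < 2 ^ (e + 1))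
    (hm' : m' < 2 ^ (e + 1)) (hne : m ≠ m') :
    ((Finset.range q).filter fun y => code q e m y = code q e m' y).card ≤ e := by
  have : Fact q.Prime := ⟨hq⟩
  let p : ℕ → Polynomial (ZMod q) := fun m => ∑ i ∈ Finset.range (e + 1),
    Polynomial.C (if m.testBit i then (1 : ZMod q) else 0) * Polynomial.X ^ i
  have hcoef : ∀ m i, i ∈ Finset.range (e + 1) →
      (p m).coeff i = if m.testBit i then (1 : ZMod q) else 0 := by
    intro m i hi
    simp only [p, Polynomial.finsetSum_coeff, Polynomial.coeff_C_mul, Polynomial.coeff_X_pow]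
    simp only [mul_ite, mul_one, mul_zero]
    rw [Finset.sum_ite_eq (Finset.range (e + 1)) i, if_pos hi]
  have hdeg : ∀ m, (p m).natDegree ≤ e := by
    intro m
    refine Polynomial.natDegree_sum_le_of_forall_le _ _ fun i hi => ?_
    refine (Polynomial.natDegree_C_mul_X_pow_le _ _).trans ?_
    have := Finset.mem_range.1 hi
    omega
  have hpne : p m - p m' ≠ 0 := by
    intro h
    apply hne
    apply Nat.eq_of_testBit_eq
    intro i
    by_cases hi : i < e + 1
    · have h1 := congrArg (fun r => Polynomial.coeff r i) h
      simp only [Polynomial.coeff_sub, Polynomial.coeff_zero] at h1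
      rw [hcoef m i (Finset.mem_range.2 hi), hcoef m' i (Finset.mem_range.2 hi)] at h1
      revert h1
      cases m.testBit i <;> cases m'.testBit i <;> simp
    · rw [Nat.testBit_lt_two_pow (hm.trans_le (Nat.pow_le_pow_right two_pos (by omega))),
        Nat.testBit_lt_two_pow (hm'.trans_le (Nat.pow_le_pow_right two_pos (by omega)))]
  calc ((Finset.range q).filter fun y => code q e m y = code q e m' y).card
      = (((Finset.range q).filter fun y => code q e m y = code q e m' y).image
          (fun y : ℕ => (y : ZMod q))).card := by
        rw [Finset.card_image_of_injOn]
        intro y hy z hz h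
        simp only [Finset.coe_filter, Finset.mem_range, Set.mem_ofPred_eq] at hy hz
        have := (ZMod.natCast_eq_natCast_iff' _ _ _).1 h
        rwa [Nat.mod_eq_of_lt hy.1, Nat.mod_eq_of_lt hz.1] at this
    _ ≤ (p m - p m').roots.toFinset.card := by
        apply Finset.card_le_card
        intro z hz
        obtain ⟨y, hy, rfl⟩ := Finset.mem_image.1 hz
        have h := (Finset.mem_filter.1 hy).2
        rw [Multiset.mem_toFinset, Polynomial.mem_roots hpne, Polynomial.IsRoot,
          Polynomial.eval_sub, sub_eq_zero]
        exact ZMod.val_injective q h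
    _ ≤ Multiset.card (p m - p m').roots := Multiset.toFinset_card_le _
    _ ≤ (p m - p m').natDegree := Polynomial.card_roots' _
    _ ≤ e := (Polynomial.natDegree_sub_le_of_le (hdeg m) (hdeg m')).trans (max_self e).le

/-- A node with color `m` can choose a point where only a small weight of differently colored
neighbors has the same code. -/
theorem exists_code_weight_le {ι : Type} {q e m : ℕ} (hq : q.Prime) (hm : m < 2 ^ (e + 1))
    (s : Multiset ι) (w : ι → ℝ) (ψ : ι → ℕ) (hw : ∀ i ∈ s, 0 ≤ w i)
    (hψ : ∀ i ∈ s, ψ i < 2 ^ (e + 1)) (hne : ∀ i ∈ s, w i ≠ 0 → ψ i ≠ m) :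
    ∃ y < q, (s.map fun i => if code q e (ψ i) y = code q e m y then w i else 0).sum ≤
      (e : ℝ) / q * (s.map w).sum := by
  have hq0 : (0 : ℝ) < q := by exact_mod_cast hq.pos
  by_contra! hcon
  -- Averaging over all points: each neighbor with nonzero weight conflicts at no more than `e` of
  -- the `q` points.
  have h1 : ∑ y ∈ Finset.range q,
      (s.map fun i => if code q e (ψ i) y = code q e m y then w i else 0).sum ≤
      e * (s.map w).sum := by
    clear hcon
    induction s using Multiset.induction_on with
    | empty => simp
    | cons i s ih =>
      simp only [Multiset.map_cons, Multiset.sum_cons, Finset.sum_add_distrib, mul_add]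
      refine add_le_add ?_ (ih (fun j hj => hw j (Multiset.mem_cons_of_mem hj))
        (fun j hj => hψ j (Multiset.mem_cons_of_mem hj))
        (fun j hj => hne j (Multiset.mem_cons_of_mem hj)))
      have hi := Multiset.mem_cons_self i s
      rw [← Finset.sum_filter, Finset.sum_const, nsmul_eq_mul]
      by_cases h0 : w i = 0
      · simp [h0]
      · refine mul_le_mul_of_nonneg_right ?_ (hw i hi)
        exact_mod_cast card_code_eq_le hq (hψ i hi) hm (hne i hi h0)
  have h2 : ∑ y ∈ Finset.range q, (e : ℝ) / q * (s.map w).sum <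
      ∑ y ∈ Finset.range q,
        (s.map fun i => if code q e (ψ i) y = code q e m y then w i else 0).sum :=
    Finset.sum_lt_sum_of_nonempty ⟨0, Finset.mem_range.2 hq.pos⟩
      fun y hy => hcon y (Finset.mem_range.1 hy)
  rw [Finset.sum_const, Finset.card_range, nsmul_eq_mul] at h2
  have h3 : (q : ℝ) * ((e : ℝ) / q * (s.map w).sum) = e * (s.map w).sum := by
    field_simp
  linarith

/-! ### Conditional expectations, class by class -/

/-- Moving in a direction that decreases the linear part decreases a quadratic form that has no
interaction along the direction. -/
theorem quadratic_le {ι : Type} [Fintype ι] (x d N : ι → ℝ) (A : ι → ι → ℝ)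
    (hA : ∀ i j, A i j = A j i) (hd : ∀ i j, d i * d j * A i j = 0)
    (hle : ∑ i, d i * (N i + ∑ j, A i j * x j) ≤ 0) :
    ∑ i, (x i + d i) * N i + (1 / 2) * ∑ i, ∑ j, (x i + d i) * (x j + d j) * A i j ≤
      ∑ i, x i * N i + (1 / 2) * ∑ i, ∑ j, x i * x j * A i j := by
  have h1 : ∑ i, ∑ j, (x i + d i) * (x j + d j) * A i j =
      ∑ i, ∑ j, x i * x j * A i j + ∑ i, ∑ j, d i * (A i j * x j) +
        ∑ i, ∑ j, d j * (A j i * x i) := by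
    simp only [← Finset.sum_add_distrib]
    refine Finset.sum_congr rfl fun i _ => Finset.sum_congr rfl fun j _ => ?_
    rw [hA j i]
    linear_combination hd i j
  have h2 : ∑ i, ∑ j, d j * (A j i * x i) = ∑ i, ∑ j, d i * (A i j * x j) := Finset.sum_comm
  have h3 : ∑ i, d i * (N i + ∑ j, A i j * x j) =
      ∑ i, d i * N i + ∑ i, ∑ j, d i * (A i j * x j) := by
    simp only [mul_add, Finset.sum_add_distrib, Finset.mul_sum]
  have h4 : ∑ i, (x i + d i) * N i = ∑ i, x i * N i + ∑ i, d i * N i := by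
    simp only [add_mul, Finset.sum_add_distrib]
  rw [h1, h2, h4]
  linarith

/-- The marginals after the classes below `k` have fixed their bits. -/
noncomputable def marginal {V : Type} (cls : V → ℕ) (p : V → Bool → ℝ) (bit : V → Bool) (k : ℕ)
    (v : V) (β : Bool) : ℝ :=
  if cls v < k then (if bit v = β then 1 else 0) else p v β

/-- Conditional expectations: if every node chooses a bit of minimum expected cost, given the
choices of the nodes in lower classes, the total cost is at most its expectation. -/
theorem greedy_cost_le {V : Type} [Fintype V] (cls : V → ℕ) (p : V → Bool → ℝ) (bit : V → Bool)
    (N : V → Bool → ℝ) (A : V → V → Bool → Bool → ℝ)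
    (hA : ∀ u v β γ, A u v β γ = A v u γ β) (hcls : ∀ u v β γ, cls u = cls v → A u v β γ = 0)
    (hp : ∀ v β, 0 ≤ p v β) (hp1 : ∀ v, ∑ β, p v β = 1)
    (hbit : ∀ v β, 0 < p v β →
      N v (bit v) + ∑ u, ∑ γ, marginal cls p bit (cls v) u γ * A v u (bit v) γ ≤
      N v β + ∑ u, ∑ γ, marginal cls p bit (cls v) u γ * A v u β γ) :
    ∑ v, N v (bit v) + (1 / 2) * ∑ v, ∑ u, A v u (bit v) (bit u) ≤
      ∑ v, ∑ β, p v β * N v β +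
        (1 / 2) * ∑ v, ∑ u, ∑ β, ∑ γ, p v β * p u γ * A v u β γ := by
  classical
  -- The expected cost once the classes below `k` are fixed, as a quadratic form in the marginals.
  -- Nodes of one class do not interact, so `Φ (k + 1)` differs from `Φ k` only by the linear part,
  -- which the choice of best bits makes nonpositive.
  let Φ : ℕ → ℝ := fun k => ∑ i : V × Bool, marginal cls p bit k i.1 i.2 * N i.1 i.2 +
    (1 / 2) * ∑ i : V × Bool, ∑ j : V × Bool,
      marginal cls p bit k i.1 i.2 * marginal cls p bit k j.1 j.2 * A i.1 j.1 i.2 j.2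
  have hstep : ∀ k, Φ (k + 1) ≤ Φ k := by
    intro k
    let d : V × Bool → ℝ := fun i =>
      marginal cls p bit (k + 1) i.1 i.2 - marginal cls p bit k i.1 i.2
    have hd0 : ∀ i : V × Bool, cls i.1 ≠ k → d i = 0 := by
      intro i hi
      have : cls i.1 < k + 1 ↔ cls i.1 < k := by omega
      simp only [d, marginal, this, sub_self]
    have hd1 : ∀ v β, cls v = k → d (v, β) = (if bit v = β then 1 else 0) - p v β := by
      intro v β hv
      simp only [d, marginal, hv, lt_irrefl, if_false, Nat.lt_succ_self, if_true]
    have := quadratic_le (fun i : V × Bool => marginal cls p bit k i.1 i.2) d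
      (fun i => N i.1 i.2) (fun i j => A i.1 j.1 i.2 j.2) (fun i j => hA _ _ _ _)
      (fun i j => by
        by_cases hi : cls i.1 = k
        · by_cases hj : cls j.1 = k
          · rw [hcls _ _ _ _ (hi.trans hj.symm), mul_zero]
          · rw [hd0 j hj]; ring
        · rw [hd0 i hi]; ring)
      (by
        rw [Fintype.sum_prod_type]
        refine Finset.sum_nonpos fun v _ => ?_
        by_cases hv : cls v = k
        · have hm : ∀ β, ∑ j : V × Bool, A v j.1 β j.2 * marginal cls p bit k j.1 j.2 =
              ∑ u, ∑ γ, marginal cls p bit (cls v) u γ * A v u β γ := by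
            intro β
            rw [Fintype.sum_prod_type, hv]
            exact Finset.sum_congr rfl fun u _ => Finset.sum_congr rfl fun γ _ => mul_comm _ _
          simp only [hm, hd1 v _ hv]
          generalize hE : (fun β => N v β +
            ∑ u, ∑ γ, marginal cls p bit (cls v) u γ * A v u β γ) = E
          have hE' : ∀ β, N v β + ∑ u, ∑ γ, marginal cls p bit (cls v) u γ * A v u β γ = E β :=
            fun β => by rw [← hE]
          simp only [hE', sub_mul, Finset.sum_sub_distrib, ite_mul, one_mul, zero_mul,
            Finset.sum_ite_eq, Finset.mem_univ, if_true]
          have h1 : ∑ β, p v β * E (bit v) ≤ ∑ β, p v β * E β := by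
            refine Finset.sum_le_sum fun β _ => ?_
            rcases (hp v β).eq_or_lt with h | h
            · rw [← h]; simp
            · refine mul_le_mul_of_nonneg_left ?_ h.le
              rw [← hE', ← hE']
              exact hbit v β h
          rw [← Finset.sum_mul, hp1, one_mul] at h1
          linarith
        · refine Finset.sum_nonpos fun β _ => ?_
          rw [hd0 (v, β) hv, zero_mul])
    simpa only [Φ, d, add_sub_cancel] using this
  have hanti : Antitone Φ := antitone_nat_of_succ_le hstep
  have hK := hanti (Nat.zero_le (Finset.univ.sup cls + 1))
  have hlt : ∀ v, cls v < Finset.univ.sup cls + 1 := fun v =>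
    Nat.lt_succ_of_le (Finset.le_sup (Finset.mem_univ v))
  have e0 : Φ 0 = ∑ v, ∑ β, p v β * N v β +
      (1 / 2) * ∑ v, ∑ u, ∑ β, ∑ γ, p v β * p u γ * A v u β γ := by
    simp only [Φ, marginal, Nat.not_lt_zero, if_false, Fintype.sum_prod_type]
    congr 2
    exact Finset.sum_congr rfl fun v _ => Finset.sum_comm
  have e1 : Φ (Finset.univ.sup cls + 1) =
      ∑ v, N v (bit v) + (1 / 2) * ∑ v, ∑ u, A v u (bit v) (bit u) := by
    simp only [Φ, marginal, hlt, if_true, Fintype.sum_prod_type, ite_mul, one_mul, zero_mul,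
      mul_ite, mul_one, mul_zero]
    have a1 : ∀ v, (∑ β, if bit v = β then N v β else 0) = N v (bit v) := fun v => by simp
    have a2 : ∀ v, (∑ β, ∑ u, ∑ γ, if bit u = γ then if bit v = β then A v u β γ else 0 else 0) =
        ∑ u, A v u (bit v) (bit u) := by
      intro v
      rw [Finset.sum_comm]
      refine Finset.sum_congr rfl fun u _ => ?_
      cases bit v <;> cases bit u <;> simp
    simp only [a1, a2]
  rwa [e0, e1] at hK

/-- A bit of positive probability that has minimum cost among these. -/
noncomputable def bestBit (p f : Bool → ℝ) : Bool :=
  open Classical in if 0 < p true ∧ (p false ≤ 0 ∨ f true ≤ f false) then true else false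

theorem bestBit_spec {p : Bool → ℝ} (f : Bool → ℝ) (hp : ∀ β, 0 ≤ p β) (hp1 : ∑ β, p β = 1) :
    0 < p (bestBit p f) ∧ ∀ β, 0 < p β → f (bestBit p f) ≤ f β := by
  have h1 := hp true
  have h2 := hp false
  rw [Fintype.sum_bool] at hp1
  unfold bestBit
  split_ifs with h
  · refine ⟨h.1, fun β hβ => ?_⟩
    cases β
    · exact h.2.resolve_left (not_le.2 hβ)
    · exact le_rfl
  · rw [not_and, not_or, not_le, not_le] at h
    rcases h1.eq_or_lt with h3 | h3
    · refine ⟨by linarith, fun β hβ => ?_⟩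
      cases β
      · exact le_rfl
      · exact absurd hβ (by rw [← h3]; exact lt_irrefl _)
    · refine ⟨(h h3).1, fun β _ => ?_⟩
      cases β
      · exact le_rfl
      · exact (h h3).2.le

/-! ### Defective colorings and deterministic rounding -/

/-- The class of a node in a defective coloring: a point of small conflicting weight, and the code
of its color at this point. -/
noncomputable def defectiveClass {δ : Type} (q e : ℕ) (ψ : δ → ℕ) (W : δ → δ → ℝ) (x : δ)
    (s : Multiset δ) : ℕ :=
  open Classical in
  let y := if h : ∃ y < q, (s.map fun z => if code q e (ψ z) y = code q e (ψ x) y then W x z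
    else 0).sum ≤ (e : ℝ) / q * (s.map (W x)).sum then h.choose else 0
  y * q + code q e (ψ x) y

theorem defectiveClass_lt {δ : Type} {q : ℕ} (hq : q.Prime) (e : ℕ) (ψ : δ → ℕ)
    (W : δ → δ → ℝ) (x : δ) (s : Multiset δ) : defectiveClass q e ψ W x s < q * q := by
  unfold defectiveClass
  extract_lets y
  have hy : y < q := by
    simp only [y]
    split_ifs with h
    · exact h.choose_spec.1
    · exact hq.pos
  have := code_lt hq e (ψ x) y
  nlinarith

/-- A class encodes the pair (point, code at that point) in base `q`. A neighbor in the same class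
thus has the same code at the point chosen by `x`, however its own point was selected from `T i`,
and `x` chose a point where such weight is small. -/
theorem defectiveClass_weight_le {δ ι : Type} {q e : ℕ} (hq : q.Prime) (ψ : δ → ℕ)
    (W : δ → δ → ℝ) (x : δ) (s : Finset ι) (f : ι → δ) (T : ι → Multiset δ)
    (hW : ∀ i ∈ s, 0 ≤ W x (f i)) (hx : ψ x < 2 ^ (e + 1)) (hψ : ∀ i ∈ s, ψ (f i) < 2 ^ (e + 1))
    (hne : ∀ i ∈ s, ψ (f i) = ψ x → W x (f i) = 0) :
    (∑ i ∈ s, if defectiveClass q e ψ W (f i) (T i) =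
        defectiveClass q e ψ W x (s.val.map f) then W x (f i) else 0) ≤
      (e : ℝ) / q * ∑ i ∈ s, W x (f i) := by
  classical
  have h : ∃ y < q, ((s.val.map f).map fun z => if code q e (ψ z) y = code q e (ψ x) y then W x z
      else 0).sum ≤ (e : ℝ) / q * ((s.val.map f).map (W x)).sum := by
    refine exists_code_weight_le hq hx _ _ _ ?_ ?_ ?_
    · intro z hz
      obtain ⟨i, hi, rfl⟩ := Multiset.mem_map.1 hz
      exact hW i hi
    · intro z hz
      obtain ⟨i, hi, rfl⟩ := Multiset.mem_map.1 hz
      exact hψ i hi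
    · intro z hz h0 h1
      obtain ⟨i, hi, rfl⟩ := Multiset.mem_map.1 hz
      exact h0 (hne i hi h1)
  have h2 := h.choose_spec.2
  obtain ⟨y₀, hy₀⟩ : ∃ y₀, y₀ = h.choose := ⟨_, rfl⟩
  rw [← hy₀] at h2
  simp only [Multiset.map_map] at h2
  refine le_trans (Finset.sum_le_sum fun i hi => ?_) h2
  have hnn := hW i hi
  simp only [Function.comp]
  by_cases hc : defectiveClass q e ψ W (f i) (T i) = defectiveClass q e ψ W x (s.val.map f)
  · rw [if_pos hc]
    unfold defectiveClass at hc
    extract_lets y y' at hc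
    have hy' : y' = y₀ := (dif_pos h).trans hy₀.symm
    have c1 := code_lt hq e (ψ (f i)) y
    have c2 := code_lt hq e (ψ x) y'
    have hyy : y = y' := by
      have := congrArg (· / q) hc
      simpa [Nat.add_div_of_dvd_right (Dvd.intro_left _ rfl), Nat.mul_div_cancel _ hq.pos,
        Nat.div_eq_of_lt c1, Nat.div_eq_of_lt c2] using this
    have hcc : code q e (ψ (f i)) y' = code q e (ψ x) y' := by
      rw [hyy] at hc
      omega
    rw [hy'] at hcc
    rw [if_pos hcc]
  · rw [if_neg hc]
    split_ifs
    · exact hnn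
    · exact le_rfl

/-- Deterministic rounding of one bit per node, with a small loss compared to independent
random choices. -/
theorem Known.exists_bits {P : Network 𝒞 → Prop} {b t : ℕ} {α δ : Type} [Encodable δ]
    {X : ∀ N : Network 𝒞, N.V → α} (hX : Known P b t X) (d : α → δ) (pr Nc : δ → Bool → ℝ)
    (K : δ → δ → Bool → Bool → ℝ) (ψ : δ → ℕ) {q e : ℕ} (hq : q.Prime)
    (henc : ∀ N, P N → ∀ v, ∀ κ < q * q, ∀ o : Option Bool,
      Encodable.encode (d (X N v), κ, o) < 2 ^ b)
    (hencd : ∀ N, P N → ∀ v, Encodable.encode (d (X N v)) < 2 ^ b)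
    (hψ : ∀ N, P N → ∀ v, ψ (d (X N v)) < 2 ^ (e + 1))
    (hK0 : ∀ x y β γ, 0 ≤ K x y β γ) (hKs : ∀ x y β γ, K x y β γ = K y x γ β)
    (hne : ∀ N, P N → ∀ u v, N.G.Adj u v → ψ (d (X N u)) = ψ (d (X N v)) →
      ∀ β γ, K (d (X N u)) (d (X N v)) β γ = 0)
    (hpr0 : ∀ N, P N → ∀ v β, 0 ≤ pr (d (X N v)) β)
    (hpr1 : ∀ N, P N → ∀ v, ∑ β, pr (d (X N v)) β = 1) :
    ∃ bit : ∀ N : Network 𝒞, N.V → Bool,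
      Known P b (t + 1 + q * q) (fun N v => (X N v, bit N v)) ∧
      ∀ N, P N → (∀ v, 0 < pr (d (X N v)) (bit N v)) ∧
        ∑ v, Nc (d (X N v)) (bit N v) +
          1 / 2 * ∑ v, ∑ u ∈ N.nbr v, K (d (X N v)) (d (X N u)) (bit N v) (bit N u) ≤
        ∑ v, ∑ β, pr (d (X N v)) β * Nc (d (X N v)) β +
          1 / 2 * ∑ v, ∑ u ∈ N.nbr v, ∑ β, ∑ γ,
            pr (d (X N v)) β * pr (d (X N u)) γ * K (d (X N v)) (d (X N u)) β γ +
          1 / 2 * ((e : ℝ) / q *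
            ∑ v, ∑ u ∈ N.nbr v, ∑ β, ∑ γ, K (d (X N v)) (d (X N u)) β γ) := by
  classical
  -- Summing over all four pairs of bits bounds the cost of an edge whatever the bits turn out to
  -- be; the classes are computed before the bits are known.
  let W : δ → δ → ℝ := fun x y => ∑ β, ∑ γ, K x y β γ
  have hW0 : ∀ x y, 0 ≤ W x y := fun x y =>
    Finset.sum_nonneg fun _ _ => Finset.sum_nonneg fun _ _ => hK0 _ _ _ _
  let cls : ∀ N : Network 𝒞, N.V → ℕ := fun N v =>
    defectiveClass q e ψ W (d (X N v)) ((N.nbr v).val.map fun u => d (X N u))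
  have hcls : ∀ N v, cls N v < q * q := fun N v => defectiveClass_lt hq _ _ _ _ _
  have h1 : Known P b (t + 1) (fun N v => (X N v, cls N v)) :=
    hX.step d hencd (fun x s => (x, defectiveClass q e ψ W (d x) s)) fun N _ v => rfl
  -- The marginal that a neighbor can compute from a report: a point mass once the bit is fixed, and
  -- `pr` before that.
  let mu : Option Bool → δ → Bool → ℝ := fun o y γ =>
    o.elim (pr y γ) fun c => if c = γ then 1 else 0
  let cost : α × ℕ → Multiset (δ × ℕ × Option Bool) → Bool → ℝ := fun x s β =>
    Nc (d x.1) β + (s.map fun z => if x.2 = z.2.1 then 0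
      else ∑ γ, mu z.2.2 z.1 γ * K (d x.1) z.1 β γ).sum
  let F : ℕ → α × ℕ × Option Bool → Multiset (δ × ℕ × Option Bool) → Option Bool :=
    fun k x s => if x.2.1 = k then some (bestBit (pr (d x.1)) (cost (x.1, x.2.1) s)) else x.2.2
  -- One round per class: in round `k` the nodes of class `k` fix their bits, knowing those of all
  -- lower classes.
  let stage : ℕ → ∀ N : Network 𝒞, N.V → Option Bool := fun k => Nat.rec (fun _ _ => none)
    (fun k st N v => F k (X N v, cls N v, st N v)
      ((N.nbr v).val.map fun u => (d (X N u), cls N u, st N u))) k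
  have hstage : ∀ k N v, stage (k + 1) N v = F k (X N v, cls N v, stage k N v)
      ((N.nbr v).val.map fun u => (d (X N u), cls N u, stage k N u)) := fun _ _ _ => rfl
  have h2 : ∀ k, Known P b (t + 1 + k) (fun N v => (X N v, cls N v, stage k N v)) := by
    intro k
    induction k with
    | zero => exact h1.map (fun x => (x.1, x.2, none)) fun _ _ _ => rfl
    | succ k ih =>
      refine ih.step (fun x => (d x.1, x.2.1, x.2.2)) (fun N hN v => ?_)
        (fun x s => (x.1, x.2.1, F k x s)) fun N _ v => ?_
      · exact henc N hN v _ (hcls N v) _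
      · rw [hstage]
  let bit : ∀ N : Network 𝒞, N.V → Bool := fun N v => (stage (q * q) N v).getD false
  have hnone : ∀ k N v, k ≤ cls N v → stage k N v = none := by
    intro k N v hk
    induction k with
    | zero => rfl
    | succ k ih =>
      rw [hstage]
      simp only [F]
      rw [if_neg (by omega)]
      exact ih (by omega)
  have hsame : ∀ N v k, stage (cls N v + 1 + k) N v = stage (cls N v + 1) N v := by
    intro N v k
    induction k with
    | zero => rfl
    | succ k ih =>
      rw [← add_assoc, hstage]
      simp only [F]
      rw [if_neg (by omega)]
      exact ih
  have hsome1 : ∀ N v, stage (cls N v + 1) N v = some (bestBit (pr (d (X N v)))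
      (cost (X N v, cls N v) ((N.nbr v).val.map fun u =>
        (d (X N u), cls N u, stage (cls N v) N u)))) := by
    intro N v
    rw [hstage]
    simp only [F, if_true]
  have hbit : ∀ N v, bit N v = bestBit (pr (d (X N v)))
      (cost (X N v, cls N v) ((N.nbr v).val.map fun u =>
        (d (X N u), cls N u, stage (cls N v) N u))) := by
    intro N v
    obtain ⟨k, hk⟩ := Nat.exists_eq_add_of_le (Nat.succ_le_of_lt (hcls N v))
    simp only [bit]
    rw [hk, Nat.succ_eq_add_one, hsame, hsome1]
    rfl
  have hsome : ∀ N v k, cls N v < k → stage k N v = some (bit N v) := by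
    intro N v k hk
    obtain ⟨k, rfl⟩ := Nat.exists_eq_add_of_le (Nat.succ_le_of_lt hk)
    rw [Nat.succ_eq_add_one, hsame, hsome1, hbit]
  refine ⟨bit, (h2 (q * q)).map (fun x => (x.1, x.2.2.getD false)) fun N _ v => rfl,
    fun N hN => ⟨fun v => ?_, ?_⟩⟩
  · rw [hbit]
    exact (bestBit_spec _ (hpr0 N hN v) (hpr1 N hN v)).1
  have hmu : ∀ k u γ, mu (stage k N u) (d (X N u)) γ =
      marginal (cls N) (fun v => pr (d (X N v))) (bit N) k u γ := by
    intro k u γ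
    unfold marginal
    split_ifs with hk h3
    · rw [hsome N u k hk]; simp [mu, h3]
    · rw [hsome N u k hk]; simp [mu, h3]
    · rw [hnone k N u (not_lt.1 hk)]; rfl
  -- Edges inside a class are left out, as `greedy_cost_le` requires; their cost is added back in
  -- `i2`.
  let A : N.V → N.V → Bool → Bool → ℝ := fun v u β γ =>
    if u ∈ N.nbr v then (if cls N v = cls N u then 0 else K (d (X N v)) (d (X N u)) β γ) else 0
  have hsum : ∀ v, ∀ f : N.V → ℝ, (∑ u, if u ∈ N.nbr v then f u else 0) =
      ∑ u ∈ N.nbr v, f u := by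
    intro v f
    rw [Finset.sum_ite_mem, Finset.univ_inter]
  have hcost : ∀ v β, cost (X N v, cls N v) ((N.nbr v).val.map fun u =>
        (d (X N u), cls N u, stage (cls N v) N u)) β =
      Nc (d (X N v)) β + ∑ u, ∑ γ,
        marginal (cls N) (fun v => pr (d (X N v))) (bit N) (cls N v) u γ * A v u β γ := by
    intro v β
    simp only [cost, Multiset.map_map]
    congr 1
    have e1 : ∀ u, ∑ γ, marginal (cls N) (fun v => pr (d (X N v))) (bit N) (cls N v) u γ *
        A v u β γ = if u ∈ N.nbr v then (if cls N v = cls N u then 0 else ∑ γ,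
          mu (stage (cls N v) N u) (d (X N u)) γ * K (d (X N v)) (d (X N u)) β γ) else 0 := by
      intro u
      simp only [A, hmu]
      split_ifs <;> simp
    simp only [e1]
    rw [hsum]
    rfl
  have hmain := greedy_cost_le (cls N) (fun v => pr (d (X N v))) (bit N)
    (fun v => Nc (d (X N v))) A ?_ ?_ (hpr0 N hN) (hpr1 N hN) ?_
  · have e1 : ∀ v, ∑ u, A v u (bit N v) (bit N u) = ∑ u ∈ N.nbr v,
        (if cls N v = cls N u then 0 else K (d (X N v)) (d (X N u)) (bit N v) (bit N u)) :=
      fun v => hsum v _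
    have e2 : ∀ v, ∑ u, ∑ β, ∑ γ, pr (d (X N v)) β * pr (d (X N u)) γ * A v u β γ =
        ∑ u ∈ N.nbr v, ∑ β, ∑ γ, pr (d (X N v)) β * pr (d (X N u)) γ *
          (if cls N v = cls N u then 0 else K (d (X N v)) (d (X N u)) β γ) := by
      intro v
      rw [← hsum]
      refine Finset.sum_congr rfl fun u _ => ?_
      simp only [A]
      split_ifs <;> simp
    simp only [e1, e2] at hmain
    have i1 : ∑ v, ∑ u ∈ N.nbr v, ∑ β, ∑ γ, pr (d (X N v)) β * pr (d (X N u)) γ *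
          (if cls N v = cls N u then 0 else K (d (X N v)) (d (X N u)) β γ) ≤
        ∑ v, ∑ u ∈ N.nbr v, ∑ β, ∑ γ,
            pr (d (X N v)) β * pr (d (X N u)) γ * K (d (X N v)) (d (X N u)) β γ := by
      refine Finset.sum_le_sum fun v _ => Finset.sum_le_sum fun u _ => Finset.sum_le_sum fun β _ =>
        Finset.sum_le_sum fun γ _ => mul_le_mul_of_nonneg_left ?_
          (mul_nonneg (hpr0 N hN v β) (hpr0 N hN u γ))
      split_ifs
      · exact hK0 _ _ _ _
      · exact le_rfl
    -- The omitted edges are the defects of the coloring, so they carry at most an `e / q` fraction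
    -- of the weight `W`.
    have i2 : ∑ v, ∑ u ∈ N.nbr v, K (d (X N v)) (d (X N u)) (bit N v) (bit N u) ≤
        ∑ v, ∑ u ∈ N.nbr v,
          (if cls N v = cls N u then 0 else K (d (X N v)) (d (X N u)) (bit N v) (bit N u)) +
        (e : ℝ) / q * ∑ v, ∑ u ∈ N.nbr v, W (d (X N v)) (d (X N u)) := by
      rw [Finset.mul_sum, ← Finset.sum_add_distrib]
      refine Finset.sum_le_sum fun v _ => ?_
      have hdef := defectiveClass_weight_le (T := fun u => (N.nbr u).val.map fun w => d (X N w))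
        hq ψ W (d (X N v)) (N.nbr v)
        (fun u => d (X N u)) (fun u _ => hW0 _ _) (hψ N hN v) (fun u _ => hψ N hN u)
        (fun u hu h => by
          refine Finset.sum_eq_zero fun β _ => Finset.sum_eq_zero fun γ _ => ?_
          exact hne N hN v u ((N.G.mem_neighborFinset v u).1 hu) h.symm β γ)
      refine le_trans ?_ (add_le_add_right hdef _)
      rw [← Finset.sum_add_distrib]
      refine Finset.sum_le_sum fun u _ => ?_
      by_cases hc : cls N v = cls N u
      · rw [if_pos hc, if_pos hc.symm, zero_add]
        exact (Finset.single_le_sum (f := fun γ => K (d (X N v)) (d (X N u)) (bit N v) γ)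
          (fun _ _ => hK0 _ _ _ _) (Finset.mem_univ (bit N u))).trans
          (Finset.single_le_sum (f := fun β => ∑ γ, K (d (X N v)) (d (X N u)) β γ)
          (fun _ _ => Finset.sum_nonneg fun _ _ => hK0 _ _ _ _) (Finset.mem_univ (bit N v)))
      · rw [if_neg hc, if_neg (fun h => hc h.symm), add_zero]
    linarith
  · intro u v β γ
    simp only [A, nbr, SimpleGraph.mem_neighborFinset, N.G.adj_comm u v, hKs (d (X N u)),
      eq_comm (a := cls N u)]
  · intro u v β γ h
    simp [A, h]
  · intro v β hβ
    rw [← hcost, ← hcost]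
    conv_lhs => rw [hbit]
    exact (bestBit_spec _ (hpr0 N hN v) (hpr1 N hN v)).2 β hβ

theorem sum_nbr_swap (N : Network 𝒞) (f : N.V → N.V → ℝ) :
    ∑ v, ∑ u ∈ N.nbr v, f u v = ∑ v, ∑ u ∈ N.nbr v, f v u :=
  Finset.sum_comm' fun x y => by
    simp [nbr, SimpleGraph.mem_neighborFinset, N.G.adj_comm]

/-! ### Choosing candidates bit by bit -/

/-- The common residue modulo `2 ^ j` of the candidates. -/
def key (j : ℕ) (B : Finset ℕ) : ℕ := B.sup id % 2 ^ j

/-- The elements of a set of candidates agree modulo `2 ^ j`. -/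
def Agree (j : ℕ) (B : Finset ℕ) : Prop := ∀ x ∈ B, ∀ y ∈ B, x % 2 ^ j = y % 2 ^ j

theorem sup_id_mem {B : Finset ℕ} (hB : B.Nonempty) : B.sup id ∈ B := by
  obtain ⟨x, hx, h⟩ := Finset.exists_mem_eq_sup B hB id
  rw [h]
  exact hx

theorem Agree.key_eq {j : ℕ} {B : Finset ℕ} (h : Agree j B) {x : ℕ} (hx : x ∈ B) :
    key j B = x % 2 ^ j :=
  h _ (sup_id_mem ⟨x, hx⟩) _ hx

/-- The weighted expected number of conflicts if all active nodes choose a random candidate. -/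
noncomputable def conflicts (N : Network 𝒞) (act : N.V → Bool) (w : N.V → ℝ) (j : ℕ)
    (B : N.V → Finset ℕ) : ℝ :=
  ∑ v, ∑ u ∈ N.nbr v,
    if act v = true ∧ act u = true ∧ key j (B v) = key j (B u) then w v / (B v).card else 0

/-- What a node tells its neighbors: whether it is active, its color and its current residue, the
numbers of candidates that remain for each value of the next bit, and its weight class. -/
abbrev Report : Type := (Bool × ℕ × ℕ) × (ℕ × ℕ × ℕ)

/-- Number of candidates for a value of the next bit. -/
def Report.count (x : Report) (β : Bool) : ℕ := bif β then x.2.2.1 else x.2.1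

/-- All entries are below `m`. -/
def Report.Below (x : Report) (m : ℕ) : Prop :=
  (x.1.2.1 < m ∧ x.1.2.2 < m) ∧ x.2.1 < m ∧ x.2.2.1 < m ∧ x.2.2.2 < m

theorem pair_lt_sq {x y m : ℕ} (hx : x < m) (hy : y < m) : Nat.pair x y < m ^ 2 :=
  (Nat.pair_lt_max_add_one_sq x y).trans_le (Nat.pow_le_pow_left (by
    have := max_lt hx hy; omega) 2)

theorem encode_bool_lt {m : ℕ} (hm : 3 ≤ m) (β : Bool) : Encodable.encode β < m := by
  cases β <;> simp <;> omega

theorem Report.encode_lt {x : Report} {m : ℕ} (hm : 3 ≤ m) (hx : x.Below m) :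
    Encodable.encode x < m ^ 8 := by
  obtain ⟨⟨a, p, k⟩, ⟨b0, b1, g⟩⟩ := x
  obtain ⟨⟨h1, h2⟩, h3, h4, h5⟩ := hx
  have hm2 : m ≤ m ^ 2 := Nat.le_self_pow two_ne_zero m
  have e1 := pair_lt_sq ((encode_bool_lt hm a).trans_le hm2) (pair_lt_sq h1 h2)
  have e2 := pair_lt_sq (h3.trans_le hm2) (pair_lt_sq h4 h5)
  have e3 := pair_lt_sq e1 e2
  rw [← pow_mul, ← pow_mul] at e3
  simpa only [Encodable.encode_prod_val, Encodable.encode_nat] using e3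

theorem encode_option_bool_lt {m : ℕ} (hm : 3 ≤ m) (o : Option Bool) : Encodable.encode o < m := by
  rcases o with _ | _ | _
  · simp; omega
  · simp; omega
  · simp; omega

theorem Report.encode_lt' {x : Report} {m : ℕ} (hm : 3 ≤ m) (hx : x.Below m) {κ : ℕ} (hκ : κ < m)
    (o : Option Bool) : Encodable.encode (x, κ, o) < m ^ 16 := by
  have e1 := pair_lt_sq hκ (encode_option_bool_lt hm o)
  have e2 := pair_lt_sq (Report.encode_lt hm hx)
    (e1.trans_le (Nat.pow_le_pow_right (by omega) (by norm_num : 2 ≤ 8)))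
  rw [← pow_mul] at e2
  simpa only [Encodable.encode_prod_val, Encodable.encode_nat] using e2

/-- The number of candidates with a given next bit, set to zero if it is only a small fraction. -/
def trimmed (r j : ℕ) (B : Finset ℕ) (β : Bool) : ℕ :=
  if B.card ≤ 4 * r * (B.filter fun x => x.testBit j = β).card then
    (B.filter fun x => x.testBit j = β).card else 0

theorem trimmed_le (r j : ℕ) (B : Finset ℕ) (β : Bool) : trimmed r j B β ≤ B.card := by
  unfold trimmed
  split_ifs
  · exact Finset.card_filter_le _ _
  · exact Nat.zero_le _

/-- The two halves cannot both be trimmed, because 4r > 2. So at most |B|/(4r) candidates are lost.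
-/
theorem trimmed_add_ge {r : ℕ} (hr : 1 ≤ r) (j : ℕ) (B : Finset ℕ) :
    4 * r * B.card ≤ 4 * r * (trimmed r j B false + trimmed r j B true) + B.card := by
  have h : (B.filter fun x => x.testBit j = false).card +
      (B.filter fun x => x.testBit j = true).card = B.card := by
    rw [← Finset.card_filter_add_card_filter_not (s := B) (fun x => x.testBit j = false)]
    simp
  unfold trimmed
  generalize (B.filter fun x => x.testBit j = false).card = c at *
  generalize (B.filter fun x => x.testBit j = true).card = c' at *
  rw [← h]
  split_ifs <;> nlinarith

theorem trimmed_ne_zero {r j : ℕ} {B : Finset ℕ} {β : Bool} (h : trimmed r j B β ≠ 0) :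
    trimmed r j B β = (B.filter fun x => x.testBit j = β).card ∧
      B.card ≤ 4 * r * trimmed r j B β := by
  unfold trimmed at *
  split_ifs at * with h1
  · exact ⟨rfl, h1⟩
  · exact absurd rfl h

theorem mod_two_pow_succ_eq_iff (x y j : ℕ) : x % 2 ^ (j + 1) = y % 2 ^ (j + 1) ↔
    x % 2 ^ j = y % 2 ^ j ∧ x.testBit j = y.testBit j := by
  constructor
  · intro h
    constructor
    · have := congrArg (· % 2 ^ j) h
      simpa [Nat.mod_mod_of_dvd _ (pow_dvd_pow 2 (Nat.le_succ j))] using this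
    · have := congrArg (fun z => z.testBit j) h
      simpa [Nat.testBit_mod_two_pow] using this
  · rintro ⟨h1, h2⟩
    apply Nat.eq_of_testBit_eq
    intro i
    rw [Nat.testBit_mod_two_pow, Nat.testBit_mod_two_pow]
    rcases lt_trichotomy i j with h | rfl | h
    · have := congrArg (fun z => z.testBit i) h1
      simp only [Nat.testBit_mod_two_pow, h, decide_true, Bool.true_and] at this
      rw [this]
    · rw [h2]
    · simp [show ¬ i < j + 1 by omega]

/-- Probability of a value of the next bit. -/
noncomputable def Report.prob (x : Report) (β : Bool) : ℝ :=
  if x.2.1 + x.2.2.1 = 0 then 1 / 2 else x.count β / ((x.2.1 : ℝ) + x.2.2.1)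

theorem Report.prob_nonneg (x : Report) (β : Bool) : 0 ≤ x.prob β := by
  unfold Report.prob
  split_ifs <;> positivity

theorem Report.sum_prob (x : Report) : ∑ β, x.prob β = 1 := by
  rw [Fintype.sum_bool]
  unfold Report.prob
  split_ifs with h
  · norm_num
  · have : (x.2.1 : ℝ) + x.2.2.1 ≠ 0 := by exact_mod_cast h
    simp only [Report.count, cond_true, cond_false]
    field_simp
    ring

/-- Contribution of an edge to the conflicts after choosing the next bits. -/
noncomputable def Report.cost (w : ℕ → ℝ) (x y : Report) (β γ : Bool) : ℝ :=
  if x.1.1 = true ∧ y.1.1 = true ∧ x.1.2.2 = y.1.2.2 ∧ β = γ then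
    w x.2.2.2 / x.count β + w y.2.2.2 / y.count β else 0

theorem Report.cost_nonneg {w : ℕ → ℝ} (hw : ∀ g, 0 ≤ w g) (x y : Report) (β γ : Bool) :
    0 ≤ Report.cost w x y β γ := by
  unfold Report.cost
  have := hw x.2.2.2
  have := hw y.2.2.2
  split_ifs <;> positivity

theorem Report.cost_symm (w : ℕ → ℝ) (x y : Report) (β γ : Bool) :
    Report.cost w x y β γ = Report.cost w y x γ β := by
  unfold Report.cost
  by_cases h : x.1.1 = true ∧ y.1.1 = true ∧ x.1.2.2 = y.1.2.2 ∧ β = γ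
  · rw [if_pos h, if_pos ⟨h.2.1, h.1, h.2.2.1.symm, h.2.2.2.symm⟩, h.2.2.2, add_comm]
  · rw [if_neg h, if_neg fun h' => h ⟨h'.2.1, h'.1, h'.2.2.1.symm, h'.2.2.2.symm⟩]

/-- The report on a candidate set that is to be split by its `j`-th bit. -/
def mkReport (r j : ℕ) (act : Bool) (ψ g : ℕ) (B : Finset ℕ) : Report :=
  ((act, ψ, key j B), (trimmed r j B false, trimmed r j B true, g))

theorem mkReport_count (r j : ℕ) (act : Bool) (ψ g : ℕ) (B : Finset ℕ) (β : Bool) :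
    (mkReport r j act ψ g B).count β = trimmed r j B β := by
  cases β <;> rfl

theorem mkReport_below {m r j : ℕ} {act : Bool} {ψ g : ℕ} {B : Finset ℕ} (hψ : ψ < m)
    (hg : g < m) (hB : ∀ x ∈ B, x + 1 < m) : (mkReport r j act ψ g B).Below m := by
  have hc : B.card < m := by
    have : B ⊆ Finset.range (m - 1) := fun x hx => Finset.mem_range.2 (by have := hB x hx; omega)
    have := Finset.card_le_card this
    rw [Finset.card_range] at this
    omega
  refine ⟨⟨hψ, (Nat.mod_le _ _).trans_lt ?_⟩, (trimmed_le _ _ _ _).trans_lt hc,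
    (trimmed_le _ _ _ _).trans_lt hc, hg⟩
  rw [Finset.sup_lt_iff (by simp; omega)]
  intro x hx
  have := hB x hx
  simp
  omega

/-- The second bound is 4r/(4r-1) ≤ 1 + 1/(2r). The third holds since a surviving half has at least
|B|/(4r) elements, while a trimmed half contributes 0 because division by zero gives 0. Trimming
exists for the third bound: it limits how much a single bit can increase the weight per candidate,
and thereby the loss on the edges inside classes. -/
theorem trimmed_real_bounds {r j : ℕ} (hr : 1 ≤ r) {B : Finset ℕ} (hB : B.Nonempty) {w : ℝ}
    (hw : 0 ≤ w) :
    (0 < (trimmed r j B false : ℝ) + trimmed r j B true) ∧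
    w / ((trimmed r j B false : ℝ) + trimmed r j B true) ≤ (1 + 1 / (2 * r)) * (w / B.card) ∧
    ∀ β, w / trimmed r j B β ≤ 4 * r * (w / B.card) := by
  have hc : (1 : ℝ) ≤ B.card := by exact_mod_cast hB.card_pos
  have hr' : (1 : ℝ) ≤ r := by exact_mod_cast hr
  have h1 : 4 * (r : ℝ) * B.card ≤
      4 * r * ((trimmed r j B false : ℝ) + trimmed r j B true) + B.card := by
    exact_mod_cast trimmed_add_ge hr j B
  set s : ℝ := (trimmed r j B false : ℝ) + trimmed r j B true
  have hs : 0 < s := by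
    by_contra hs
    nlinarith
  refine ⟨hs, ?_, fun β => ?_⟩
  · have : B.card ≤ (1 + 1 / (2 * (r : ℝ))) * s := by
      have e : (1 + 1 / (2 * (r : ℝ))) * s = (2 * r + 1) * s / (2 * r) := by field_simp
      rw [e, le_div_iff₀ (by positivity)]
      nlinarith
    rw [div_le_iff₀ hs]
    calc w = w / B.card * B.card := by field_simp
      _ ≤ w / B.card * ((1 + 1 / (2 * (r : ℝ))) * s) :=
        mul_le_mul_of_nonneg_left this (by positivity)
      _ = _ := by ring
  · by_cases h0 : trimmed r j B β = 0
    · rw [h0]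
      simp only [Nat.cast_zero, div_zero]
      positivity
    · have h2 : (B.card : ℝ) ≤ 4 * r * trimmed r j B β := by exact_mod_cast (trimmed_ne_zero h0).2
      have h3 : (0 : ℝ) < trimmed r j B β := by exact_mod_cast Nat.pos_of_ne_zero h0
      rw [div_le_iff₀ h3]
      calc w = w / B.card * B.card := by field_simp
        _ ≤ w / B.card * (4 * r * trimmed r j B β) :=
          mul_le_mul_of_nonneg_left h2 (by positivity)
        _ = _ := by ring

/-- The increase 1/r has two equal parts. Trimming costs a factor 1 + 1/(2r) in expectation. On
edges inside classes the cost is at most 8r times the old one (4r for each value of the bit), and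
the fraction e/q ≤ 1/(16r²) of that is another 1/(2r). -/
theorem Known.split {P : Network 𝒞 → Prop} {b t : ℕ} {α : Type}
    {X : ∀ N : Network 𝒞, N.V → α} (hX : Known P b t X) (act : α → Bool) (ψ g : α → ℕ)
    (B : α → Finset ℕ) (w : ℕ → ℝ) (hw : ∀ x, 0 ≤ w x) {q e r m : ℕ} (j : ℕ) (hq : q.Prime)
    (hr : 1 ≤ r) (hqe : 16 * r ^ 2 * e ≤ q) (hm : 3 ≤ m) (hmb : m ^ 16 ≤ 2 ^ b)
    (hqm : q * q ≤ m) (hψm : ∀ N, P N → ∀ v, ψ (X N v) < m)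
    (hgm : ∀ N, P N → ∀ v, g (X N v) < m)
    (hBm : ∀ N, P N → ∀ v, ∀ x ∈ B (X N v), x + 1 < m)
    (hψ : ∀ N, P N → ∀ v, ψ (X N v) < 2 ^ (e + 1))
    (hne : ∀ N, P N → ∀ u v, N.G.Adj u v → act (X N u) = true → act (X N v) = true →
      ψ (X N u) ≠ ψ (X N v))
    (hB : ∀ N, P N → ∀ v, act (X N v) = true → (B (X N v)).Nonempty)
    (hag : ∀ N, P N → ∀ v, Agree j (B (X N v))) :
    ∃ C : ∀ N : Network 𝒞, N.V → Finset ℕ,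
      Known P b (t + (1 + q * q)) (fun N v => (X N v, C N v)) ∧
      ∀ N, P N → (∀ v, act (X N v) = true → (C N v).Nonempty) ∧
        (∀ v, C N v ⊆ B (X N v)) ∧ (∀ v, Agree (j + 1) (C N v)) ∧
        N.conflicts (fun v => act (X N v)) (fun v => w (g (X N v))) (j + 1) (C N) ≤
          (1 + 1 / r) *
          N.conflicts (fun v => act (X N v)) (fun v => w (g (X N v))) j (fun v => B (X N v)) := by
  classical
  let d : α → Report := fun x => mkReport r j (act x) (ψ x) (g x) (B x)
  have hd : ∀ N, P N → ∀ v, (d (X N v)).Below m := fun N hN v =>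
    mkReport_below (hψm N hN v) (hgm N hN v) (hBm N hN v)
  obtain ⟨bit, hk, hbit⟩ := hX.exists_bits d Report.prob (fun _ _ => 0) (Report.cost w)
    (fun x => x.1.2.1) (e := e) hq
    (fun N hN v κ hκ o =>
      (Report.encode_lt' hm (hd N hN v) (hκ.trans_le hqm) o).trans_le hmb)
    (fun N hN v => (Report.encode_lt hm (hd N hN v)).trans_le
      ((Nat.pow_le_pow_right (by omega) (by norm_num)).trans hmb))
    hψ (Report.cost_nonneg hw) (Report.cost_symm w)
    (fun N hN u v huv h β γ => by
      refine if_neg fun hc => ?_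
      exact hne N hN u v huv hc.1 hc.2.1 h)
    (fun N _ v β => Report.prob_nonneg _ _) (fun N _ v => Report.sum_prob _)
  let C : ∀ N : Network 𝒞, N.V → Finset ℕ := fun N v =>
    (B (X N v)).filter fun x => x.testBit j = bit N v
  have hCB : ∀ N v, C N v ⊆ B (X N v) := fun N v => Finset.filter_subset _ _
  refine ⟨C, ?_, fun N hN => ?_⟩
  · rw [← add_assoc]
    exact hk.map (fun x => (x.1, (B x.1).filter fun y => y.testBit j = x.2)) fun _ _ _ => rfl
  obtain ⟨hpos, hle⟩ := hbit N hN
  have hcnt : ∀ v, act (X N v) = true →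
      trimmed r j (B (X N v)) (bit N v) ≠ 0 := by
    intro v hv h0
    have h1 := hpos v
    have h2 := (trimmed_real_bounds (j := j) hr (hB N hN v hv) zero_le_one).1
    unfold Report.prob at h1
    rw [if_neg, mkReport_count, h0] at h1
    · simp at h1
    · intro h3
      have h4 : trimmed r j (B (X N v)) false + trimmed r j (B (X N v)) true = 0 := h3
      have h5 : (trimmed r j (B (X N v)) false : ℝ) + trimmed r j (B (X N v)) true = 0 := by
        exact_mod_cast h4
      exact h2.ne' h5
  have hCcard : ∀ v, act (X N v) = true →
      trimmed r j (B (X N v)) (bit N v) = (C N v).card := fun v hv =>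
    (trimmed_ne_zero (hcnt v hv)).1
  have hCne : ∀ v, act (X N v) = true → (C N v).Nonempty := by
    intro v hv
    rw [← Finset.card_pos, ← hCcard v hv]
    exact Nat.pos_of_ne_zero (hcnt v hv)
  have hCag : ∀ v, Agree (j + 1) (C N v) := by
    intro v x hx y hy
    rw [mod_two_pow_succ_eq_iff]
    exact ⟨hag N hN v x (hCB N v hx) y (hCB N v hy),
      (Finset.mem_filter.1 hx).2.trans (Finset.mem_filter.1 hy).2.symm⟩
  refine ⟨hCne, hCB N, hCag, ?_⟩
  let T : N.V → N.V → ℝ := fun v u =>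
    if act (X N v) = true ∧ act (X N u) = true ∧ key j (B (X N v)) = key j (B (X N u)) then
      w (g (X N v)) / (B (X N v)).card else 0
  let T' : N.V → N.V → ℝ := fun v u =>
    if act (X N v) = true ∧ act (X N u) = true ∧ key (j + 1) (C N v) = key (j + 1) (C N u) then
      w (g (X N v)) / (C N v).card else 0
  have hr0 : (0 : ℝ) < r := by exact_mod_cast hr
  have hsym : ∀ f : N.V → N.V → ℝ, ∑ v, ∑ u ∈ N.nbr v, (f v u + f u v) =
      2 * ∑ v, ∑ u ∈ N.nbr v, f v u := by
    intro f
    simp only [Finset.sum_add_distrib]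
    rw [sum_nbr_swap]
    ring
  have hTT : ∀ v u, act (X N v) = true → act (X N u) = true →
      key j (B (X N v)) = key j (B (X N u)) →
      T v u + T u v = w (g (X N v)) / (B (X N v)).card + w (g (X N u)) / (B (X N u)).card := by
    intro v u hv hu hk
    simp only [T]
    rw [if_pos ⟨hv, hu, hk⟩, if_pos ⟨hu, hv, hk.symm⟩]
  have hT0 : ∀ v u, 0 ≤ T v u := by
    intro v u
    simp only [T]
    have := hw (g (X N v))
    split_ifs <;> positivity
  -- Equal residues modulo `2 ^ (j + 1)` mean equal residues modulo `2 ^ j` and equal chosen bits,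
  -- exactly the event charged by `Report.cost`.
  have i1 : ∀ v u, T' v u + T' u v ≤
      Report.cost w (d (X N v)) (d (X N u)) (bit N v) (bit N u) := by
    intro v u
    by_cases hc : act (X N v) = true ∧ act (X N u) = true ∧
        key (j + 1) (C N v) = key (j + 1) (C N u)
    · obtain ⟨hv, hu, hk⟩ := hc
      simp only [T']
      rw [if_pos ⟨hv, hu, hk⟩, if_pos ⟨hu, hv, hk.symm⟩]
      have m1 := sup_id_mem (hCne v hv)
      have m2 := sup_id_mem (hCne u hu)
      have h3 := (mod_two_pow_succ_eq_iff _ _ _).1 hk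
      have h4 : bit N v = bit N u := by
        rw [← (Finset.mem_filter.1 m1).2, ← (Finset.mem_filter.1 m2).2]
        exact h3.2
      have h5 : key j (B (X N v)) = key j (B (X N u)) := by
        rw [(hag N hN v).key_eq (hCB N v m1), (hag N hN u).key_eq (hCB N u m2)]
        exact h3.1
      unfold Report.cost
      rw [if_pos ⟨hv, hu, h5, h4⟩]
      simp only [d]
      rw [mkReport_count, mkReport_count, hCcard v hv, h4, hCcard u hu]
      exact le_rfl
    · have h1 : T' v u = 0 := if_neg hc
      have h2 : T' u v = 0 := if_neg fun h => hc ⟨h.2.1, h.1, h.2.2.symm⟩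
      rw [h1, h2, add_zero]
      exact Report.cost_nonneg hw _ _ _ _
  have i2 : ∀ v u, ∑ β, ∑ γ, (d (X N v)).prob β * (d (X N u)).prob γ *
      Report.cost w (d (X N v)) (d (X N u)) β γ ≤ (1 + 1 / (2 * r)) * (T v u + T u v) := by
    intro v u
    by_cases hc : act (X N v) = true ∧ act (X N u) = true ∧
        key j (B (X N v)) = key j (B (X N u))
    · obtain ⟨hv, hu, hk⟩ := hc
      rw [hTT v u hv hu hk]
      have b1 := trimmed_real_bounds (j := j) hr (hB N hN v hv) (hw (g (X N v)))
      have b2 := trimmed_real_bounds (j := j) hr (hB N hN u hu) (hw (g (X N u)))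
      have e1 : ∀ z : N.V, 0 < (trimmed r j (B (X N z)) false : ℝ) + trimmed r j (B (X N z)) true →
          ∀ β, (d (X N z)).prob β = trimmed r j (B (X N z)) β /
          ((trimmed r j (B (X N z)) false : ℝ) + trimmed r j (B (X N z)) true) := by
        intro z hz β
        unfold Report.prob
        rw [if_neg, mkReport_count]
        · rfl
        · intro h
          have h : trimmed r j (B (X N z)) false + trimmed r j (B (X N z)) true = 0 := h
          have h5 : (trimmed r j (B (X N z)) false : ℝ) + trimmed r j (B (X N z)) true = 0 := by
            exact_mod_cast h
          exact hz.ne' h5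
      have e2 : ∀ β γ, Report.cost w (d (X N v)) (d (X N u)) β γ = if β = γ then
          w (g (X N v)) / trimmed r j (B (X N v)) β +
          w (g (X N u)) / trimmed r j (B (X N u)) β else 0 := by
        intro β γ
        unfold Report.cost
        simp only [d, mkReport_count]
        simp [mkReport, hv, hu, hk]
      -- The count cancels: the probability of a bit is count/total and the cost is w/count. What
      -- remains is w/total times the probability that the neighbor takes this bit, and these
      -- probabilities sum to 1.
      have hab : ∀ β, (d (X N v)).prob β * (d (X N u)).prob β *
          (w (g (X N v)) / trimmed r j (B (X N v)) β +
          w (g (X N u)) / trimmed r j (B (X N u)) β) ≤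
          (d (X N u)).prob β * (w (g (X N v)) /
            ((trimmed r j (B (X N v)) false : ℝ) + trimmed r j (B (X N v)) true)) +
          (d (X N v)).prob β * (w (g (X N u)) /
            ((trimmed r j (B (X N u)) false : ℝ) + trimmed r j (B (X N u)) true)) := by
        intro β
        have p1 := (d (X N v)).prob_nonneg β
        have p2 := (d (X N u)).prob_nonneg β
        have key1 : ∀ (a s ω : ℝ), 0 ≤ a → 0 < s → 0 ≤ ω → a / s * (ω / a) ≤ ω / s := by
          intro a s ω ha hs hω
          rcases ha.eq_or_lt with h | h
          · rw [← h]; simp; positivity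
          · apply le_of_eq; field_simp
        have k1 := key1 (trimmed r j (B (X N v)) β) _ _ (Nat.cast_nonneg _) b1.1
          (hw (g (X N v)))
        have k2 := key1 (trimmed r j (B (X N u)) β) _ _ (Nat.cast_nonneg _) b2.1
          (hw (g (X N u)))
        rw [← e1 v b1.1] at k1
        rw [← e1 u b2.1] at k2
        have l1 := mul_le_mul_of_nonneg_left k1 p2
        have l2 := mul_le_mul_of_nonneg_left k2 p1
        linarith
      calc _ = ∑ β, (d (X N v)).prob β * (d (X N u)).prob β *
          (w (g (X N v)) / trimmed r j (B (X N v)) β +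
          w (g (X N u)) / trimmed r j (B (X N u)) β) := by
            refine Finset.sum_congr rfl fun β _ => ?_
            simp only [e2, mul_ite, mul_zero, Finset.sum_ite_eq, Finset.mem_univ, if_true]
        _ ≤ _ := Finset.sum_le_sum fun β _ => hab β
        _ ≤ _ := by
            rw [Finset.sum_add_distrib, ← Finset.sum_mul, ← Finset.sum_mul, Report.sum_prob,
              Report.sum_prob, one_mul, one_mul, mul_add]
            exact add_le_add b1.2.1 b2.2.1
    · refine le_trans (Finset.sum_nonpos fun β _ => Finset.sum_nonpos fun γ _ => ?_)
        (mul_nonneg (by positivity) (add_nonneg (hT0 v u) (hT0 u v)))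
      have : Report.cost w (d (X N v)) (d (X N u)) β γ = 0 :=
        if_neg fun h => hc ⟨h.1, h.2.1, h.2.2.1⟩
      rw [this, mul_zero]
  have i3 : ∀ v u, ∑ β, ∑ γ, Report.cost w (d (X N v)) (d (X N u)) β γ ≤
      8 * r * (T v u + T u v) := by
    intro v u
    by_cases hc : act (X N v) = true ∧ act (X N u) = true ∧
        key j (B (X N v)) = key j (B (X N u))
    · obtain ⟨hv, hu, hk⟩ := hc
      rw [hTT v u hv hu hk]
      have b1 := (trimmed_real_bounds (j := j) hr (hB N hN v hv) (hw (g (X N v)))).2.2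
      have b2 := (trimmed_real_bounds (j := j) hr (hB N hN u hu) (hw (g (X N u)))).2.2
      have e2 : ∀ β γ, Report.cost w (d (X N v)) (d (X N u)) β γ = if β = γ then
          w (g (X N v)) / trimmed r j (B (X N v)) β +
          w (g (X N u)) / trimmed r j (B (X N u)) β else 0 := by
        intro β γ
        unfold Report.cost
        simp only [d, mkReport_count]
        simp [mkReport, hv, hu, hk]
      simp only [e2, Finset.sum_ite_eq, Finset.mem_univ, if_true]
      rw [Fintype.sum_bool]
      have := b1 true; have := b1 false; have := b2 true; have := b2 false
      linarith
    · refine le_trans (Finset.sum_nonpos fun β _ => Finset.sum_nonpos fun γ _ => ?_)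
        (mul_nonneg (by positivity) (add_nonneg (hT0 v u) (hT0 u v)))
      exact le_of_eq (if_neg fun h => hc ⟨h.1, h.2.1, h.2.2.1⟩)
  have s1 : 2 * ∑ v, ∑ u ∈ N.nbr v, T' v u ≤
      ∑ v, ∑ u ∈ N.nbr v, Report.cost w (d (X N v)) (d (X N u)) (bit N v) (bit N u) := by
    rw [← hsym]
    exact Finset.sum_le_sum fun v _ => Finset.sum_le_sum fun u _ => i1 v u
  have s2 : ∑ v, ∑ u ∈ N.nbr v, ∑ β, ∑ γ, (d (X N v)).prob β * (d (X N u)).prob γ *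
      Report.cost w (d (X N v)) (d (X N u)) β γ ≤
      (1 + 1 / (2 * r)) * (2 * ∑ v, ∑ u ∈ N.nbr v, T v u) := by
    rw [← hsym, Finset.mul_sum]
    refine Finset.sum_le_sum fun v _ => ?_
    rw [Finset.mul_sum]
    exact Finset.sum_le_sum fun u _ => i2 v u
  have s3 : ∑ v, ∑ u ∈ N.nbr v, ∑ β, ∑ γ, Report.cost w (d (X N v)) (d (X N u)) β γ ≤
      8 * r * (2 * ∑ v, ∑ u ∈ N.nbr v, T v u) := by
    rw [← hsym, Finset.mul_sum]
    refine Finset.sum_le_sum fun v _ => ?_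
    rw [Finset.mul_sum]
    exact Finset.sum_le_sum fun u _ => i3 v u
  have hS : 0 ≤ ∑ v, ∑ u ∈ N.nbr v, T v u :=
    Finset.sum_nonneg fun v _ => Finset.sum_nonneg fun u _ => hT0 v u
  have heq : (e : ℝ) / q ≤ 1 / (16 * r ^ 2) := by
    have hq0 : (0 : ℝ) < q := by exact_mod_cast hq.pos
    rw [div_le_div_iff₀ hq0 (by positivity), one_mul]
    have : (16 * r ^ 2 * e : ℝ) ≤ q := by exact_mod_cast hqe
    linarith
  have s4 := mul_le_mul heq s3 (Finset.sum_nonneg fun v _ => Finset.sum_nonneg fun u _ =>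
    Finset.sum_nonneg fun β _ => Finset.sum_nonneg fun γ _ => Report.cost_nonneg hw _ _ _ _)
    (by positivity)
  have e5 : 1 / (16 * (r : ℝ) ^ 2) * (8 * r * (2 * ∑ v, ∑ u ∈ N.nbr v, T v u)) =
      1 / r * ∑ v, ∑ u ∈ N.nbr v, T v u := by
    field_simp
    norm_num
  rw [e5] at s4
  have e6 : 1 / (2 * (r : ℝ)) = 1 / 2 * (1 / r) := by field_simp
  rw [e6] at s2
  change ∑ v, ∑ u ∈ N.nbr v, T' v u ≤ (1 + 1 / r) * ∑ v, ∑ u ∈ N.nbr v, T v u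
  simp only [mul_zero, Finset.sum_const_zero, zero_add] at hle
  linarith

theorem conflicts_nonneg (N : Network 𝒞) (act : N.V → Bool) {w : N.V → ℝ} (hw : ∀ v, 0 ≤ w v)
    (j : ℕ) (B : N.V → Finset ℕ) : 0 ≤ N.conflicts act w j B := by
  refine Finset.sum_nonneg fun v _ => Finset.sum_nonneg fun u _ => ?_
  have := hw v
  split_ifs <;> positivity

/-! ### Activation and partial colorings -/

/-- Probability to become active. -/
noncomputable def actProb (x : Report) (β : Bool) : ℝ :=
  if x.1.1 = true then (if β = true then 1 / 16 else 15 / 16) else 1 / 2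

/-- Gain from becoming active, as a negative cost. -/
noncomputable def actGain (w : ℕ → ℝ) (x : Report) (β : Bool) : ℝ :=
  if x.1.1 = true ∧ β = true then - w x.2.2.2 else 0

/-- Bound on the loss from activating both ends of an edge. -/
noncomputable def actCost (w : ℕ → ℝ) (x y : Report) (β γ : Bool) : ℝ :=
  if x.1.1 = true ∧ y.1.1 = true ∧ β = true ∧ γ = true then
    3 * (w x.2.2.2 / x.2.1 + w y.2.2.2 / y.2.1) else 0

/-- A subset of the participating nodes can be chosen such that its weight exceeds three times
the expected number of conflicts by a constant fraction of the total weight. -/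
theorem Known.activate {P : Network 𝒞 → Prop} {b t : ℕ} {α : Type}
    {X : ∀ N : Network 𝒞, N.V → α} (hX : Known P b t X) (act : α → Bool) (ψ g : α → ℕ)
    (B : α → Finset ℕ) (w : ℕ → ℝ) (hw : ∀ x, 0 ≤ w x) {q e m : ℕ} (hq : q.Prime)
    (hqe : 1024 * e ≤ q) (hm : 3 ≤ m) (hmb : m ^ 16 ≤ 2 ^ b)
    (hqm : q * q ≤ m) (hψm : ∀ N, P N → ∀ v, ψ (X N v) < m)
    (hgm : ∀ N, P N → ∀ v, g (X N v) < m)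
    (hBm : ∀ N, P N → ∀ v, ∀ x ∈ B (X N v), x + 1 < m)
    (hψ : ∀ N, P N → ∀ v, ψ (X N v) < 2 ^ (e + 1))
    (hne : ∀ N, P N → ∀ u v, N.G.Adj u v → act (X N u) = true → act (X N v) = true →
      ψ (X N u) ≠ ψ (X N v))
    (hB : ∀ N, P N → ∀ v, act (X N v) = true → (B (X N v)).Nonempty)
    (hdeg : ∀ N, P N → ∀ v, act (X N v) = true →
      ((N.nbr v).filter fun u => act (X N u) = true).card ≤ 2 * (B (X N v)).card) :
    ∃ bit : ∀ N : Network 𝒞, N.V → Bool,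
      Known P b (t + (1 + q * q)) (fun N v => (X N v, bit N v)) ∧
      ∀ N, P N →
        (1 / 64) * ∑ v, (if act (X N v) = true then w (g (X N v)) else 0) ≤
          ∑ v, (if (act (X N v) && bit N v) = true then w (g (X N v)) else 0) -
          3 * N.conflicts (fun v => act (X N v) && bit N v) (fun v => w (g (X N v))) 0
            (fun v => B (X N v)) := by
  classical
  -- The first count slot carries |B|, the denominator in `actCost`; the residue is 0 since no bit
  -- has been chosen yet.
  let d : α → Report := fun x => ((act x, ψ x, 0), ((B x).card, 0, g x))
  have hd : ∀ N, P N → ∀ v, (d (X N v)).Below m := by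
    intro N hN v
    refine ⟨⟨hψm N hN v, by simp only [d]; omega⟩, ?_, by simp only [d]; omega, hgm N hN v⟩
    have h1 : B (X N v) ⊆ Finset.range (m - 1) :=
      fun x hx => Finset.mem_range.2 (by have := hBm N hN v x hx; omega)
    have h2 := Finset.card_le_card h1
    rw [Finset.card_range] at h2
    simp only [d]
    omega
  have hc0 : ∀ x y β γ, 0 ≤ actCost w x y β γ := by
    intro x y β γ
    unfold actCost
    have := hw x.2.2.2
    have := hw y.2.2.2
    split_ifs <;> positivity
  obtain ⟨bit, hk, hbit⟩ := hX.exists_bits d actProb (actGain w) (actCost w)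
    (fun x => x.1.2.1) (e := e) hq
    (fun N hN v κ hκ o =>
      (Report.encode_lt' hm (hd N hN v) (hκ.trans_le hqm) o).trans_le hmb)
    (fun N hN v => (Report.encode_lt hm (hd N hN v)).trans_le
      ((Nat.pow_le_pow_right (by omega) (by norm_num)).trans hmb))
    hψ hc0
    (fun x y β γ => by
      unfold actCost
      by_cases h : x.1.1 = true ∧ y.1.1 = true ∧ β = true ∧ γ = true
      · rw [if_pos h, if_pos ⟨h.2.1, h.1, h.2.2.2, h.2.2.1⟩, add_comm]
      · rw [if_neg h, if_neg fun h' => h ⟨h'.2.1, h'.1, h'.2.2.2, h'.2.2.1⟩])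
    (fun N hN u v huv h β γ => by
      refine if_neg fun hc => ?_
      exact hne N hN u v huv hc.1 hc.2.1 h)
    (fun N _ v β => by unfold actProb; split_ifs <;> norm_num)
    (fun N _ v => by rw [Fintype.sum_bool]; unfold actProb; split_ifs <;> norm_num <;> contradiction)
  refine ⟨bit, by rw [← add_assoc]; exact hk, fun N hN => ?_⟩
  have hle := (hbit N hN).2
  let a : N.V → Prop := fun v => act (X N v) = true
  let ω : N.V → ℝ := fun v => w (g (X N v))
  let W : ℝ := ∑ v, if a v then ω v else 0
  let T : N.V → N.V → ℝ := fun v u => if a v ∧ a u then ω v / (B (X N v)).card else 0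
  have hω : ∀ v, 0 ≤ ω v := fun v => hw _
  have hW : 0 ≤ W := Finset.sum_nonneg fun v _ => by
    have := hω v
    split_ifs
    · exact this
    · exact le_rfl
  have hsym : ∀ f : N.V → N.V → ℝ, ∑ v, ∑ u ∈ N.nbr v, (f v u + f u v) =
      2 * ∑ v, ∑ u ∈ N.nbr v, f v u := by
    intro f
    simp only [Finset.sum_add_distrib]
    rw [sum_nbr_swap]
    ring
  -- At most 2|B| participating neighbors, each charging w/|B|.
  have hTW : ∑ v, ∑ u ∈ N.nbr v, T v u ≤ 2 * W := by
    rw [Finset.mul_sum]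
    refine Finset.sum_le_sum fun v _ => ?_
    by_cases hv : a v
    · have e1 : ∀ u, T v u = if a u then ω v / (B (X N v)).card else 0 := by
        intro u; simp only [T, hv, true_and]
      simp only [e1, if_pos hv]
      rw [← Finset.sum_filter, Finset.sum_const, nsmul_eq_mul]
      have h1 : (((N.nbr v).filter a).card : ℝ) ≤ 2 * (B (X N v)).card := by
        exact_mod_cast hdeg N hN v hv
      have h2 : (0 : ℝ) < (B (X N v)).card := by exact_mod_cast (hB N hN v hv).card_pos
      calc _ ≤ 2 * ((B (X N v)).card : ℝ) * (ω v / (B (X N v)).card) :=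
            mul_le_mul_of_nonneg_right h1 (div_nonneg (hω v) h2.le)
        _ = 2 * ω v := by field_simp
    · simp only [T, hv, false_and, if_false, Finset.sum_const_zero, mul_zero, le_refl]
  have hcost : ∀ v u β γ, actCost w (d (X N v)) (d (X N u)) β γ =
      if β = true ∧ γ = true then 3 * (T v u + T u v) else 0 := by
    intro v u β γ
    simp only [actCost, d, T, a, ω]
    by_cases h1 : act (X N v) = true <;> by_cases h2 : act (X N u) = true <;>
      by_cases h3 : β = true <;> by_cases h4 : γ = true <;> simp [h1, h2, h3, h4]
  have hgain : ∀ v β, actGain w (d (X N v)) β =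
      if a v ∧ β = true then - ω v else 0 := fun v β => rfl
  have x1 : ∑ v, ∑ β, actProb (d (X N v)) β * actGain w (d (X N v)) β = - (1 / 16) * W := by
    rw [Finset.mul_sum]
    refine Finset.sum_congr rfl fun v _ => ?_
    rw [Fintype.sum_bool]
    simp only [hgain]
    by_cases hv : a v
    · have : actProb (d (X N v)) true = 1 / 16 := by
        unfold actProb; rw [if_pos hv, if_pos rfl]
      simp [hv, this]
    · simp [hv]
  have x2 : ∑ v, ∑ u ∈ N.nbr v, ∑ β, ∑ γ, actProb (d (X N v)) β * actProb (d (X N u)) γ *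
      actCost w (d (X N v)) (d (X N u)) β γ = 3 / 256 * (2 * ∑ v, ∑ u ∈ N.nbr v, T v u) := by
    rw [← hsym, Finset.mul_sum]
    refine Finset.sum_congr rfl fun v _ => ?_
    rw [Finset.mul_sum]
    refine Finset.sum_congr rfl fun u _ => ?_
    simp only [hcost, Fintype.sum_bool]
    by_cases h : a v ∧ a u
    · have h1 : actProb (d (X N v)) true = 1 / 16 := by
        unfold actProb; rw [if_pos h.1, if_pos rfl]
      have h2 : actProb (d (X N u)) true = 1 / 16 := by
        unfold actProb; rw [if_pos h.2, if_pos rfl]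
      simp [h1, h2]
      ring
    · have h1 : T v u = 0 := if_neg h
      have h2 : T u v = 0 := if_neg fun h' => h h'.symm
      simp [h1, h2]
  have x3 : ∑ v, ∑ u ∈ N.nbr v, ∑ β, ∑ γ, actCost w (d (X N v)) (d (X N u)) β γ =
      3 * (2 * ∑ v, ∑ u ∈ N.nbr v, T v u) := by
    rw [← hsym, Finset.mul_sum]
    refine Finset.sum_congr rfl fun v _ => ?_
    rw [Finset.mul_sum]
    refine Finset.sum_congr rfl fun u _ => ?_
    simp [hcost]
  have x4 : ∑ v, actGain w (d (X N v)) (bit N v) =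
      - ∑ v, (if (act (X N v) && bit N v) = true then w (g (X N v)) else 0) := by
    rw [← Finset.sum_neg_distrib]
    refine Finset.sum_congr rfl fun v _ => ?_
    rw [hgain]
    simp only [a, ω, Bool.and_eq_true]
    split_ifs <;> simp
  have x5 : ∑ v, ∑ u ∈ N.nbr v, actCost w (d (X N v)) (d (X N u)) (bit N v) (bit N u) =
      6 * N.conflicts (fun v => act (X N v) && bit N v) (fun v => w (g (X N v))) 0
            (fun v => B (X N v)) := by
    have : ∀ v u, actCost w (d (X N v)) (d (X N u)) (bit N v) (bit N u) =
        3 * ((fun v u => if bit N v = true ∧ bit N u = true then T v u else 0) v u +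
        (fun v u => if bit N v = true ∧ bit N u = true then T v u else 0) u v) := by
      intro v u
      rw [hcost]
      simp only
      by_cases h : bit N v = true ∧ bit N u = true
      · rw [if_pos h, if_pos h, if_pos h.symm]
      · rw [if_neg h, if_neg h, if_neg fun h' => h h'.symm]; ring
    simp only [this, ← Finset.mul_sum]
    rw [hsym (fun v u => if bit N v = true ∧ bit N u = true then T v u else 0), ← mul_assoc]
    norm_num
    unfold conflicts
    refine Finset.sum_congr rfl fun v _ => Finset.sum_congr rfl fun u _ => ?_
    simp only [T, a, ω, key, pow_zero, Nat.mod_one]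
    by_cases h1 : act (X N v) = true <;> by_cases h2 : act (X N u) = true <;>
      by_cases h3 : bit N v = true <;> by_cases h4 : bit N u = true <;> simp [h1, h2, h3, h4]
  rw [x1, x2, x3, x4, x5] at hle
  have heq : (e : ℝ) / q ≤ 1 / 1024 := by
    have hq0 : (0 : ℝ) < q := by exact_mod_cast hq.pos
    rw [div_le_div_iff₀ hq0 (by norm_num), one_mul]
    have : (1024 * e : ℝ) ≤ q := by exact_mod_cast hqe
    linarith
  have heq' : (e : ℝ) / q * (3 * (2 * ∑ v, ∑ u ∈ N.nbr v, T v u)) ≤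
      1 / 1024 * (3 * (2 * (2 * W))) :=
    mul_le_mul heq (by linarith) (by
      have : 0 ≤ ∑ v, ∑ u ∈ N.nbr v, T v u := Finset.sum_nonneg fun v _ =>
        Finset.sum_nonneg fun u _ => by
          simp only [T]
          have := hω v
          split_ifs <;> positivity
      positivity) (by norm_num)
  -- The balance in units of W/1024: the expected gain is 64, the expected conflicts cost at most 24
  -- and the defects at most 6, which leaves 34 ≥ 16.
  change 1 / 64 * W ≤ _
  linarith

/-- Iteration of `Known.split` over all bits. -/
theorem Known.split_all {P : Network 𝒞 → Prop} {b t : ℕ} {α : Type}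
    {X : ∀ N : Network 𝒞, N.V → α} (hX : Known P b t X) (act : α → Bool) (ψ g : α → ℕ)
    (B : α → Finset ℕ) (w : ℕ → ℝ) (hw : ∀ x, 0 ≤ w x) {q e r m : ℕ} (hq : q.Prime)
    (hr : 1 ≤ r) (hqe : 16 * r ^ 2 * e ≤ q) (hm : 3 ≤ m) (hmb : m ^ 16 ≤ 2 ^ b)
    (hqm : q * q ≤ m) (hψm : ∀ N, P N → ∀ v, ψ (X N v) < m)
    (hgm : ∀ N, P N → ∀ v, g (X N v) < m)
    (hBm : ∀ N, P N → ∀ v, ∀ x ∈ B (X N v), x + 1 < m)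
    (hψ : ∀ N, P N → ∀ v, ψ (X N v) < 2 ^ (e + 1))
    (hne : ∀ N, P N → ∀ u v, N.G.Adj u v → act (X N u) = true → act (X N v) = true →
      ψ (X N u) ≠ ψ (X N v))
    (hB : ∀ N, P N → ∀ v, act (X N v) = true → (B (X N v)).Nonempty) (j : ℕ) :
    ∃ C : ∀ N : Network 𝒞, N.V → Finset ℕ,
      Known P b (t + j * (1 + q * q)) (fun N v => (X N v, C N v)) ∧
      ∀ N, P N → (∀ v, act (X N v) = true → (C N v).Nonempty) ∧
        (∀ v, C N v ⊆ B (X N v)) ∧ (∀ v, Agree j (C N v)) ∧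
        N.conflicts (fun v => act (X N v)) (fun v => w (g (X N v))) j (C N) ≤
          (1 + 1 / r) ^ j *
          N.conflicts (fun v => act (X N v)) (fun v => w (g (X N v))) 0 (fun v => B (X N v)) := by
  induction j with
  | zero =>
    refine ⟨fun N v => B (X N v), ?_, fun N hN => ⟨hB N hN, fun v => subset_rfl, ?_, ?_⟩⟩
    · rw [zero_mul, add_zero]
      exact hX.map (fun x => (x, B x)) fun _ _ _ => rfl
    · intro v x _ y _
      rw [pow_zero, Nat.mod_one, Nat.mod_one]
    · rw [pow_zero, one_mul]
  | succ j ih =>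
    obtain ⟨C, hC, hC'⟩ := ih
    obtain ⟨C₁, h1, h2⟩ := hC.split (fun x => act x.1) (fun x => ψ x.1) (fun x => g x.1)
      (fun x => x.2) w hw j hq hr hqe hm hmb hqm hψm hgm
      (fun N hN v x hx => hBm N hN v x ((hC' N hN).2.1 v hx)) hψ hne (fun N hN => (hC' N hN).1)
      (fun N hN => (hC' N hN).2.2.1)
    refine ⟨C₁, ?_, fun N hN => ⟨(h2 N hN).1, fun v =>
      ((h2 N hN).2.1 v).trans ((hC' N hN).2.1 v), (h2 N hN).2.2.1, ?_⟩⟩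
    · rw [add_mul, one_mul, ← add_assoc]
      exact h1.map (fun x => (x.1.1, x.2)) fun _ _ _ => rfl
    · refine (h2 N hN).2.2.2.trans ?_
      rw [pow_succ', mul_assoc]
      exact mul_le_mul_of_nonneg_left (hC' N hN).2.2.2 (by positivity)

theorem one_add_inv_pow_le_three {r : ℕ} (hr : 1 ≤ r) : (1 + 1 / (r : ℝ)) ^ r ≤ 3 := by
  have hr0 : (0 : ℝ) < r := by exact_mod_cast hr
  calc (1 + 1 / (r : ℝ)) ^ r ≤ Real.exp (1 / r) ^ r := by
        refine pow_le_pow_left₀ (by positivity) ?_ r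
        rw [add_comm]
        exact Real.add_one_le_exp _
    _ = Real.exp 1 := by rw [← Real.exp_nat_mul]; congr 1; field_simp
    _ ≤ 3 := by have := Real.exp_one_lt_d9; linarith

/-- A set of participating nodes that carries a constant fraction of the weight can choose
candidates such that neighbors choose differently. -/
theorem Known.exists_candidates {P : Network 𝒞 → Prop} {b t : ℕ} {α : Type}
    {X : ∀ N : Network 𝒞, N.V → α} (hX : Known P b t X) (part : α → Bool) (ψ g : α → ℕ)
    (B : α → Finset ℕ) (w : ℕ → ℝ) (hw : ∀ x, 0 ≤ w x) {q e r m : ℕ} (hq : q.Prime)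
    (hr : 1 ≤ r) (hqe : 1024 * r ^ 2 * e ≤ q) (hm : 3 ≤ m) (hmb : m ^ 16 ≤ 2 ^ b)
    (hqm : q * q ≤ m) (hrm : 2 ^ r < m) (hψm : ∀ N, P N → ∀ v, ψ (X N v) < m)
    (hgm : ∀ N, P N → ∀ v, g (X N v) < m)
    (hBr : ∀ N, P N → ∀ v, ∀ x ∈ B (X N v), x < 2 ^ r)
    (hψ : ∀ N, P N → ∀ v, ψ (X N v) < 2 ^ (e + 1))
    (hne : ∀ N, P N → ∀ u v, N.G.Adj u v → part (X N u) = true → part (X N v) = true →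
      ψ (X N u) ≠ ψ (X N v))
    (hB : ∀ N, P N → ∀ v, part (X N v) = true → (B (X N v)).Nonempty)
    (hdeg : ∀ N, P N → ∀ v, part (X N v) = true →
      ((N.nbr v).filter fun u => part (X N u) = true).card ≤ 2 * (B (X N v)).card) :
    ∃ val : ∀ N : Network 𝒞, N.V → Option ℕ,
      Known P b (t + ((r + 1) * (1 + q * q) + 1)) (fun N v => (X N v, val N v)) ∧
      ∀ N, P N →
        (∀ v x, val N v = some x → part (X N v) = true ∧ x ∈ B (X N v)) ∧
        (∀ u v x, N.G.Adj u v → val N u = some x → val N v ≠ some x) ∧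
        (1 / 64) * ∑ v, (if part (X N v) = true then w (g (X N v)) else 0) ≤
          ∑ v, (if (val N v).isSome = true then w (g (X N v)) else 0) := by
  classical
  have hBm : ∀ N, P N → ∀ v, ∀ x ∈ B (X N v), x + 1 < m := fun N hN v x hx => by
    have := hBr N hN v x hx
    omega
  have hr2 : 1 ≤ r ^ 2 := Nat.one_le_pow _ _ hr
  obtain ⟨bit, k1, h1⟩ := hX.activate part ψ g B w hw hq
    (le_trans (by nlinarith [Nat.mul_le_mul_right e hr2]) hqe) hm hmb hqm hψm hgm hBm hψ hne hB hdeg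
  obtain ⟨C, k2, h2⟩ := k1.split_all (fun x => part x.1 && x.2) (fun x => ψ x.1)
    (fun x => g x.1) (fun x => B x.1) w hw hq hr
    (le_trans (by nlinarith [Nat.zero_le (r ^ 2 * e)]) hqe) hm hmb hqm hψm
    hgm hBm hψ
    (fun N hN u v huv hu hv => hne N hN u v huv (by simp at hu; exact hu.1)
      (by simp at hv; exact hv.1))
    (fun N hN v hv => hB N hN v (by simp at hv; exact hv.1)) r
  let act : ∀ N : Network 𝒞, N.V → Bool := fun N v => part (X N v) && bit N v
  have k3 : Known P b (t + (1 + q * q) + r * (1 + q * q))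
      (fun N v => (X N v, act N v, key r (C N v))) :=
    k2.map (fun x => (x.1.1, part x.1.1 && x.1.2, key r x.2)) fun _ _ _ => rfl
  -- After `r` bits the candidate set of an active node is a singleton, as all candidates are below
  -- `2 ^ r`. The candidate is kept if no active neighbor has the same one.
  let val : ∀ N : Network 𝒞, N.V → Option ℕ := fun N v =>
    if act N v = true ∧ ∀ u ∈ N.nbr v, ¬ (act N u = true ∧ key r (C N u) = key r (C N v)) then
      some (key r (C N v)) else none
  have hkey : ∀ N, P N → ∀ v, act N v = true → key r (C N v) ∈ C N v ∧
      (C N v).card = 1 := by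
    intro N hN v hv
    have hne := (h2 N hN).1 v hv
    have hmod : ∀ x ∈ C N v, x % 2 ^ r = x := fun x hx =>
      Nat.mod_eq_of_lt (hBr N hN v x ((h2 N hN).2.1 v hx))
    have hs := sup_id_mem hne
    have hag := (h2 N hN).2.2.1 v
    have e1 : key r (C N v) = (C N v).sup id := hmod _ hs
    refine ⟨e1 ▸ hs, ?_⟩
    rw [Finset.card_eq_one]
    refine ⟨(C N v).sup id, Finset.eq_singleton_iff_unique_mem.2 ⟨hs, fun x hx => ?_⟩⟩
    rw [← hmod x hx, hag x hx _ hs, hmod _ hs]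
  refine ⟨val, ?_, fun N hN => ⟨?_, ?_, ?_⟩⟩
  · have k4 := k3.step (fun x => (x.2.1, x.2.2))
      (fun N hN v => by
        have : key r (C N v) < m := (Nat.mod_lt _ (by positivity)).trans hrm
        have := pair_lt_sq (encode_bool_lt hm (act N v)) this
        have := this.trans_le ((Nat.pow_le_pow_right (by omega)
          (by norm_num : 2 ≤ 16)).trans hmb)
        simpa only [Encodable.encode_prod_val, Encodable.encode_nat] using this)
      (fun x s => (x.1, if x.2.1 = true ∧ ∀ z ∈ s, ¬ (z.1 = true ∧ z.2 = x.2.2) then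
        some x.2.2 else none))
      (Y := fun N v => (X N v, val N v)) (fun N hN v => by
        simp only [val, Multiset.mem_map]
        congr 2
        simp only [eq_iff_iff]
        refine and_congr_right fun _ => ⟨?_, ?_⟩
        · rintro h z ⟨u, hu, rfl⟩
          exact h u hu
        · intro h u hu
          exact h _ ⟨u, hu, rfl⟩)
    convert k4 using 1
    ring
  · intro v x hx
    simp only [val] at hx
    split_ifs at hx with hc
    rw [Option.some.injEq] at hx
    subst hx
    refine ⟨?_, (h2 N hN).2.1 v (hkey N hN v hc.1).1⟩
    have := hc.1
    simp only [act, Bool.and_eq_true] at this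
    exact this.1
  · intro u v x huv hu hv
    simp only [val] at hu hv
    split_ifs at hu with hcu
    split_ifs at hv with hcv
    rw [Option.some.injEq] at hu hv
    exact hcu.2 v ((N.G.mem_neighborFinset u v).2 huv) ⟨hcv.1, hv.trans hu.symm⟩
  · refine (h1 N hN).trans ?_
    have hw0 : ∀ v : N.V, 0 ≤ w (g (X N v)) := fun v => hw _
    have c1 := (h2 N hN).2.2.2
    have c2 : (1 + 1 / (r : ℝ)) ^ r * N.conflicts (fun v => part (X N v) && bit N v)
        (fun v => w (g (X N v))) 0 (fun v => B (X N v)) ≤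
        3 * N.conflicts (fun v => part (X N v) && bit N v)
        (fun v => w (g (X N v))) 0 (fun v => B (X N v)) :=
      mul_le_mul_of_nonneg_right (one_add_inv_pow_le_three hr) (conflicts_nonneg N _ hw0 _ _)
    -- An active node that gives up has a neighbor with the same residue, and since its candidate
    -- set has one element this conflict alone counts its full weight.
    have c3 : ∑ v, (if act N v = true then w (g (X N v)) else 0) ≤
        ∑ v, (if (val N v).isSome = true then w (g (X N v)) else 0) +
        N.conflicts (act N) (fun v => w (g (X N v))) r (C N) := by
      unfold conflicts
      rw [← Finset.sum_add_distrib]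
      refine Finset.sum_le_sum fun v _ => ?_
      have hnn : ∀ u ∈ N.nbr v, 0 ≤ if act N v = true ∧ act N u = true ∧
          key r (C N v) = key r (C N u) then w (g (X N v)) / (C N v).card else 0 := by
        intro u _
        have := hw0 v
        split_ifs <;> positivity
      by_cases hv : act N v = true
      · rw [if_pos hv]
        by_cases hc : ∀ u ∈ N.nbr v, ¬ (act N u = true ∧ key r (C N u) = key r (C N v))
        · have : val N v = some (key r (C N v)) := if_pos ⟨hv, hc⟩
          rw [this, Option.isSome_some, if_pos rfl]
          exact le_add_of_nonneg_right (Finset.sum_nonneg hnn)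
        · have : val N v = none := if_neg fun h => hc h.2
          rw [this, Option.isSome_none, if_neg (by simp), zero_add]
          push Not at hc
          obtain ⟨u, hu, hau, hk⟩ := hc
          refine le_trans ?_ (Finset.single_le_sum hnn hu)
          rw [if_pos ⟨hv, hau, hk.symm⟩, (hkey N hN v hv).2]
          simp
      · rw [if_neg hv]
        refine add_nonneg ?_ (Finset.sum_nonneg hnn)
        have := hw0 v
        split_ifs <;> simp [this]
    have c1' : N.conflicts (act N) (fun v => w (g (X N v))) r (C N) ≤ _ := c1
    have c3' : ∑ v, (if (part (X N v) && bit N v) = true then w (g (X N v)) else 0) ≤ _ := c3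
    linarith

/-! ### Existence of a good family of hash functions -/

section Hash

variable [Fintype 𝒞]

/-- Resampling the value at `c` preserves the uniform distribution: exchanging the value `f c` with
the fresh value `x` is an involution. -/
theorem sum_update_eq [DecidableEq 𝒞] (R : ℕ) (c : 𝒞) (G : (𝒞 → Fin R) → ℕ) :
    ∑ f : 𝒞 → Fin R, ∑ x, G (Function.update f c x) = R * ∑ f, G f := by
  have hinv : Function.Involutive
      (fun p : (𝒞 → Fin R) × Fin R => (Function.update p.1 c p.2, p.1 c)) := by
    rintro ⟨f, x⟩
    simp
  rw [← Fintype.sum_prod_type' (f := fun f x => G (Function.update f c x))]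
  rw [Fintype.sum_equiv hinv.toPerm (fun p : (𝒞 → Fin R) × Fin R => G (Function.update p.1 c p.2))
    (fun p => G p.1) (fun p => rfl), Fintype.sum_prod_type]
  simp [Finset.mul_sum]

/-- Exponential moment of the number of collisions of a random function on a set. -/
theorem sum_pow_collisions_le [DecidableEq 𝒞] {R : ℕ} (s τ : ℕ) (hRs : R = 2 ^ (s + τ)) (S : Finset 𝒞) (hS : S.card ≤ 2 ^ s) :
    ∑ f : 𝒞 → Fin R, (2 ^ τ) ^ (S.card - (S.image f).card) ≤
      R ^ Fintype.card 𝒞 * 2 ^ S.card := by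
  classical
  induction S using Finset.induction_on with
  | empty => simp
  | insert c S hc ih =>
    rw [Finset.card_insert_of_notMem hc] at hS ⊢
    have ih := ih (by omega)
    have hR : 0 < R := by rw [hRs]; positivity
    refine Nat.le_of_mul_le_mul_left ?_ hR
    rw [← sum_update_eq R c]
    have himg : ∀ (f : 𝒞 → Fin R) x,
        (insert c S).image (Function.update f c x) = insert x (S.image f) := by
      intro f x
      rw [Finset.image_insert, Function.update_self]
      congr 1
      refine Finset.image_congr fun y hy => ?_
      exact Function.update_of_ne (by rintro rfl; exact hc hy) _ _
    -- A fresh value hits the old image for at most 2^s of the R = 2^(s+τ) choices, and a hit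
    -- multiplies the moment by 2^τ. So hits and misses contribute at most 1 each on average.
    have hpt : ∀ f : 𝒞 → Fin R,
        ∑ x, (2 ^ τ) ^ (S.card + 1 - ((insert c S).image (Function.update f c x)).card) ≤
          R * 2 * (2 ^ τ) ^ (S.card - (S.image f).card) := by
      intro f
      have hle : (S.image f).card ≤ S.card := Finset.card_image_le
      calc _ ≤ ∑ x, ((if x ∈ S.image f then (2 ^ τ) ^ (S.card - (S.image f).card) * 2 ^ τ else 0) +
            (2 ^ τ) ^ (S.card - (S.image f).card)) := by
            refine Finset.sum_le_sum fun x _ => ?_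
            rw [himg]
            split_ifs with hx
            · rw [Finset.insert_eq_self.2 hx, Nat.succ_sub hle, pow_succ]
              exact Nat.le_add_right _ _
            · rw [Finset.card_insert_of_notMem hx, Nat.add_sub_add_right, zero_add]
        _ ≤ 2 ^ s * ((2 ^ τ) ^ (S.card - (S.image f).card) * 2 ^ τ) +
            R * (2 ^ τ) ^ (S.card - (S.image f).card) := by
            rw [Finset.sum_add_distrib, ← Finset.sum_filter, Finset.sum_const, Finset.sum_const]
            simp only [smul_eq_mul, Finset.card_univ, Fintype.card_fin]
            refine Nat.add_le_add_right (Nat.mul_le_mul_right _ ?_) _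
            refine le_trans (Finset.card_le_card ?_) (hle.trans (by omega))
            intro x hx
            exact (Finset.mem_filter.1 hx).2
        _ = _ := by
            have hRs' : R = 2 ^ s * 2 ^ τ := by rw [hRs, pow_add]
            generalize (2 ^ τ) ^ (S.card - (S.image f).card) = z
            rw [hRs']; ring
    calc _ ≤ ∑ f : 𝒞 → Fin R,
          R * 2 * (2 ^ τ) ^ (S.card - (S.image f).card) :=
          Finset.sum_le_sum fun f _ => hpt f
      _ ≤ R * 2 * (R ^ Fintype.card 𝒞 * 2 ^ S.card) := by
          rw [← Finset.mul_sum]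
          exact Nat.mul_le_mul_left _ ih
      _ = _ := by rw [pow_succ]; ring

/-- Over all sets the sum is (1 + 4^(-T))^|𝒞| ≤ exp(2^(-T)) ≤ exp(1/2) < 2 by the binomial theorem,
and the excluded empty set accounts for 1. -/
theorem sum_pow_card_lt_one {T : ℕ} (hT : 1 ≤ T) (hC : Fintype.card 𝒞 ≤ 2 ^ T)
    (small : Finset (Finset 𝒞)) (hs : ∀ S ∈ small, S.Nonempty) :
    ∑ S ∈ small, (1 / 2 ^ (2 * T) : ℝ) ^ S.card < 1 := by
  classical
  have h3 : ∑ S ∈ small, (1 / 2 ^ (2 * T) : ℝ) ^ S.card + 1 ≤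
      ∑ S : Finset 𝒞, (1 / 2 ^ (2 * T) : ℝ) ^ S.card := by
    rw [← Finset.sum_erase_add _ _ (Finset.mem_univ (∅ : Finset 𝒞))]
    simp only [Finset.card_empty, pow_zero]
    refine add_le_add_left (Finset.sum_le_sum_of_subset_of_nonneg ?_ fun _ _ _ => by positivity) 1
    intro S hS
    exact Finset.mem_erase.2
      ⟨(hs S hS).ne_empty, Finset.mem_univ _⟩
  have h4 : ∑ S : Finset 𝒞, (1 / 2 ^ (2 * T) : ℝ) ^ S.card =
      (1 / 2 ^ (2 * T) + 1) ^ Fintype.card 𝒞 := by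
    have := Finset.sum_pow_mul_eq_add_pow (1 / 2 ^ (2 * T) : ℝ) 1 (Finset.univ : Finset 𝒞)
    simpa using this
  have h5 : (1 / 2 ^ (2 * T) + 1 : ℝ) ^ Fintype.card 𝒞 < 2 := by
    calc (1 / 2 ^ (2 * T) + 1 : ℝ) ^ Fintype.card 𝒞
        ≤ (1 / 2 ^ (2 * T) + 1) ^ (2 ^ T) :=
          pow_le_pow_right₀ (by simp) hC
      _ ≤ Real.exp (1 / 2 ^ (2 * T)) ^ (2 ^ T) :=
          pow_le_pow_left₀ (by positivity) (Real.add_one_le_exp _) _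
      _ = Real.exp (1 / 2 ^ T) := by
          rw [← Real.exp_nat_mul]
          congr 1
          push_cast
          rw [two_mul, pow_add]
          field_simp
      _ ≤ Real.exp (1 / 2) := by
          refine Real.exp_le_exp.2 (one_div_le_one_div_of_le (by norm_num) ?_)
          calc (2 : ℝ) = 2 ^ 1 := by norm_num
            _ ≤ 2 ^ T := pow_le_pow_right₀ (by norm_num) hT
      _ < 2 := by
          have h6 : Real.exp (1 / 2) ^ 2 = Real.exp 1 := by
            rw [← Real.exp_nat_mul]; norm_num
          have h7 := Real.exp_one_lt_d9
          have h8 := Real.exp_pos (1 / 2)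
          nlinarith
  linarith

/-- A union bound over sets of all sizes at once: the probability that `S` is badly treated must
decay like 4^(-T|S|) to beat the number of sets of that size, which is at most 2^(T|S|). -/
theorem exists_notMem_of_card_mul_pow_le {Ω : Type} [Fintype Ω] [Nonempty Ω] {T : ℕ} (hT : 1 ≤ T)
    (hC : Fintype.card 𝒞 ≤ 2 ^ T) (small : Finset (Finset 𝒞)) (hs : ∀ S ∈ small, S.Nonempty)
    (bad : Finset 𝒞 → Finset Ω)
    (hbad : ∀ S ∈ small, (bad S).card * 2 ^ (2 * S.card * T) ≤ Fintype.card Ω) :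
    ∃ h : Ω, ∀ S ∈ small, h ∉ bad S := by
  classical
  have hunion : (small.biUnion bad).card < Fintype.card Ω := by
    have hΩ : (0 : ℝ) < Fintype.card Ω := by
      exact_mod_cast Fintype.card_pos
    have h1 : ∀ S ∈ small, ((bad S).card : ℝ) ≤
        Fintype.card Ω * (1 / 2 ^ (2 * T)) ^ S.card := by
      intro S hS
      have h2 := hbad S hS
      have h3 : ((bad S).card : ℝ) * 2 ^ (2 * S.card * T) ≤ Fintype.card Ω := by exact_mod_cast h2
      rw [one_div, inv_pow, ← div_eq_mul_inv, le_div_iff₀ (by positivity), ← pow_mul]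
      rw [show 2 * T * S.card = 2 * S.card * T by ring]
      exact h3
    have h2 : ∑ S ∈ small, (1 / 2 ^ (2 * T) : ℝ) ^ S.card <  1 :=
      sum_pow_card_lt_one hT hC small hs
    have h3 : ((small.biUnion bad).card : ℝ) < Fintype.card Ω := by
      calc ((small.biUnion bad).card : ℝ) ≤ ∑ S ∈ small, ((bad S).card : ℝ) := by
            exact_mod_cast Finset.card_biUnion_le
        _ ≤ ∑ S ∈ small, Fintype.card Ω * (1 / 2 ^ (2 * T) : ℝ) ^ S.card := Finset.sum_le_sum h1
        _ = Fintype.card Ω * ∑ S ∈ small, (1 / 2 ^ (2 * T) : ℝ) ^ S.card := by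
            rw [Finset.mul_sum]
        _ < Fintype.card Ω * 1 := mul_lt_mul_of_pos_left h2 hΩ
        _ = _ := mul_one _
    exact_mod_cast h3
  by_contra! hcon
  have : small.biUnion bad = Finset.univ := Finset.eq_univ_of_forall fun h => by
    obtain ⟨S, hS, hSb⟩ := hcon h
    exact Finset.mem_biUnion.2 ⟨S, hS, hSb⟩
  rw [this, Finset.card_univ] at hunion
  exact lt_irrefl _ hunion

/-- A family of hash functions such that every small set is almost injectively mapped by all but a
small fraction of them. -/
theorem exists_hash (s T : ℕ) (hT : 1 ≤ T) (hC : Fintype.card 𝒞 ≤ 2 ^ T) :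
    ∃ h : ℕ → 𝒞 → ℕ, (∀ i c, h i c < 2 ^ (25 * s + 24)) ∧
      ∀ S : Finset 𝒞, S.Nonempty → S.card ≤ 2 ^ s →
        2 * (s + 1) * ((Finset.range T).filter fun i =>
          4 * (S.image (h i)).card < 3 * S.card).card ≤ T := by
  classical
  obtain ⟨R, hR⟩ : ∃ R, R = 2 ^ (s + 24 * (s + 1)) := ⟨_, rfl⟩
  have hR0 : 0 < R := by rw [hR]; positivity
  let Ω := Fin T → 𝒞 → Fin R
  let bad : Finset 𝒞 → Finset Ω := fun S => Finset.univ.filter fun h =>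
    T < 2 * (s + 1) * (Finset.univ.filter fun i => 4 * (S.image (h i)).card < 3 * S.card).card
  have hcardΩ : Fintype.card Ω = (R ^ Fintype.card 𝒞) ^ T := by
    simp [Ω]
  have hbad : ∀ S : Finset 𝒞, S.card ≤ 2 ^ s →
      (bad S).card * 2 ^ (2 * S.card * T) ≤ Fintype.card Ω := by
    intro S hS
    have h1 := Nat.pow_le_pow_left (sum_pow_collisions_le s (24 * (s + 1)) hR S hS) T
    rw [Fintype.sum_pow, mul_pow, ← hcardΩ] at h1
    -- Markov's inequality for the product of the moments. A bad family has more than T/(2(s+1))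
    -- members with over |S|/4 collisions each, so with 24(s+1) bits per collision the exponent is
    -- at least 3|S|T. The moment bound takes back |S|T, leaving the 2|S|T that the union bound
    -- needs.
    have h2 : (bad S).card * 2 ^ (3 * S.card * T) ≤
        ∑ p : Ω, ∏ i, (2 ^ (24 * (s + 1))) ^ (S.card - (S.image (p i)).card) := by
      refine le_trans ?_ (Finset.sum_le_sum_of_subset (Finset.subset_univ (bad S)))
      rw [← smul_eq_mul]
      refine Finset.card_nsmul_le_sum _ _ _ fun h hh => ?_
      have hh := (Finset.mem_filter.1 hh).2
      rw [Finset.prod_pow_eq_pow_sum, ← pow_mul]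
      refine Nat.pow_le_pow_right two_pos ?_
      set I := Finset.univ.filter fun i => 4 * (S.image (h i)).card < 3 * S.card
      have h3 : I.card * S.card ≤ 4 * ∑ i, (S.card - (S.image (h i)).card) := by
        rw [Finset.mul_sum]
        refine le_trans ?_ (Finset.sum_le_sum_of_subset (Finset.subset_univ I))
        rw [← smul_eq_mul]
        refine Finset.card_nsmul_le_sum _ _ _ fun i hi => ?_
        have := (Finset.mem_filter.1 hi).2
        omega
      calc 3 * S.card * T ≤ 3 * S.card * (2 * (s + 1) * I.card) := Nat.mul_le_mul_left _ hh.le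
        _ = 6 * (s + 1) * (I.card * S.card) := by ring
        _ ≤ 6 * (s + 1) * (4 * ∑ i, (S.card - (S.image (h i)).card)) := Nat.mul_le_mul_left _ h3
        _ = _ := by ring
    have h4 := h2.trans h1
    have h5 : 2 ^ (3 * S.card * T) = 2 ^ (2 * S.card * T) * (2 ^ S.card) ^ T := by
      rw [← pow_mul, ← pow_add]; congr 1; ring
    rw [h5, ← mul_assoc] at h4
    exact Nat.le_of_mul_le_mul_right h4 (by positivity)
  let small : Finset (Finset 𝒞) := Finset.univ.filter fun S => S.Nonempty ∧ S.card ≤ 2 ^ s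
  have : Nonempty Ω := ⟨fun _ _ => ⟨0, hR0⟩⟩
  obtain ⟨h, hh⟩ := exists_notMem_of_card_mul_pow_le hT hC small
    (fun S hS => (Finset.mem_filter.1 hS).2.1) bad
    (fun S hS => hbad S (Finset.mem_filter.1 hS).2.2)
  refine ⟨fun i c => if hi : i < T then (h ⟨i, hi⟩ c : ℕ) else 0, fun i c => ?_, fun S hS hSc => ?_⟩
  · have : 25 * s + 24 = s + 24 * (s + 1) := by ring
    rw [this, ← hR]
    dsimp only
    split_ifs
    · exact (h _ c).2
    · exact hR0
  · have hS' : h ∉ bad S := 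
      hh S (Finset.mem_filter.2 ⟨Finset.mem_univ _, hS, hSc⟩)
    simp only [bad, Finset.mem_filter, Finset.mem_univ, true_and, not_lt] at hS'
    refine le_trans (Nat.mul_le_mul_left _ ?_) hS'
    refine le_trans (Finset.card_le_card ?_)
      (Finset.card_image_le (f := fun i : Fin T => (i : ℕ)))
    intro i hi
    obtain ⟨hi1, hi2⟩ := Finset.mem_filter.1 hi
    have hi1 := Finset.mem_range.1 hi1
    refine Finset.mem_image.2 ⟨⟨i, hi1⟩, Finset.mem_filter.2 ⟨Finset.mem_univ _, ?_⟩, rfl⟩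
    have e1 : S.image (fun c => if hi : i < T then (h ⟨i, hi⟩ c : ℕ) else 0) =
        (S.image (h ⟨i, hi1⟩)).image (fun x : Fin R => (x : ℕ)) := by
      rw [Finset.image_image]
      refine Finset.image_congr fun c _ => ?_
      simp [hi1]
    rw [e1, Finset.card_image_of_injective _ Fin.val_injective] at hi2
    exact hi2

end Hash

/-! ### Announcing colors and reducing the number of colors -/

/-- Padding, used to keep the number of rounds fixed when a color reduction has nothing left to do.
-/
theorem Known.wait {P : Network 𝒞 → Prop} {b t : ℕ} {α : Type} {X : ∀ N : Network 𝒞, N.V → α}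
    (hX : Known P b t X) : Known P b (t + 1) X :=
  hX.step (fun _ => (0 : ℕ)) (fun _ _ _ => by simp) (fun x _ => x) fun _ _ _ => rfl

/-- All nodes can learn the colors of their neighbors in one round. -/
theorem Known.announce [Fintype 𝒞] {P : Network 𝒞 → Prop} {b t : ℕ} {α : Type}
    {X : ∀ N : Network 𝒞, N.V → α} (hX : Known P b t X) (f : α → Option 𝒞)
    (hC : Fintype.card 𝒞 < 2 ^ b) :
    Known P b (t + 1) (fun N v => (X N v, (N.nbr v).val.map fun u => f (X N u))) := by
  let E := Fintype.equivFin 𝒞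
  refine hX.step (fun x => (f x).map E) (fun N hN v => ?_)
    (fun x s => (x, s.map fun o => o.map E.symm)) fun N hN v => ?_
  · rcases f (X N v) with _ | c
    · simp
    · have : Encodable.encode (E c) = (E c : ℕ) := rfl
      rw [Option.map_some, Encodable.encode_some, this]
      have := (E c).2
      omega
  · simp only [Multiset.map_map]
    congr 2
    funext u
    simp

/-- One round of color reduction on the subgraph induced by a set of nodes. -/
theorem Known.reduce_colors {P : Network 𝒞 → Prop} {b t : ℕ} {α : Type}
    {X : ∀ N : Network 𝒞, N.V → α} (hX : Known P b t X) (U : α → Bool) (ψ : α → ℕ) {q e D m : ℕ}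
    (hq : q.Prime) (hqe : e * D < q) (hm : 3 ≤ m) (hmb : m ^ 16 ≤ 2 ^ b)
    (hψm : ∀ N, P N → ∀ v, ψ (X N v) < m)
    (hψ : ∀ N, P N → ∀ v, ψ (X N v) < 2 ^ (e + 1))
    (hne : ∀ N, P N → ∀ u v, N.G.Adj u v → U (X N u) = true → U (X N v) = true →
      ψ (X N u) ≠ ψ (X N v))
    (hdeg : ∀ N, P N → ∀ v, U (X N v) = true →
      ((N.nbr v).filter fun u => U (X N u) = true).card ≤ D) :
    ∃ φ : ∀ N : Network 𝒞, N.V → ℕ,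
      Known P b (t + 1) (fun N v => (X N v, φ N v)) ∧
      ∀ N, P N → (∀ v, φ N v < q * q) ∧
        ∀ u v, N.G.Adj u v → U (X N u) = true → U (X N v) = true → φ N u ≠ φ N v := by
  classical
  let d : α → Bool × ℕ := fun x => (U x, ψ x)
  let W : Bool × ℕ → Bool × ℕ → ℝ := fun x z =>
    if x.1 = true ∧ z.1 = true ∧ x.2 ≠ z.2 then 1 else 0
  have hW : ∀ x z, 0 ≤ W x z := fun x z => by simp only [W]; split_ifs <;> norm_num
  let φ : ∀ N : Network 𝒞, N.V → ℕ := fun N v =>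
    defectiveClass q e Prod.snd W (d (X N v)) ((N.nbr v).val.map fun u => d (X N u))
  refine ⟨φ, hX.step d (fun N hN v => ?_)
    (fun x s => (x, defectiveClass q e Prod.snd W (d x) s)) (fun _ _ _ => rfl),
    fun N hN => ⟨fun v => defectiveClass_lt hq _ _ _ _ _, ?_⟩⟩
  · have := pair_lt_sq (encode_bool_lt hm (U (X N v))) (hψm N hN v)
    have := this.trans_le ((Nat.pow_le_pow_right (by omega)
      (by norm_num : 2 ≤ 16)).trans hmb)
    simpa only [d, Encodable.encode_prod_val, Encodable.encode_nat] using this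
  · intro u v huv hu hv heq
    have h1 := defectiveClass_weight_le (T := fun u => (N.nbr u).val.map fun w => d (X N w))
      hq Prod.snd W (d (X N v)) (N.nbr v) (fun u => d (X N u)) (fun _ _ => hW _ _) (hψ N hN v)
      (fun u _ => hψ N hN u) (fun u _ h => if_neg fun h' => h'.2.2 h.symm)
    have hmem : u ∈ N.nbr v := (N.G.mem_neighborFinset v u).2 huv.symm
    have h2 : (1 : ℝ) ≤ ∑ u ∈ N.nbr v, if φ N u = φ N v then W (d (X N v)) (d (X N u)) else 0 := by
      refine le_trans ?_ (Finset.single_le_sum (fun w _ => ?_) hmem)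
      · rw [if_pos heq]
        simp only [W]
        rw [if_pos ⟨hv, hu, (hne N hN u v huv hu hv).symm⟩]
      · have := hW (d (X N v)) (d (X N w))
        split_ifs <;> simp [this]
    have h3 : ∑ u ∈ N.nbr v, W (d (X N v)) (d (X N u)) ≤ D := by
      calc ∑ u ∈ N.nbr v, W (d (X N v)) (d (X N u))
          ≤ ∑ u ∈ N.nbr v, if U (X N u) = true then (1 : ℝ) else 0 := by
            refine Finset.sum_le_sum fun w _ => ?_
            simp only [W]
            split_ifs with h4 h5 h5
            · exact le_rfl
            · exact absurd h4.2.1 h5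
            · norm_num
            · exact le_rfl
        _ = ((N.nbr v).filter fun u => U (X N u) = true).card := by simp
        _ ≤ D := by exact_mod_cast hdeg N hN v hv
    have hq0 : (0 : ℝ) < q := by exact_mod_cast hq.pos
    -- With unit weights a monochromatic edge would have weight 1, but the defect is below 1: the
    -- defective coloring is proper.
    have h4 : (e : ℝ) / q * D < 1 := by
      rw [div_mul_eq_mul_div, div_lt_one hq0]
      exact_mod_cast hqe
    have h5 : (e : ℝ) / q * ∑ u ∈ N.nbr v, W (d (X N v)) (d (X N u)) ≤ (e : ℝ) / q * D :=
      mul_le_mul_of_nonneg_left h3 (by positivity)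
    have h6 : (1 : ℝ) ≤ (e : ℝ) / q * ∑ u ∈ N.nbr v, W (d (X N v)) (d (X N u)) := h2.trans h1
    linarith

theorem succ_pow_four_le (e : ℕ) : (e + 1) ^ 4 ≤ 64 * 2 ^ e := by
  by_cases he : e < 6
  · interval_cases e <;> norm_num
  · push Not at he
    induction e, he using Nat.le_induction with
    | base => norm_num
    | succ e he ih =>
      rw [pow_succ 2 e]
      have : (e + 1 + 1) ^ 4 ≤ 2 * (e + 1) ^ 4 := by
        obtain ⟨k, rfl⟩ := Nat.exists_eq_add_of_le he
        ring_nf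
        nlinarith [Nat.zero_le (k ^ 4), Nat.zero_le (k ^ 3), Nat.zero_le (k ^ 2), Nat.zero_le k]
      omega

/-- Halving the number of colors is possible in one round if there are many. -/
theorem exists_prime_sq_le {D M : ℕ} (hM : 4096 * (D + 1) ^ 4 ≤ M) :
    ∃ q, q.Prime ∧ Nat.log 2 M * D < q ∧ 2 * (q * q) ≤ M := by
  obtain ⟨q, hq, h1, h2⟩ := Nat.exists_prime_lt_and_le_two_mul (Nat.log 2 M * D + 1)
    (by omega)
  refine ⟨q, hq, by omega, ?_⟩
  have hM0 : M ≠ 0 := by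
    have : 0 < (D + 1) ^ 4 := by positivity
    omega
  have h3 := Nat.pow_log_le_self 2 hM0
  set e := Nat.log 2 M
  have h4 : q ≤ 2 * ((e + 1) * (D + 1)) := by nlinarith
  have h5 : q * q ≤ 4 * ((e + 1) ^ 2 * (D + 1) ^ 2) := by nlinarith
  have h6 := succ_pow_four_le e
  -- One factor `M` pays for 4096(D+1)^4, the other for 2^e; the logarithm `e` is absorbed by
  -- (e+1)^4 ≤ 64 · 2^e.
  have h7 : (8 * ((e + 1) ^ 2 * (D + 1) ^ 2)) ^ 2 ≤ M ^ 2 := by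
    calc (8 * ((e + 1) ^ 2 * (D + 1) ^ 2)) ^ 2 = 64 * (D + 1) ^ 4 * (e + 1) ^ 4 := by ring
      _ ≤ 64 * (D + 1) ^ 4 * (64 * 2 ^ e) := Nat.mul_le_mul_left _ h6
      _ = (4096 * (D + 1) ^ 4) * 2 ^ e := by ring
      _ ≤ M * M := Nat.mul_le_mul hM h3
      _ = M ^ 2 := by ring
  have h8 := (Nat.pow_le_pow_iff_left two_ne_zero).1 h7
  omega

/-- Iterated color reduction. -/
theorem Known.exists_coloring {P : Network 𝒞 → Prop} {b t : ℕ} {α : Type}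
    {X : ∀ N : Network 𝒞, N.V → α} (hX : Known P b t X) (U : α → Bool) (ψ : α → ℕ) {D M m : ℕ}
    (hm : 3 ≤ m) (hmb : m ^ 16 ≤ 2 ^ b) (hMm : M ≤ m)
    (hψ : ∀ N, P N → ∀ v, ψ (X N v) < M)
    (hne : ∀ N, P N → ∀ u v, N.G.Adj u v → U (X N u) = true → U (X N v) = true →
      ψ (X N u) ≠ ψ (X N v))
    (hdeg : ∀ N, P N → ∀ v, U (X N v) = true →
      ((N.nbr v).filter fun u => U (X N u) = true).card ≤ D) :
    ∃ φ : ∀ N : Network 𝒞, N.V → ℕ,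
      Known P b (t + (Nat.log 2 M + 1)) (fun N v => (X N v, φ N v)) ∧
      ∀ N, P N → (∀ v, φ N v < 4096 * (D + 1) ^ 4) ∧
        ∀ u v, N.G.Adj u v → U (X N u) = true → U (X N v) = true → φ N u ≠ φ N v := by
  have key : ∀ i, ∃ φ : ∀ N : Network 𝒞, N.V → ℕ,
      Known P b (t + i) (fun N v => (X N v, φ N v)) ∧
      ∀ N, P N → (∀ v, φ N v < max (4096 * (D + 1) ^ 4) (M / 2 ^ i)) ∧
        ∀ u v, N.G.Adj u v → U (X N u) = true → U (X N v) = true → φ N u ≠ φ N v := by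
    intro i
    induction i with
    | zero =>
      refine ⟨fun N v => ψ (X N v), hX.map (fun x => (x, ψ x)) fun _ _ _ => rfl,
        fun N hN => ⟨fun v => ?_, hne N hN⟩⟩
      rw [pow_zero, Nat.div_one]
      exact (hψ N hN v).trans_le (le_max_right _ _)
    | succ i ih =>
      obtain ⟨φ, h1, h2⟩ := ih
      by_cases hc : M / 2 ^ i ≤ 4096 * (D + 1) ^ 4
      · refine ⟨φ, h1.wait, fun N hN => ⟨fun v => ?_, (h2 N hN).2⟩⟩
        have := (h2 N hN).1 v
        rw [max_eq_left hc] at this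
        exact this.trans_le (le_max_left _ _)
      · push Not at hc
        obtain ⟨q, hq, hqe, hqM⟩ := exists_prime_sq_le hc.le
        have h3 : ∀ N, P N → ∀ v, φ N v < M / 2 ^ i := fun N hN v => by
          have := (h2 N hN).1 v
          rwa [max_eq_right hc.le] at this
        obtain ⟨φ', h4, h5⟩ := h1.reduce_colors (fun x => U x.1) (fun x => x.2)
          (e := Nat.log 2 (M / 2 ^ i)) hq hqe hm hmb
          (fun N hN v => (h3 N hN v).trans_le ((Nat.div_le_self _ _).trans hMm))
          (fun N hN v => (h3 N hN v).trans (Nat.lt_pow_succ_log_self one_lt_two _))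
          (fun N hN => (h2 N hN).2) hdeg
        refine ⟨φ', h4.map (fun x => (x.1.1, x.2)) fun _ _ _ => rfl,
          fun N hN => ⟨fun v => ?_, (h5 N hN).2⟩⟩
        refine ((h5 N hN).1 v).trans_le (le_trans ?_ (le_max_right _ _))
        rw [pow_succ, ← Nat.div_div_eq_div_mul]
        omega
  obtain ⟨φ, h1, h2⟩ := key (Nat.log 2 M + 1)
  refine ⟨φ, h1, fun N hN => ⟨fun v => ?_, (h2 N hN).2⟩⟩
  have := (h2 N hN).1 v
  rwa [Nat.div_eq_of_lt (Nat.lt_pow_succ_log_self one_lt_two _), max_eq_left (Nat.zero_le _)]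
    at this

/-! ### Coloring a layer of small degree -/

/-- The state of a node during the coloring of a layer: a base set of colors, the colors that are
still available, the number of rounds of participation, and the chosen color. -/
structure LayerState (𝒞 : Type) where
  base : Finset 𝒞
  avail : Finset 𝒞
  g : ℕ
  col : Option 𝒞

open Classical in
/-- A hash function maps a set of colors almost injectively. -/
def Good (h : ℕ → 𝒞 → ℕ) (i : ℕ) (S : Finset 𝒞) : Prop := 3 * S.card ≤ 4 * (S.image (h i)).card

open Classical in
/-- Number of hash functions among the first `i` that are not good for `S`. -/
noncomputable def badCount (h : ℕ → 𝒞 → ℕ) (i : ℕ) (S : Finset 𝒞) : ℕ :=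
  ((Finset.range i).filter fun j => ¬ Good h j S).card

open Classical in
theorem badCount_mono (h : ℕ → 𝒞 → ℕ) {i j : ℕ} (hij : i ≤ j) (S : Finset 𝒞) :
    badCount h i S ≤ badCount h j S :=
  Finset.card_le_card (Finset.filter_subset_filter _ (Finset.range_subset_range.2 hij))

open Classical in
theorem badCount_succ {h : ℕ → 𝒞 → ℕ} {i : ℕ} {S : Finset 𝒞} (hS : ¬ Good h i S) :
    badCount h (i + 1) S = badCount h i S + 1 := by
  unfold badCount
  rw [Finset.range_add_one, Finset.filter_insert, if_pos hS, Finset.card_insert_of_notMem]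
  simp

/-- Nodes of the layer `U` that are not colored yet. -/
def Alive {V : Type} (U : V → Bool) (σ : V → LayerState 𝒞) (v : V) : Prop :=
  U v = true ∧ (σ v).col = none

open Classical in
/-- The invariant of the iterations that color a layer. -/
structure LayerInv (N : Network 𝒞) (U : N.V → Bool) (Ls : N.V → Finset 𝒞) (h : ℕ → 𝒞 → ℕ)
    (s β i : ℕ) (σ : N.V → LayerState 𝒞) : Prop where
  col_mem : ∀ v c, (σ v).col = some c → U v = true ∧ c ∈ Ls v
  col_ne : ∀ u v c, N.G.Adj u v → (σ u).col = some c → (σ v).col ≠ some c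
  g_le : ∀ v, (σ v).g ≤ i
  avail_sub : ∀ v, Alive U σ v → (σ v).avail ⊆ (σ v).base ∧ (σ v).avail ⊆ Ls v
  avail_free : ∀ u v c, N.G.Adj u v → Alive U σ v → (σ u).col = some c → c ∉ (σ v).avail
  deg_lt : ∀ v, Alive U σ v → ((N.nbr v).filter (Alive U σ)).card < (σ v).avail.card
  base_le : ∀ v, Alive U σ v → (σ v).base.card ≤ 2 * (σ v).avail.card
  -- Here `ρ` bounds the number of replacements of the base, each of which at least halves it. Every
  -- iteration is a participation, or a bad function for the current base, or belongs to one of the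
  -- at most `β` bad ones of a former base.
  progress : ∀ v, Alive U σ v → ∃ ρ, 2 ^ ρ * (σ v).base.card ≤ 2 ^ s ∧
    i ≤ (σ v).g + β * ρ + badCount h i (σ v).base
  weight : ∑ v, (if Alive U σ v then (64 / 63 : ℝ) ^ (σ v).g else 0) ≤ Fintype.card N.V

open Classical in
/-- The update of the state of a node, given its new color and the new colors of its neighbors. -/
noncomputable def LayerState.update (x : LayerState 𝒞) (part : Bool) (new : Option 𝒞)
    (taken : Multiset (Option 𝒞)) : LayerState 𝒞 :=
  let a := x.avail.filter fun c => some c ∉ taken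
  { base := if x.base.card ≤ 2 * a.card then x.base else a
    avail := a
    g := if part = true then x.g + 1 else x.g
    col := if x.col = none then new else x.col }

open Classical in
-- A newly colored neighbor removes at most one available color but also one uncolored neighbor, so
-- the slack of the list survives. The weight does not grow: participants that stay uncolored gain a
-- factor 64/63, and at least a 1/64 fraction of the participating weight disappears.
theorem LayerInv.update {N : Network 𝒞} {U : N.V → Bool} {Ls : N.V → Finset 𝒞} {h : ℕ → 𝒞 → ℕ}
    {s β i : ℕ} {σ : N.V → LayerState 𝒞} (inv : LayerInv N U Ls h s β i σ)
    (hβ : ∀ S : Finset 𝒞, S.Nonempty → S.card ≤ 2 ^ s → ∀ j ≤ i + 1, badCount h j S ≤ β)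
    (part : N.V → Bool) (hpart : ∀ v, part v = true ↔ Alive U σ v ∧ Good h i (σ v).base)
    (new : N.V → Option 𝒞)
    (hnew : ∀ v c, new v = some c → part v = true ∧ c ∈ (σ v).avail)
    (hne : ∀ u v c, N.G.Adj u v → new u = some c → new v ≠ some c)
    (hw : (1 / 64) * ∑ v, (if part v = true then (64 / 63 : ℝ) ^ (σ v).g else 0) ≤
          ∑ v, (if (new v).isSome = true then (64 / 63 : ℝ) ^ (σ v).g else 0)) :
    LayerInv N U Ls h s β (i + 1)
      (fun v => (σ v).update (part v) (new v) ((N.nbr v).val.map new)) := by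
  set σ' : N.V → LayerState 𝒞 :=
    fun v => (σ v).update (part v) (new v) ((N.nbr v).val.map new) with hσ'
  have hav : ∀ v c, c ∈ (σ' v).avail ↔ c ∈ (σ v).avail ∧ ∀ u ∈ N.nbr v, new u ≠ some c := by
    intro v c
    simp [hσ', LayerState.update]
  have hcol : ∀ v, (σ' v).col = if (σ v).col = none then new v else (σ v).col := fun v => rfl
  have hg : ∀ v, (σ' v).g = if part v = true then (σ v).g + 1 else (σ v).g := fun v => rfl
  have hbase : ∀ v, (σ' v).base = if (σ v).base.card ≤ 2 * (σ' v).avail.card then (σ v).base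
      else (σ' v).avail := fun v => rfl
  have halive : ∀ v, Alive U σ' v ↔ Alive U σ v ∧ new v = none := by
    intro v
    unfold Alive
    rw [hcol]
    by_cases h : (σ v).col = none
    · simp [h]
    · simp [h]
  have hnewal : ∀ v c, new v = some c → Alive U σ v := fun v c hc =>
    ((hpart v).1 (hnew v c hc).1).1
  have hcol' : ∀ v c, (σ' v).col = some c → (σ v).col = some c ∨ new v = some c := by
    intro v c hc
    rw [hcol] at hc
    split_ifs at hc
    · exact Or.inr hc
    · exact Or.inl hc
  have havsub : ∀ v, (σ' v).avail ⊆ (σ v).avail := fun v c hc => ((hav v c).1 hc).1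
  have hdeg : ∀ v, Alive U σ v →
      ((N.nbr v).filter (Alive U σ')).card < (σ' v).avail.card := by
    intro v hv
    have h1 := inv.deg_lt v hv
    let R := (N.nbr v).filter fun u => new u ≠ none
    have h2 : ((N.nbr v).filter (Alive U σ')).card + R.card ≤
        ((N.nbr v).filter (Alive U σ)).card := by
      rw [← Finset.card_union_of_disjoint]
      · apply Finset.card_le_card
        intro u hu
        rcases Finset.mem_union.1 hu with hu | hu
        · obtain ⟨a1, a2⟩ := Finset.mem_filter.1 hu
          exact Finset.mem_filter.2 ⟨a1, ((halive u).1 a2).1⟩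
        · obtain ⟨a1, a2⟩ := Finset.mem_filter.1 hu
          obtain ⟨c, hc⟩ := Option.ne_none_iff_exists'.1 a2
          exact Finset.mem_filter.2 ⟨a1, hnewal u c hc⟩
      · rw [Finset.disjoint_left]
        intro u hu hu'
        exact (Finset.mem_filter.1 hu').2 ((halive u).1 (Finset.mem_filter.1 hu).2).2
    have h3 : (σ v).avail.card ≤ (σ' v).avail.card + R.card := by
      have h4 : (σ v).avail ⊆ (σ' v).avail ∪ (R.image new).biUnion fun o => o.toFinset := by
        intro c hc
        by_cases hc' : c ∈ (σ' v).avail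
        · exact Finset.mem_union_left _ hc'
        · rw [hav] at hc'
          push Not at hc'
          obtain ⟨u, hu, huc⟩ := hc' hc
          refine Finset.mem_union_right _ (Finset.mem_biUnion.2 ⟨some c, ?_, by simp⟩)
          exact Finset.mem_image.2 ⟨u, Finset.mem_filter.2 ⟨hu, by simp [huc]⟩, huc⟩
      refine (Finset.card_le_card h4).trans ((Finset.card_union_le _ _).trans ?_)
      refine Nat.add_le_add_left ?_ _
      refine (Finset.card_biUnion_le_card_mul _ _ 1 fun o _ => ?_).trans ?_
      · rcases o with _ | c <;> simp
      · rw [mul_one]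
        exact Finset.card_image_le
    omega
  constructor
  · intro v c hc
    rcases hcol' v c hc with h1 | h1
    · exact inv.col_mem v c h1
    · have h2 := hnewal v c h1
      exact ⟨h2.1, (inv.avail_sub v h2).2 (hnew v c h1).2⟩
  · intro u v c huv hu hv
    rcases hcol' u c hu with h1 | h1 <;> rcases hcol' v c hv with h2 | h2
    · exact inv.col_ne u v c huv h1 h2
    · exact inv.avail_free u v c huv (hnewal v c h2) h1 (hnew v c h2).2
    · exact inv.avail_free v u c huv.symm (hnewal u c h1) h2 (hnew u c h1).2
    · exact hne u v c huv h1 h2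
  · intro v
    have := inv.g_le v
    rw [hg]
    split_ifs <;> omega
  · intro v hv
    have hv := ((halive v).1 hv).1
    refine ⟨?_, (havsub v).trans (inv.avail_sub v hv).2⟩
    rw [hbase]
    split_ifs
    · exact (havsub v).trans (inv.avail_sub v hv).1
    · exact subset_rfl
  · intro u v c huv hv hu hc
    have hv := ((halive v).1 hv).1
    rcases hcol' u c hu with h1 | h1
    · exact inv.avail_free u v c huv hv h1 (havsub v hc)
    · exact ((hav v c).1 hc).2 u ((N.G.mem_neighborFinset v u).2 huv.symm) h1
  · intro v hv
    exact hdeg v ((halive v).1 hv).1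
  · intro v hv
    rw [hbase]
    split_ifs with h1
    · exact h1
    · omega
  · intro v hv
    have hv := ((halive v).1 hv).1
    obtain ⟨ρ, h1, h2⟩ := inv.progress v hv
    have hbn : (σ v).base.Nonempty := by
      have := inv.deg_lt v hv
      exact (Finset.card_pos.1 (by omega)).mono (inv.avail_sub v hv).1
    have hbs : (σ v).base.card ≤ 2 ^ s :=
      (Nat.le_mul_of_pos_left _ (by positivity)).trans h1
    have h3 : i + 1 ≤ (σ' v).g + β * ρ + badCount h (i + 1) (σ v).base := by
      rw [hg]
      by_cases hp : part v = true
      · rw [if_pos hp]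
        have := badCount_mono h (Nat.le_succ i) (σ v).base
        have e : i.succ = i + 1 := rfl
        rw [e] at this
        omega
      · rw [if_neg hp, badCount_succ fun hgood => hp ((hpart v).2 ⟨hv, hgood⟩)]
        omega
    -- If the base is replaced, its bad iterations, at most `β`, are charged to the increment of
    -- `ρ`, and the count for the new base may start from any value.
    by_cases hc : (σ v).base.card ≤ 2 * (σ' v).avail.card
    · refine ⟨ρ, ?_, ?_⟩
      · rwa [hbase, if_pos hc]
      · rwa [hbase, if_pos hc]
    · refine ⟨ρ + 1, ?_, ?_⟩
      · rw [hbase, if_neg hc, pow_succ, mul_assoc]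
        push Not at hc
        exact (Nat.mul_le_mul_left _ hc.le).trans h1
      · have := hβ _ hbn hbs (i + 1) le_rfl
        rw [mul_add, mul_one]
        omega
  · refine le_trans ?_ inv.weight
    -- A new color takes away w and the gain w/63 credited for participating, together 64/63 · w.
    have e1 : ∀ v, (if Alive U σ' v then (64 / 63 : ℝ) ^ (σ' v).g else 0) ≤
        (if Alive U σ v then (64 / 63 : ℝ) ^ (σ v).g else 0) +
        (1 / 63) * (if part v = true then (64 / 63 : ℝ) ^ (σ v).g else 0) -
        (64 / 63) * (if (new v).isSome = true then (64 / 63 : ℝ) ^ (σ v).g else 0) := by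
      intro v
      have hp : (0 : ℝ) ≤ (64 / 63 : ℝ) ^ (σ v).g := by positivity
      rcases hn : new v with _ | c
      · by_cases hal : Alive U σ v
        · rw [if_pos ((halive v).2 ⟨hal, hn⟩), if_pos hal, hg]
          by_cases hpv : part v = true
          · simp only [hpv, if_true, Option.isSome_none, Bool.false_eq_true, if_false, pow_succ]
            linarith
          · simp only [hpv, Option.isSome_none, Bool.false_eq_true, if_false]
            linarith
        · have hpv : ¬ part v = true := fun hpv => hal ((hpart v).1 hpv).1
          rw [if_neg fun h' => hal ((halive v).1 h').1, if_neg hal, if_neg hpv]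
          simp
      · have hal := hnewal v c hn
        have hpv := (hnew v c hn).1
        rw [if_neg fun h' => by rw [halive, hn] at h'; exact absurd h'.2 (by simp),
          if_pos hal, if_pos hpv]
        simp only [Option.isSome_some, if_true]
        linarith
    refine (Finset.sum_le_sum fun v _ => e1 v).trans ?_
    rw [Finset.sum_sub_distrib, Finset.sum_add_distrib, ← Finset.mul_sum, ← Finset.mul_sum]
    linarith

open Classical in
/-- A color of a given hash value. -/
noncomputable def preimage (f : 𝒞 → ℕ) (A : Finset 𝒞) (o : Option ℕ) : Option 𝒞 :=
  o.bind fun x => if hx : ∃ c ∈ A, f c = x then some hx.choose else none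

theorem preimage_eq_some {f : 𝒞 → ℕ} {A : Finset 𝒞} {o : Option ℕ} {c : 𝒞}
    (h : preimage f A o = some c) : c ∈ A ∧ o = some (f c) := by
  rcases o with _ | x
  · simp [preimage] at h
  · simp only [preimage, Option.bind_some] at h
    split_ifs at h with hx
    rw [Option.some.injEq] at h
    subst h
    exact ⟨hx.choose_spec.1, by rw [hx.choose_spec.2]⟩

theorem preimage_isSome {f : 𝒞 → ℕ} {A : Finset 𝒞} {o : Option ℕ}
    (h : ∀ x, o = some x → ∃ c ∈ A, f c = x) : (preimage f A o).isSome = o.isSome := by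
  rcases o with _ | x
  · simp [preimage]
  · simp only [preimage, Option.bind_some]
    rw [dif_pos (h x rfl)]
    rfl

/-- At most β(s+1) ≤ T/2 iterations were missed, so a surviving node has g ≥ T/2 ≥ 64(log n + 1). As
(64/63)^64 ≥ 2, it would alone weigh more than `n`. -/
theorem LayerInv.alive_eq_empty {N : Network 𝒞} {U : N.V → Bool} {Ls : N.V → Finset 𝒞}
    {h : ℕ → 𝒞 → ℕ} {s β T n : ℕ} {σ : N.V → LayerState 𝒞} (inv : LayerInv N U Ls h s β T σ)
    (hβ : ∀ S : Finset 𝒞, S.Nonempty → S.card ≤ 2 ^ s → badCount h T S ≤ β)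
    (hβT : 2 * (s + 1) * β ≤ T) (hT : 128 * (Nat.log 2 n + 1) ≤ T) (hn : Fintype.card N.V ≤ n)
    (v : N.V) : ¬ Alive U σ v := by
  classical
  intro hv
  obtain ⟨ρ, h1, h2⟩ := inv.progress v hv
  have hbn : (σ v).base.Nonempty := by
    have := inv.deg_lt v hv
    exact (Finset.card_pos.1 (by omega)).mono (inv.avail_sub v hv).1
  have hb1 := hbn.card_pos
  have hbs : (σ v).base.card ≤ 2 ^ s := (Nat.le_mul_of_pos_left _ (by positivity)).trans h1
  have hρ : ρ ≤ s := by
    refine (Nat.pow_le_pow_iff_right one_lt_two).1 (le_trans ?_ h1)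
    exact Nat.le_mul_of_pos_right _ hb1
  have h3 := hβ _ hbn hbs
  have h4 : β * ρ ≤ β * s := Nat.mul_le_mul_left _ hρ
  have h5 : 64 * (Nat.log 2 n + 1) ≤ (σ v).g := by nlinarith
  have h6 : (64 / 63 : ℝ) ^ (σ v).g ≤ n := by
    have h7 := Finset.single_le_sum (f := fun v => if Alive U σ v then (64 / 63 : ℝ) ^ (σ v).g else 0)
      (fun u _ => by split_ifs <;> positivity) (Finset.mem_univ v)
    simp only [if_pos hv] at h7
    refine h7.trans (le_trans ?_ (by exact_mod_cast hn : (Fintype.card N.V : ℝ) ≤ n))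
    convert inv.weight
  have h8 : (2 : ℝ) ≤ (64 / 63 : ℝ) ^ 64 := by norm_num
  have h9 : (n : ℝ) < (64 / 63 : ℝ) ^ (σ v).g := by
    calc (n : ℝ) < 2 ^ (Nat.log 2 n + 1) := by
          exact_mod_cast Nat.lt_pow_succ_log_self one_lt_two n
      _ ≤ ((64 / 63 : ℝ) ^ 64) ^ (Nat.log 2 n + 1) := pow_le_pow_left₀ (by norm_num) h8 _
      _ = (64 / 63 : ℝ) ^ (64 * (Nat.log 2 n + 1)) := (pow_mul _ _ _).symm
      _ ≤ _ := pow_le_pow_right₀ (by norm_num) h5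
  linarith

/-- One iteration of the coloring of a layer. -/
theorem Known.layer_step [Fintype 𝒞] {P : Network 𝒞 → Prop} {b t : ℕ} {α : Type}
    {X : ∀ N : Network 𝒞, N.V → α} {σ : ∀ N : Network 𝒞, N.V → LayerState 𝒞}
    (hX : Known P b t fun N v => (X N v, σ N v)) (U : α → Bool) (Ls : α → Finset 𝒞) (ψ : α → ℕ)
    (h : ℕ → 𝒞 → ℕ) {s β i r q e m : ℕ} (hq : q.Prime)
    (hr : 1 ≤ r) (hqe : 1024 * r ^ 2 * e ≤ q) (hm : 3 ≤ m) (hmb : m ^ 16 ≤ 2 ^ b)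
    (hqm : q * q ≤ m) (hrm : 2 ^ r < m) (hCm : Fintype.card 𝒞 < m) (him : i < m)
    (hψm : ∀ N, P N → ∀ v, ψ (X N v) < m)
    (hψ : ∀ N, P N → ∀ v, ψ (X N v) < 2 ^ (e + 1))
    (hne : ∀ N, P N → ∀ u v, N.G.Adj u v → U (X N u) = true → U (X N v) = true →
      ψ (X N u) ≠ ψ (X N v))
    (hh : ∀ i c, h i c < 2 ^ r)
    (hβ : ∀ S : Finset 𝒞, S.Nonempty → S.card ≤ 2 ^ s → ∀ j ≤ i + 1, badCount h j S ≤ β)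
    (inv : ∀ N, P N →
      LayerInv N (fun v => U (X N v)) (fun v => Ls (X N v)) h s β i (σ N)) :
    ∃ σ' : ∀ N : Network 𝒞, N.V → LayerState 𝒞,
      Known P b (t + ((r + 1) * (1 + q * q) + 2)) (fun N v => (X N v, σ' N v)) ∧
      ∀ N, P N →
        LayerInv N (fun v => U (X N v)) (fun v => Ls (X N v)) h s β (i + 1) (σ' N) := by
  classical
  let part : α × LayerState 𝒞 → Bool := fun x =>
    decide (U x.1 = true ∧ x.2.col = none ∧ Good h i x.2.base)
  let B : α × LayerState 𝒞 → Finset ℕ := fun x => x.2.avail.image (h i)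
  have hpart : ∀ N v, part (X N v, σ N v) = true ↔
      Alive (fun v => U (X N v)) (σ N) v ∧ Good h i (σ N v).base := by
    intro N v
    simp only [part, Alive, decide_eq_true_eq, and_assoc]
  -- Goodness of the base passes to the available colors: their image has at least |avail| -
  -- |base|/4 ≥ |avail|/2 elements, using |base| ≤ 2|avail|.
  have hdegB : ∀ N, P N → ∀ v, part (X N v, σ N v) = true →
      ((N.nbr v).filter fun u => part (X N u, σ N u) = true).card <
        2 * (B (X N v, σ N v)).card := by
    intro N hN v hv
    obtain ⟨hal, hgood⟩ := (hpart N v).1 hv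
    have h1 := (inv N hN).deg_lt v hal
    have h2 : ((N.nbr v).filter fun u => part (X N u, σ N u) = true).card ≤
        ((N.nbr v).filter (Alive (fun v => U (X N v)) (σ N))).card := by
      refine Finset.card_le_card fun u hu => ?_
      obtain ⟨a1, a2⟩ := Finset.mem_filter.1 hu
      exact Finset.mem_filter.2 ⟨a1, ((hpart N u).1 a2).1⟩
    have h3 := (inv N hN).base_le v hal
    have h4 := ((inv N hN).avail_sub v hal).1
    have h5 : ((σ N v).base.image (h i)).card ≤
        (B (X N v, σ N v)).card + ((σ N v).base.card - (σ N v).avail.card) := by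
      rw [← Finset.card_sdiff_of_subset h4]
      have h6 : (σ N v).base.image (h i) ⊆
          B (X N v, σ N v) ∪ ((σ N v).base \ (σ N v).avail).image (h i) := by
        rw [← Finset.image_union, Finset.union_sdiff_of_subset h4]
      exact (Finset.card_le_card h6).trans ((Finset.card_union_le _ _).trans
        (Nat.add_le_add_left Finset.card_image_le _))
    have h7 : 3 * (σ N v).base.card ≤ 4 * ((σ N v).base.image (h i)).card := by
      unfold Good at hgood
      convert hgood
    have h8 := Finset.card_le_card h4
    omega
  obtain ⟨val, k1, h1⟩ := hX.exists_candidates part (fun x => ψ x.1) (fun x => x.2.g) B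
    (fun g => (64 / 63 : ℝ) ^ g) (fun g => by positivity) hq hr hqe hm hmb hqm hrm hψm
    (fun N hN v => ((inv N hN).g_le v).trans_lt him)
    (fun N hN v x hx => by
      obtain ⟨c, _, rfl⟩ := Finset.mem_image.1 hx
      exact hh i c)
    hψ
    (fun N hN u v huv hu hv => hne N hN u v huv ((hpart N u).1 hu).1.1 ((hpart N v).1 hv).1.1)
    (fun N hN v hv => Finset.card_pos.1 (by have := hdegB N hN v hv; omega))
    (fun N hN v hv => (hdegB N hN v hv).le)
  let new : ∀ N : Network 𝒞, N.V → Option 𝒞 := fun N v =>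
    preimage (h i) (σ N v).avail (val N v)
  let σ' : ∀ N : Network 𝒞, N.V → LayerState 𝒞 := fun N v =>
    (σ N v).update (part (X N v, σ N v)) (new N v) ((N.nbr v).val.map (new N))
  refine ⟨σ', ?_, fun N hN => ?_⟩
  · have k2 := k1.announce (fun x => preimage (h i) x.1.2.avail x.2)
      (hCm.trans_le ((Nat.le_self_pow (by norm_num) m).trans hmb))
    have k3 := k2.map (fun x => (x.1.1.1, x.1.1.2.update (part x.1.1)
      (preimage (h i) x.1.1.2.avail x.1.2) x.2)) (Y := fun N v => (X N v, σ' N v))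
      fun _ _ _ => rfl
    exact k3
  · refine (inv N hN).update hβ _ (hpart N) (new N) ?_ ?_ ?_
    · intro v c hc
      obtain ⟨a1, a2⟩ := preimage_eq_some hc
      exact ⟨((h1 N hN).1 v _ a2).1, a1⟩
    · intro u v c huv hu hv
      exact (h1 N hN).2.1 u v _ huv (preimage_eq_some hu).2 (preimage_eq_some hv).2
    · have e1 : ∀ v, (new N v).isSome = (val N v).isSome := fun v =>
        preimage_isSome fun x hx => by
          obtain ⟨c, hc, rfl⟩ := Finset.mem_image.1 ((h1 N hN).1 v x hx).2
          exact ⟨c, hc, rfl⟩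
      simp only [e1]
      exact (h1 N hN).2.2

/-- The number of rounds to color a layer. -/
def layerRounds (M T r q : ℕ) : ℕ := Nat.log 2 M + 1 + T * ((r + 1) * (1 + q * q) + 2)

open Classical in
/-- List coloring of the subgraph induced by a layer of small degree. -/
theorem Known.color_layer [Fintype 𝒞] {P : Network 𝒞 → Prop} {b t : ℕ} {α : Type}
    {X : ∀ N : Network 𝒞, N.V → α} (hX : Known P b t X) (U : α → Bool) (Ls : α → Finset 𝒞)
    (ident : α → ℕ) {D s T e q M m n : ℕ} (hq : q.Prime) (hs : D + 1 ≤ 2 ^ s)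
    (hT : 128 * (Nat.log 2 n + 1) ≤ T) (hC : Fintype.card 𝒞 ≤ 2 ^ T)
    (he : 4096 * (D + 1) ^ 4 ≤ 2 ^ (e + 1)) (hqe : 1024 * (25 * s + 24) ^ 2 * e ≤ q)
    (hm : 3 ≤ m) (hmb : m ^ 16 ≤ 2 ^ b) (hqm : q * q ≤ m) (hrm : 2 ^ (25 * s + 24) < m)
    (hCm : Fintype.card 𝒞 < m) (hTm : T < m) (hMm : M ≤ m) (hDm : 4096 * (D + 1) ^ 4 ≤ m)
    (hn : ∀ N, P N → Fintype.card N.V ≤ n)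
    (hid : ∀ N, P N → ∀ v, ident (X N v) < M)
    (hinj : ∀ N, P N → Function.Injective fun v => ident (X N v))
    (hdegD : ∀ N, P N → ∀ v, U (X N v) = true →
      ((N.nbr v).filter fun u => U (X N u) = true).card ≤ D)
    (hlist : ∀ N, P N → ∀ v, U (X N v) = true →
      ((N.nbr v).filter fun u => U (X N u) = true).card < (Ls (X N v)).card) :
    ∃ col : ∀ N : Network 𝒞, N.V → Option 𝒞,
      Known P b (t + layerRounds M T (25 * s + 24) q) (fun N v => (X N v, col N v)) ∧
      ∀ N, P N →
        (∀ v c, col N v = some c → U (X N v) = true ∧ c ∈ Ls (X N v)) ∧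
        (∀ u v c, N.G.Adj u v → col N u = some c → col N v ≠ some c) ∧
        ∀ v, U (X N v) = true → col N v ≠ none := by
  obtain ⟨h, hh, hgood⟩ := exists_hash (𝒞 := 𝒞) s T (by omega) hC
  obtain ⟨φ, k1, h1⟩ := hX.exists_coloring U ident (D := D) hm hmb hMm hid
    (fun N hN u v huv _ _ heq => huv.ne (hinj N hN heq)) hdegD
  set β := T / (2 * (s + 1)) with hβdef
  have hβT : 2 * (s + 1) * β ≤ T := Nat.mul_div_le _ _
  have hβ : ∀ S : Finset 𝒞, S.Nonempty → S.card ≤ 2 ^ s → badCount h T S ≤ β := by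
    intro S hS hSc
    have h2 := hgood S hS hSc
    rw [hβdef, Nat.le_div_iff_mul_le (by positivity), mul_comm]
    convert h2 using 3
    unfold badCount
    congr 1
    refine Finset.filter_congr fun i _ => ?_
    unfold Good
    rw [not_le]
  -- Lists are cut down to D + 1 colors. They still exceed the degree, and now they have at most 2^s
  -- elements, as the hash family requires.
  let init : α → Finset 𝒞 := fun x =>
    (Finset.exists_subset_card_eq (min_le_left (Ls x).card (D + 1))).choose
  have hinit : ∀ x, init x ⊆ Ls x ∧ (init x).card = min (Ls x).card (D + 1) := fun x =>
    (Finset.exists_subset_card_eq (min_le_left (Ls x).card (D + 1))).choose_spec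
  have key : ∀ i ≤ T, ∃ σ : ∀ N : Network 𝒞, N.V → LayerState 𝒞,
      Known P b (t + (Nat.log 2 M + 1) + i * ((25 * s + 24 + 1) * (1 + q * q) + 2))
        (fun N v => ((X N v, φ N v), σ N v)) ∧
      ∀ N, P N → LayerInv N (fun v => U (X N v)) (fun v => Ls (X N v)) h s β i (σ N) := by
    intro i
    induction i with
    | zero =>
      intro _
      refine ⟨fun N v => ⟨init (X N v), init (X N v), 0, none⟩, ?_, fun N hN => ?_⟩
      · rw [zero_mul, add_zero]
        exact k1.map (fun x => (x, ⟨init x.1, init x.1, 0, none⟩)) fun _ _ _ => rfl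
      have hal : ∀ v, Alive (fun v => U (X N v))
          (fun v => (⟨init (X N v), init (X N v), 0, none⟩ : LayerState 𝒞)) v ↔
          U (X N v) = true := fun v => by simp [Alive]
      constructor
      · intro v c hc; simp at hc
      · intro u v c _ hc; simp at hc
      · intro v; exact le_rfl
      · intro v _; exact ⟨subset_rfl, (hinit _).1⟩
      · intro u v c _ _ hc; simp at hc
      · intro v hv
        have hv := (hal v).1 hv
        simp only [hal, (hinit _).2, lt_min_iff]
        have a1 := hlist N hN v hv
        have a2 := hdegD N hN v hv
        exact ⟨a1, Nat.lt_succ_of_le a2⟩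
      · intro v _; simp only; omega
      · intro v _
        refine ⟨0, ?_, Nat.zero_le _⟩
        rw [pow_zero, one_mul]
        simp only [(hinit _).2]
        exact (min_le_right _ _).trans hs
      · calc _ ≤ ∑ v : N.V, (1 : ℝ) := Finset.sum_le_sum fun v _ => by
              split_ifs <;> simp
          _ = Fintype.card N.V := by simp
    | succ i ih =>
      intro hi
      obtain ⟨σ, k2, inv⟩ := ih (by omega)
      obtain ⟨σ', k3, inv'⟩ := k2.layer_step (fun x => U x.1) (fun x => Ls x.1) (fun x => x.2) h
        (s := s) (β := β) (i := i) hq (by omega) hqe hm hmb hqm hrm hCm (by omega)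
        (fun N hN v => ((h1 N hN).1 v).trans_le hDm)
        (fun N hN v => ((h1 N hN).1 v).trans_le he) (fun N hN => (h1 N hN).2) hh
        (fun S hS hSc j hj => (badCount_mono h (hj.trans hi) S).trans (hβ S hS hSc)) inv
      refine ⟨σ', ?_, inv'⟩
      convert k3 using 1
      ring
  obtain ⟨σ, k2, inv⟩ := key T le_rfl
  refine ⟨fun N v => (σ N v).col, ?_, fun N hN =>
    ⟨(inv N hN).col_mem, (inv N hN).col_ne, fun v hv hc => ?_⟩⟩
  · have k3 := k2.map (Y := fun N v => (X N v, (σ N v).col)) (fun x => (x.1.1, x.2.col))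
      fun _ _ _ => rfl
    convert k3 using 1
    unfold layerRounds
    ring
  · exact (inv N hN).alive_eq_empty hβ hβT hT (hn N hN) v ⟨hv, hc⟩

end Network

/-! ### Edge counts from arboricity -/

namespace SimpleGraph

open Classical in
-- A maximal acyclic extension of `F` is a spanning tree, with one edge less than vertices.
theorem IsAcyclic.sum_degree_le {V : Type} [Fintype V] {F : SimpleGraph V} (hF : F.IsAcyclic) :
    ∑ v, F.degree v ≤ 2 * Fintype.card V := by
  rcases isEmpty_or_nonempty V with h | h
  · simp
  obtain ⟨T, hT, hmax⟩ := exists_maximal_isAcyclic_of_le_isAcyclic (le_top : F ≤ ⊤) hF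
  have htree := (isTree_iff_maximal_isAcyclic (G := T)).2 ⟨h, ⟨hmax.1.2, fun H hH hle =>
    hmax.2 ⟨le_top, hH⟩ hle⟩⟩
  have h1 := htree.card_edgeFinset
  rw [sum_degrees_eq_twice_card_edges]
  have h2 : F.edgeFinset.card ≤ T.edgeFinset.card :=
    Finset.card_le_card (edgeFinset_subset_edgeFinset.2 hT)
  omega

open Classical in
theorem IsAcyclic.sum_card_filter_le {V : Type} [Fintype V] {F : SimpleGraph V}
    (hF : F.IsAcyclic) (S : Finset V) :
    ∑ v ∈ S, (S.filter fun u => F.Adj v u).card ≤ 2 * S.card := by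
  have h1 := (hF.induce (S : Set V)).sum_degree_le
  have h2 : ∀ v : (S : Set V), (F.induce (S : Set V)).degree v =
      (S.filter fun u => F.Adj v u).card := by
    intro v
    rw [← card_neighborFinset_eq_degree]
    refine Finset.card_bij (fun u _ => (u : V)) ?_ ?_ ?_
    · intro u hu
      rw [mem_neighborFinset, comap_adj] at hu
      exact Finset.mem_filter.2 ⟨u.2, hu⟩
    · intro u _ w _ h
      exact Subtype.ext h
    · intro u hu
      obtain ⟨a1, a2⟩ := Finset.mem_filter.1 hu
      refine ⟨⟨u, a1⟩, ?_, rfl⟩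
      rw [mem_neighborFinset, comap_adj]
      exact a2
  have h3 : Fintype.card (S : Set V) = S.card := by simp
  have h4 : ∑ v : (S : Set V), (S.filter fun u => F.Adj v u).card ≤ 2 * S.card := by
    rw [← h3]
    refine le_trans (le_of_eq (Finset.sum_congr rfl fun v _ => ?_)) h1
    rw [← h2 v]
    congr!
  refine le_trans (le_of_eq ?_) h4
  exact (Finset.sum_coe_sort S fun v => (S.filter fun u => F.Adj v u).card).symm

open Classical in
theorem CoveredByForests.sum_card_filter_le {V : Type} [Fintype V] {G : SimpleGraph V} {a : ℕ}
    (h : G.CoveredByForests a) (S : Finset V) :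
    ∑ v ∈ S, (S.filter fun u => G.Adj v u).card ≤ 2 * a * S.card := by
  obtain ⟨F, hF, rfl⟩ := h
  calc ∑ v ∈ S, (S.filter fun u => (⨆ i, F i).Adj v u).card
      ≤ ∑ v ∈ S, ∑ i, (S.filter fun u => (F i).Adj v u).card := by
        refine Finset.sum_le_sum fun v _ => ?_
        refine le_trans (Finset.card_le_card ?_) Finset.card_biUnion_le
        intro u hu
        obtain ⟨a1, a2⟩ := Finset.mem_filter.1 hu
        rw [iSup_adj] at a2
        obtain ⟨i, hi⟩ := a2
        exact Finset.mem_biUnion.2 ⟨i, Finset.mem_univ _, Finset.mem_filter.2 ⟨a1, hi⟩⟩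
    _ = ∑ i, ∑ v ∈ S, (S.filter fun u => (F i).Adj v u).card := Finset.sum_comm
    _ ≤ ∑ i : Fin a, 2 * S.card := Finset.sum_le_sum fun i _ => (hF i).sum_card_filter_le S
    _ = 2 * a * S.card := by simp; ring

/-- Positivity is what excludes an infimum over the empty set, which would be 0. -/
theorem coveredByForests_arboricity {V : Type} {G : SimpleGraph V} (h : 1 ≤ G.arboricity) :
    G.CoveredByForests G.arboricity := by
  refine Nat.sInf_mem (s := {k | G.CoveredByForests k}) ?_
  by_contra hcon
  rw [Set.not_nonempty_iff_eq_empty] at hcon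
  unfold arboricity at h
  rw [hcon, Nat.sInf_empty] at h
  omega

end SimpleGraph

/-! ### Peeling into layers and coloring them in reverse -/

namespace Network

variable {𝒞 : Type}

open Classical in
/-- The invariant of the peeling process. -/
structure PeelInv (N : Network 𝒞) (D i : ℕ) (x : ℝ) (rem : N.V → Bool) (ℓ : N.V → ℕ) : Prop where
  of_rem : ∀ v, rem v = true → ℓ v = i
  of_not_rem : ∀ v, rem v = false → ℓ v < i
  deg_le : ∀ v, rem v = false → ((N.nbr v).filter fun u => ℓ v ≤ ℓ u).card ≤ D
  card_le : (1 + x) ^ i * ((Finset.univ.filter fun v => rem v = true).card : ℝ) ≤ Fintype.card N.V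

open Classical in
/-- Iterated removal of the nodes of small degree. -/
theorem Known.exists_layers {P : Network 𝒞 → Prop} {b t : ℕ} {α : Type}
    {X : ∀ N : Network 𝒞, N.V → α} (hX : Known P b t X) (hb : 1 ≤ b) {D n L : ℕ} {x : ℝ}
    (hx : 0 ≤ x)
    (hpeel : ∀ N, P N → ∀ S : Finset N.V,
      (1 + x) * ((S.filter fun v => D < ((N.nbr v).filter fun u => u ∈ S).card).card : ℝ) ≤ S.card)
    (hn : ∀ N, P N → Fintype.card N.V ≤ n) (hL : (n : ℝ) < (1 + x) ^ L) :
    ∃ ℓ : ∀ N : Network 𝒞, N.V → ℕ,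
      Known P b (t + L) (fun N v => (X N v, ℓ N v)) ∧
      ∀ N, P N → ∀ v, ℓ N v < L ∧ ((N.nbr v).filter fun u => ℓ N v ≤ ℓ N u).card ≤ D := by
  have key : ∀ i, ∃ (rem : ∀ N : Network 𝒞, N.V → Bool) (ℓ : ∀ N : Network 𝒞, N.V → ℕ),
      Known P b (t + i) (fun N v => (X N v, rem N v, ℓ N v)) ∧
      ∀ N, P N → PeelInv N D i x (rem N) (ℓ N) := by
    intro i
    induction i with
    | zero =>
      refine ⟨fun _ _ => true, fun _ _ => 0, hX.map (fun x => (x, true, 0)) fun _ _ _ => rfl,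
        fun N _ => ⟨fun _ _ => rfl, fun _ h => by simp at h, fun _ h => by simp at h, ?_⟩⟩
      simp
    | succ i ih =>
      obtain ⟨rem, ℓ, k1, inv⟩ := ih
      let rem' : ∀ N : Network 𝒞, N.V → Bool := fun N v =>
        decide (rem N v = true ∧ D < ((N.nbr v).filter fun u => rem N u = true).card)
      let ℓ' : ∀ N : Network 𝒞, N.V → ℕ := fun N v => if rem' N v = true then i + 1 else ℓ N v
      refine ⟨rem', ℓ', ?_, fun N hN => ?_⟩
      · refine k1.step (fun y => y.2.1) (fun N _ v => ?_)
          (fun y s =>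
            let z := decide (y.2.1 = true ∧ D < Multiset.card (s.filter fun o => o = true))
            (y.1, z, if z = true then i + 1 else y.2.2)) fun N _ v => ?_
        · have : 2 ≤ 2 ^ b := by
            calc 2 = 2 ^ 1 := rfl
              _ ≤ 2 ^ b := Nat.pow_le_pow_right two_pos hb
          cases rem N v <;> simp
          omega
        · simp only [rem', ℓ', Multiset.filter_map, Multiset.card_map, Finset.card_def,
            Finset.filter_val]
          rfl
      · have hrem : ∀ v, rem' N v = true ↔
            rem N v = true ∧ D < ((N.nbr v).filter fun u => rem N u = true).card := fun v => by
          simp [rem']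
        have hI := inv N hN
        -- The index of a remaining node is still provisional, but it never drops below the current
        -- round. So the nodes of index at least `i` are exactly those remaining, and the degree
        -- tested at removal equals the final degree into the own and later layers.
        have hge : ∀ v, rem N v = true → ∀ u, i ≤ ℓ' N u ↔ rem N u = true := by
          intro v hv u
          by_cases hu : rem' N u = true
          · have := ((hrem u).1 hu).1
            simp [ℓ', hu, this]
          · simp only [ℓ', hu]
            rcases hru : rem N u with _ | _
            · have := hI.of_not_rem u hru
              simp; omega
            · have := hI.of_rem u hru
              simp [this]
        constructor
        · intro v hv
          simp only [ℓ', hv, if_true]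
        · intro v hv
          simp only [ℓ', hv, Bool.false_eq_true, if_false]
          rcases hr : rem N v with _ | _
          · have := hI.of_not_rem v hr; omega
          · have := hI.of_rem v hr; omega
        · intro v hv
          have hℓ : ℓ' N v = ℓ N v := by simp [ℓ', hv]
          rcases hr : rem N v with _ | _
          · refine le_trans (Finset.card_le_card ?_) (hI.deg_le v hr)
            intro u hu
            obtain ⟨a1, a2⟩ := Finset.mem_filter.1 hu
            refine Finset.mem_filter.2 ⟨a1, ?_⟩
            rw [hℓ] at a2
            by_cases hu' : rem' N u = true
            · have b1 := hI.of_rem u ((hrem u).1 hu').1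
              have b2 := hI.of_not_rem v hr
              omega
            · have h3 : ℓ' N u = ℓ N u := if_neg hu'
              rwa [h3] at a2
          · have h1 : ¬ (D < ((N.nbr v).filter fun u => rem N u = true).card) := fun h => by
              rw [(hrem v).2 ⟨hr, h⟩] at hv
              exact Bool.noConfusion hv
            rw [hℓ, hI.of_rem v hr]
            simp only [hge v hr]
            exact not_lt.1 h1
        · have h1 := hpeel N hN (Finset.univ.filter fun v => rem N v = true)
          have h2 : (Finset.univ.filter fun v => rem' N v = true) =
              ((Finset.univ.filter fun v => rem N v = true).filter fun v =>
                D < ((N.nbr v).filter fun u =>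
                  u ∈ Finset.univ.filter fun v => rem N v = true).card) := by
            ext v
            simp only [Finset.mem_filter, Finset.mem_univ, true_and, hrem]
          rw [h2, pow_succ, mul_assoc]
          exact (mul_le_mul_of_nonneg_left h1 (by positivity)).trans hI.card_le
  obtain ⟨rem, ℓ, k1, inv⟩ := key L
  have hrem : ∀ N, P N → ∀ v, rem N v = false := by
    intro N hN v
    by_contra h
    have h1 : (1 : ℝ) ≤ ((Finset.univ.filter fun v => rem N v = true).card : ℝ) := by
      exact_mod_cast Finset.card_pos.2 ⟨v, by simpa using h⟩
    have h2 := (inv N hN).card_le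
    have h3 : (Fintype.card N.V : ℝ) ≤ n := by exact_mod_cast hn N hN
    have h4 : (0 : ℝ) ≤ (1 + x) ^ L := by positivity
    nlinarith
  exact ⟨ℓ, k1.map (fun y => (y.1, y.2.2)) fun _ _ _ => rfl, fun N hN v =>
    ⟨(inv N hN).of_not_rem v (hrem N hN v), (inv N hN).deg_le v (hrem N hN v)⟩⟩

open Classical in
/-- The invariant of the coloring of the layers, from the last one to the first one. -/
structure ColorInv (N : Network 𝒞) (L : ℕ) (ℓ : N.V → ℕ) (j : ℕ) (col : N.V → Option 𝒞)
    (av : N.V → Finset 𝒞) : Prop where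
  isSome_iff : ∀ v, col v ≠ none ↔ L ≤ ℓ v + j
  col_mem : ∀ v c, col v = some c → c ∈ N.L v
  col_ne : ∀ u v c, N.G.Adj u v → col u = some c → col v ≠ some c
  av_sub : ∀ v, av v ⊆ N.L v
  av_free : ∀ u v c, N.G.Adj u v → col u = some c → c ∉ av v
  card_le : ∀ v, (N.L v).card ≤ (av v).card + ((N.nbr v).filter fun u => col u ≠ none).card

open Classical in
/-- List coloring of all nodes, layer by layer. -/
theorem Known.color_layers [Fintype 𝒞] {P : Network 𝒞 → Prop} {b t : ℕ} {α : Type}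
    {X : ∀ N : Network 𝒞, N.V → α} (hX : Known P b t X)
    (ident : α → ℕ) (lst : α → Finset 𝒞) (lay : α → ℕ) {D s T e q M m n : ℕ} (hq : q.Prime)
    (hs : D + 1 ≤ 2 ^ s)
    (hT : 128 * (Nat.log 2 n + 1) ≤ T) (hC : Fintype.card 𝒞 ≤ 2 ^ T)
    (he : 4096 * (D + 1) ^ 4 ≤ 2 ^ (e + 1)) (hqe : 1024 * (25 * s + 24) ^ 2 * e ≤ q)
    (hm : 3 ≤ m) (hmb : m ^ 16 ≤ 2 ^ b) (hqm : q * q ≤ m) (hrm : 2 ^ (25 * s + 24) < m)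
    (hCm : Fintype.card 𝒞 < m) (hTm : T < m) (hMm : M ≤ m) (hDm : 4096 * (D + 1) ^ 4 ≤ m)
    (hn : ∀ N, P N → Fintype.card N.V ≤ n)
    (hid : ∀ N, P N → ∀ v, ident (X N v) < M)
    (hinj : ∀ N, P N → Function.Injective fun v => ident (X N v))
    (hlst : ∀ N, P N → ∀ v, lst (X N v) = N.L v) (hcard : ∀ N, P N → ∀ v, D < (N.L v).card)
    (L : ℕ)
    (hlay : ∀ N, P N → ∀ v, lay (X N v) < L ∧
      ((N.nbr v).filter fun u => lay (X N v) ≤ lay (X N u)).card ≤ D) :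
    ∃ col : ∀ N : Network 𝒞, N.V → Option 𝒞,
      Known P b (t + L * (layerRounds M T (25 * s + 24) q + 1)) col ∧
      ∀ N, P N → ∃ x, IsListColoring N.G N.L x ∧ ∀ v, col N v = some (x v) := by
  have key : ∀ j ≤ L, ∃ (col : ∀ N : Network 𝒞, N.V → Option 𝒞)
      (av : ∀ N : Network 𝒞, N.V → Finset 𝒞),
      Known P b (t + j * (layerRounds M T (25 * s + 24) q + 1))
        (fun N v => (X N v, col N v, av N v)) ∧
      ∀ N, P N → ColorInv N L (fun v => lay (X N v)) j (col N) (av N) := by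
    intro j
    induction j with
    | zero =>
      intro _
      refine ⟨fun _ _ => none, fun N v => lst (X N v), ?_, fun N hN => ?_⟩
      · rw [zero_mul, add_zero]
        exact hX.map (fun x => (x, none, lst x)) fun _ _ _ => rfl
      · constructor
        · intro v
          have := (hlay N hN v).1
          simp; omega
        · intro v c hc; simp at hc
        · intro u v c _ hc; simp at hc
        · intro v; exact (hlst N hN v).subset
        · intro u v c _ hc; simp at hc
        · intro v; simp only [hlst N hN]; omega
    | succ j ih =>
      intro hj
      obtain ⟨col, av, k1, inv⟩ := ih (by omega)
      have hU : ∀ N v, decide (lay (X N v) + j + 1 = L) = true ↔ lay (X N v) + j + 1 = L :=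
        fun N v => by simp
      -- Neighbors in the same layer and neighbors already colored are disjoint sets of neighbors in
      -- the own or later layers. A list has more than D colors, and at most one is lost per colored
      -- neighbor, so more colors than uncolored neighbors in the layer remain.
      have hdeg : ∀ N, P N → ∀ v, lay (X N v) + j + 1 = L →
          ((N.nbr v).filter fun u => lay (X N u) + j + 1 = L).card +
          ((N.nbr v).filter fun u => col N u ≠ none).card ≤ D := by
        intro N hN v hv
        rw [← Finset.card_union_of_disjoint]
        · refine (Finset.card_le_card fun u hu => ?_).trans (hlay N hN v).2
          rcases Finset.mem_union.1 hu with hu | hu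
          · obtain ⟨a1, a2⟩ := Finset.mem_filter.1 hu
            exact Finset.mem_filter.2 ⟨a1, by omega⟩
          · obtain ⟨a1, a2⟩ := Finset.mem_filter.1 hu
            have := ((inv N hN).isSome_iff u).1 a2
            exact Finset.mem_filter.2 ⟨a1, by omega⟩
        · rw [Finset.disjoint_left]
          intro u hu hu'
          have h1 := (Finset.mem_filter.1 hu).2
          have h2 := ((inv N hN).isSome_iff u).1 (Finset.mem_filter.1 hu').2
          omega
      obtain ⟨new, k2, h2⟩ := k1.color_layer (fun x => decide (lay x.1 + j + 1 = L))
        (fun x => x.2.2) (fun x => ident x.1) hq hs hT hC he hqe hm hmb hqm hrm hCm hTm hMm hDm hn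
        hid hinj
        (fun N hN v hv => by
          have := hdeg N hN v ((hU N v).1 hv)
          simp only [hU]
          omega)
        (fun N hN v hv => by
          have h1 := hdeg N hN v ((hU N v).1 hv)
          have h2 := (inv N hN).card_le v
          have h3 := hcard N hN v
          simp only [hU]
          omega)
      let col' : ∀ N : Network 𝒞, N.V → Option 𝒞 := fun N v => (col N v).orElse fun _ => new N v
      let av' : ∀ N : Network 𝒞, N.V → Finset 𝒞 := fun N v =>
        (av N v).filter fun c => some c ∉ (N.nbr v).val.map (new N)
      have hav : ∀ N v c, c ∈ av' N v ↔ c ∈ av N v ∧ ∀ u ∈ N.nbr v, new N u ≠ some c := by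
        intro N v c
        simp [av']
      refine ⟨col', av', ?_, fun N hN => ?_⟩
      · have k3 := k2.announce (fun x => x.2)
          (hCm.trans_le ((Nat.le_self_pow (by norm_num) m).trans hmb))
        have k4 := k3.map (Y := fun N v => (X N v, col' N v, av' N v))
          (fun x => (x.1.1.1, x.1.1.2.1.orElse fun _ => x.1.2,
            x.1.1.2.2.filter fun c => some c ∉ x.2)) fun _ _ _ => rfl
        convert k4 using 1
        ring
      · have hI := inv N hN
        obtain ⟨n1, n2, n3⟩ := h2 N hN
        simp only [hU] at n1 n3
        have hnone : ∀ v, lay (X N v) + j + 1 = L → col N v = none := by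
          intro v hv
          by_contra h
          have := (hI.isSome_iff v).1 h
          omega
        have hcol : ∀ v c, col' N v = some c → col N v = some c ∨ new N v = some c := by
          intro v c h
          simp only [col'] at h
          rcases hc : col N v with _ | c'
          · rw [hc] at h; exact Or.inr h
          · rw [hc] at h; exact Or.inl h
        have hnone' : ∀ v, col' N v = none ↔ col N v = none ∧ new N v = none := by
          intro v
          simp only [col']
          rcases col N v with _ | c' <;> simp
        constructor
        · intro v
          rw [Ne, hnone', not_and_or]
          have h1 := hI.isSome_iff v
          constructor
          · rintro (h | h)
            · have := h1.1 h; omega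
            · obtain ⟨c, hc⟩ := Option.ne_none_iff_exists'.1 h
              have := (n1 v c hc).1
              omega
          · intro h
            by_cases h3 : L ≤ lay (X N v) + j
            · exact Or.inl (h1.2 h3)
            · exact Or.inr (n3 v (by omega))
        · intro v c hc
          rcases hcol v c hc with h | h
          · exact hI.col_mem v c h
          · exact hI.av_sub v (n1 v c h).2
        · intro u v c huv hu hv
          rcases hcol u c hu with h | h <;> rcases hcol v c hv with h' | h'
          · exact hI.col_ne u v c huv h h'
          · exact hI.av_free u v c huv h (n1 v c h').2
          · exact hI.av_free v u c huv.symm h' (n1 u c h).2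
          · exact n2 u v c huv h h'
        · intro v c hc
          exact hI.av_sub v ((hav N v c).1 hc).1
        · intro u v c huv hu hc
          obtain ⟨c1, c2⟩ := (hav N v c).1 hc
          rcases hcol u c hu with h | h
          · exact hI.av_free u v c huv h c1
          · exact c2 u ((N.G.mem_neighborFinset v u).2 huv.symm) h
        · intro v
          let R := (N.nbr v).filter fun u => new N u ≠ none
          have e1 : ((N.nbr v).filter fun u => col N u ≠ none).card + R.card ≤
              ((N.nbr v).filter fun u => col' N u ≠ none).card := by
            rw [← Finset.card_union_of_disjoint]
            · refine Finset.card_le_card fun u hu => ?_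
              rcases Finset.mem_union.1 hu with hu | hu
              · obtain ⟨a1, a2⟩ := Finset.mem_filter.1 hu
                exact Finset.mem_filter.2 ⟨a1, fun h => a2 ((hnone' u).1 h).1⟩
              · obtain ⟨a1, a2⟩ := Finset.mem_filter.1 hu
                exact Finset.mem_filter.2 ⟨a1, fun h => a2 ((hnone' u).1 h).2⟩
            · rw [Finset.disjoint_left]
              intro u hu hu'
              obtain ⟨c, hc⟩ := Option.ne_none_iff_exists'.1 (Finset.mem_filter.1 hu').2
              exact (Finset.mem_filter.1 hu).2 (hnone u (n1 u c hc).1)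
          have e2 : (av N v).card ≤ (av' N v).card + R.card := by
            have h4 : av N v ⊆ av' N v ∪ (R.image (new N)).biUnion fun o => o.toFinset := by
              intro c hc
              by_cases hc' : c ∈ av' N v
              · exact Finset.mem_union_left _ hc'
              · rw [hav] at hc'
                push Not at hc'
                obtain ⟨u, hu, huc⟩ := hc' hc
                refine Finset.mem_union_right _ (Finset.mem_biUnion.2 ⟨some c, ?_, by simp⟩)
                exact Finset.mem_image.2 ⟨u, Finset.mem_filter.2 ⟨hu, by simp [huc]⟩, huc⟩
            refine (Finset.card_le_card h4).trans ((Finset.card_union_le _ _).trans ?_)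
            refine Nat.add_le_add_left ?_ _
            refine (Finset.card_biUnion_le_card_mul _ _ 1 fun o _ => ?_).trans ?_
            · rcases o with _ | c <;> simp
            · rw [mul_one]
              exact Finset.card_image_le
          have := hI.card_le v
          omega
  obtain ⟨col, av, k1, inv⟩ := key L le_rfl
  refine ⟨col, k1.map (fun x => x.2.1) fun _ _ _ => rfl, fun N hN => ?_⟩
  have h1 : ∀ v, ∃ c, col N v = some c := fun v =>
    Option.ne_none_iff_exists'.1 (((inv N hN).isSome_iff v).2 (by omega))
  choose x hx using h1
  refine ⟨x, ⟨fun v => (inv N hN).col_mem v _ (hx v), fun u v huv heq => ?_⟩, hx⟩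
  exact (inv N hN).col_ne u v (x u) huv (hx u) (by rw [hx v, heq])

/-! ### Parameters, message size and running time -/

/-- The number of binary digits, at least one. -/
def bitLength (n : ℕ) : ℕ := Nat.log 2 n + 1

theorem lt_two_pow_bitLength (n : ℕ) : n < 2 ^ bitLength n :=
  Nat.lt_pow_succ_log_self one_lt_two n

theorem one_le_bitLength (n : ℕ) : 1 ≤ bitLength n := Nat.le_add_left _ _

/-- The degree bound inside the layers. -/
noncomputable def layerDegree (ε : ℝ) (a n : ℕ) : ℕ := min (⌈(2 + min ε 1) * (a : ℝ)⌉₊ - 1) n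

/-- The number of layers. -/
noncomputable def layerCount (ε : ℝ) (n : ℕ) : ℕ := ⌈2 / min ε 1⌉₊ * bitLength n

/-- Bertrand's postulate for the bound 1024 r² e, where r = 25s + 24 is the number of hash bits and
e = 4s + 11 suffices for 4096(D+1)^4 ≤ 2^(e+1). -/
theorem exists_class_prime (s : ℕ) : ∃ q, q.Prime ∧
    1024 * (25 * s + 24) ^ 2 * (4 * s + 11) ≤ q ∧
    q ≤ 2048 * (25 * s + 24) ^ 2 * (4 * s + 11) := by
  obtain ⟨q, hq, h1, h2⟩ := Nat.exists_prime_lt_and_le_two_mul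
    (1024 * (25 * s + 24) ^ 2 * (4 * s + 11)) (by positivity)
  exact ⟨q, hq, h1.le, h2.trans (le_of_eq (by ring))⟩

/-- The size of the prime field used for defective colorings. -/
noncomputable def classPrime (s : ℕ) : ℕ := (exists_class_prime s).choose

theorem classPrime_le {s : ℕ} (hs : 1 ≤ s) : classPrime s ≤ 2 ^ 27 * s ^ 3 := by
  calc classPrime s ≤ 2048 * (25 * s + 24) ^ 2 * (4 * s + 11) :=
        (exists_class_prime s).choose_spec.2.2
    _ ≤ 2048 * (49 * s) ^ 2 * (15 * s) := by gcongr <;> omega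
    _ = 73758720 * s ^ 3 := by ring
    _ ≤ 2 ^ 27 * s ^ 3 := Nat.mul_le_mul_right _ (by norm_num)

/-- The cap `n` in `layerDegree` is never exceeded by a degree, so each vertex of R has degree at
least (2+δ)a inside S. Double counting gives |R|(2+δ)a ≤ 2a|S|. -/
theorem card_peel_le {N : Network 𝒞} {ε : ℝ} {a n : ℕ} (hε : 0 < ε) (ha : 1 ≤ a)
    (hG : N.G.CoveredByForests a) (hn : Fintype.card N.V = n) (S : Finset N.V)
    [DecidableEq N.V] :
    (1 + min ε 1 / 2) * ((S.filter fun v =>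
      layerDegree ε a n < ((N.nbr v).filter fun u => u ∈ S).card).card : ℝ) ≤ S.card := by
  classical
  set δ := min ε 1
  have hδ : 0 < δ := lt_min hε one_pos
  have ha' : (0 : ℝ) < a := by exact_mod_cast ha
  set R := S.filter fun v => layerDegree ε a n < ((N.nbr v).filter fun u => u ∈ S).card
  have h1 : ∀ v ∈ R, (2 + δ) * (a : ℝ) ≤ ((S.filter fun u => N.G.Adj v u).card : ℝ) := by
    intro v hv
    have h2 := (Finset.mem_filter.1 hv).2
    have h3 : ((N.nbr v).filter fun u => u ∈ S) = S.filter fun u => N.G.Adj v u := by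
      ext u
      simp [nbr, and_comm]
    rw [h3] at h2
    have h4 : (S.filter fun u => N.G.Adj v u).card ≤ n := by
      rw [← hn]
      exact Finset.card_le_univ _
    have h5 : ⌈(2 + δ) * (a : ℝ)⌉₊ ≤ (S.filter fun u => N.G.Adj v u).card := by
      have h6 : layerDegree ε a n = min (⌈(2 + δ) * (a : ℝ)⌉₊ - 1) n := rfl
      omega
    exact Nat.ceil_le.1 h5
  have h2 : (R.card : ℝ) * ((2 + δ) * a) ≤ 2 * a * S.card := by
    calc (R.card : ℝ) * ((2 + δ) * a) = ∑ v ∈ R, (2 + δ) * (a : ℝ) := by simp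
      _ ≤ ∑ v ∈ R, ((S.filter fun u => N.G.Adj v u).card : ℝ) := Finset.sum_le_sum h1
      _ ≤ ∑ v ∈ S, ((S.filter fun u => N.G.Adj v u).card : ℝ) :=
        Finset.sum_le_sum_of_subset_of_nonneg (Finset.filter_subset _ _)
          fun _ _ _ => Nat.cast_nonneg _
      _ ≤ _ := by
        have := hG.sum_card_filter_le S
        have h3 : ((∑ v ∈ S, (S.filter fun u => N.G.Adj v u).card : ℕ) : ℝ) ≤
            ((2 * a * S.card : ℕ) : ℝ) := by
          refine Nat.cast_le.2 (le_trans (le_of_eq ?_) this)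
          refine Finset.sum_congr rfl fun v _ => ?_
          congr!
        push_cast at h3
        exact h3
  have h3 : (1 + δ / 2) * (R.card : ℝ) * (2 * a) ≤ S.card * (2 * a) := by nlinarith
  exact le_of_mul_le_mul_right h3 (by positivity)

/-- By Bernoulli's inequality, ⌈2/δ⌉ peeling rounds halve the number of remaining nodes. -/
theorem lt_pow_layerCount {ε : ℝ} (hε : 0 < ε) (n : ℕ) :
    (n : ℝ) < (1 + min ε 1 / 2) ^ layerCount ε n := by
  have hδ : 0 < min ε 1 := lt_min hε one_pos
  have h1 : (2 : ℝ) ≤ (1 + min ε 1 / 2) ^ ⌈2 / min ε 1⌉₊ := by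
    refine le_trans ?_ (one_add_mul_le_pow (by linarith) _)
    have h2 := Nat.le_ceil (2 / min ε 1)
    have h3 : 2 / min ε 1 * (min ε 1 / 2) = 1 := by field_simp
    have h4 := mul_le_mul_of_nonneg_right h2 (by positivity : 0 ≤ min ε 1 / 2)
    linarith
  calc (n : ℝ) < 2 ^ bitLength n := by exact_mod_cast lt_two_pow_bitLength n
    _ ≤ ((1 + min ε 1 / 2) ^ ⌈2 / min ε 1⌉₊) ^ bitLength n :=
      pow_le_pow_left₀ (by norm_num) h1 _
    _ = _ := (pow_mul _ _ _).symm

/-- With at most one vertex there are no edges, so no forest is needed. The consequence log n ≥ 1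
lets log n absorb additive constants. -/
theorem two_le_card_of_arboricity {V : Type} [Fintype V] {G : SimpleGraph V}
    (h : 1 ≤ G.arboricity) : 2 ≤ Fintype.card V := by
  by_contra! hcon
  have : Subsingleton V := Fintype.card_le_one_iff_subsingleton.1 (by omega)
  have h0 : G.CoveredByForests 0 := by
    refine ⟨Fin.elim0, fun i => i.elim0, ?_⟩
    ext u v
    rw [Subsingleton.elim u v]
    simp
  have : G.arboricity ≤ 0 := Nat.sInf_le h0
  omega

/-- The networks with given global parameters to which the theorem applies. -/
structure Admissible [Fintype 𝒞] (c k : ℕ) (ε : ℝ) (n Δ a : ℕ) (N : Network 𝒞) : Prop where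
  card_eq : Fintype.card N.V = n
  maxDegree_eq : N.G.maxDegree = Δ
  arboricity_eq : N.G.arboricity = a
  one_le : 1 ≤ a
  ident_le : ∀ v, N.ident v ≤ n ^ k
  card_colors_le : Fintype.card 𝒞 ≤ c * Δ ^ c
  list_card : ∀ v, ⌈(2 + ε) * (a : ℝ)⌉₊ ≤ (N.L v).card

/-- The bound on the number of bits of a message. -/
def messageBits (c k n : ℕ) : ℕ := (200 + 2 * c + k) * bitLength n * 16

/-- The logarithm of the degree bound. -/
noncomputable def scale (ε : ℝ) (a n : ℕ) : ℕ := Nat.log 2 (layerDegree ε a n + 1) + 1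

/-- The total number of rounds. -/
noncomputable def totalRounds (c k : ℕ) (ε : ℝ) (n a : ℕ) : ℕ :=
  layerCount ε n + layerCount ε n *
    (layerRounds (n ^ k + 1) ((128 + 2 * c) * bitLength n) (25 * scale ε a n + 24)
      (classPrime (scale ε a n)) + 1)

theorem succ_le_two_pow_bitLength {n k : ℕ} : n ^ k + 1 ≤ 2 ^ ((k + 1) * bitLength n) := by
  have h1 : n ^ k ≤ 2 ^ (k * bitLength n) := by
    rw [mul_comm, pow_mul]
    exact Nat.pow_le_pow_left (lt_two_pow_bitLength n).le k
  have h2 : 2 ≤ 2 ^ bitLength n := by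
    calc 2 = 2 ^ 1 := rfl
      _ ≤ _ := Nat.pow_le_pow_right two_pos (one_le_bitLength n)
  have h3 : 1 ≤ 2 ^ (k * bitLength n) := Nat.one_le_two_pow
  rw [add_mul, one_mul, pow_add]
  nlinarith

theorem Admissible.card_colors_le_two_pow [Fintype 𝒞] {c k : ℕ} {ε : ℝ} {n Δ a : ℕ} {N : Network 𝒞}
    (h : Admissible c k ε n Δ a N) : Fintype.card 𝒞 ≤ 2 ^ (2 * c * bitLength n) := by
  have hne : Nonempty N.V := by
    have := two_le_card_of_arboricity (h.arboricity_eq ▸ h.one_le : 1 ≤ N.G.arboricity)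
    exact Fintype.card_pos_iff.1 (by omega)
  have h1 : Δ < n := by
    rw [← h.maxDegree_eq, ← h.card_eq]
    exact N.G.maxDegree_lt_card_verts
  have hl := one_le_bitLength n
  have h2 : Δ ≤ 2 ^ bitLength n := h1.le.trans (lt_two_pow_bitLength n).le
  generalize bitLength n = l at *
  calc Fintype.card 𝒞 ≤ c * Δ ^ c := h.card_colors_le
    _ ≤ 2 ^ c * (2 ^ l) ^ c := Nat.mul_le_mul Nat.lt_two_pow_self.le (Nat.pow_le_pow_left h2 c)
    _ = 2 ^ (c + l * c) := by rw [← pow_mul, ← pow_add]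
    _ ≤ 2 ^ (2 * c * l) := Nat.pow_le_pow_right two_pos (by nlinarith)

theorem layerDegree_lt_two_pow_scale (ε : ℝ) (a n : ℕ) :
    layerDegree ε a n + 1 < 2 ^ scale ε a n :=
  Nat.lt_pow_succ_log_self one_lt_two _

theorem one_le_scale (ε : ℝ) (a n : ℕ) : 1 ≤ scale ε a n := Nat.le_add_left _ _

theorem scale_le_two_mul_bitLength (ε : ℝ) (a n : ℕ) : scale ε a n ≤ 2 * bitLength n := by
  have hl := one_le_bitLength n
  have hn := lt_two_pow_bitLength n
  have hD : layerDegree ε a n ≤ n := min_le_right _ _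
  have h1 : Nat.log 2 (layerDegree ε a n + 1) ≤ bitLength n := by
    calc Nat.log 2 (layerDegree ε a n + 1) ≤ Nat.log 2 (2 ^ bitLength n) :=
          Nat.log_mono_right (by omega)
      _ = bitLength n := Nat.log_pow one_lt_two _
  unfold scale
  omega

theorem mul_pow_four_le {D s : ℕ} (h : D < 2 ^ s) : 4096 * D ^ 4 ≤ 2 ^ (4 * s + 11 + 1) := by
  calc 4096 * D ^ 4 ≤ 2 ^ 12 * (2 ^ s) ^ 4 :=
        Nat.mul_le_mul (by norm_num) (Nat.pow_le_pow_left h.le 4)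
    _ = 2 ^ (4 * s + 11 + 1) := by rw [← pow_mul, ← pow_add]; congr 1; ring

theorem classPrime_le_two_pow {s l : ℕ} (hs : 1 ≤ s) (hl : 1 ≤ l) (hsl : s ≤ 2 * l) :
    classPrime s ≤ 2 ^ (33 * l) := by
  calc classPrime s ≤ 2 ^ 27 * s ^ 3 := classPrime_le hs
    _ ≤ 2 ^ 27 * (2 ^ s) ^ 3 :=
      Nat.mul_le_mul_left _ (Nat.pow_le_pow_left Nat.lt_two_pow_self.le 3)
    _ = 2 ^ (27 + s * 3) := by rw [← pow_mul, ← pow_add]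
    _ ≤ 2 ^ (33 * l) := Nat.pow_le_pow_right two_pos (by omega)

theorem Admissible.layerDegree_lt_card [Fintype 𝒞] {c k : ℕ} {ε : ℝ} {n Δ a : ℕ} {N : Network 𝒞}
    (h : Admissible c k ε n Δ a N) (hε : 0 < ε) (v : N.V) :
    layerDegree ε a n < (N.L v).card := by
  have hδ : 0 < min ε 1 := lt_min hε one_pos
  have h1 := h.list_card v
  have h2 : ⌈(2 + min ε 1) * (a : ℝ)⌉₊ ≤ ⌈(2 + ε) * (a : ℝ)⌉₊ :=
    Nat.ceil_mono (mul_le_mul_of_nonneg_right (by linarith [min_le_left ε 1]) (Nat.cast_nonneg _))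
  have h3 : layerDegree ε a n ≤ ⌈(2 + min ε 1) * (a : ℝ)⌉₊ - 1 := min_le_left _ _
  have h4 : 0 < ⌈(2 + min ε 1) * (a : ℝ)⌉₊ := by
    have : (0 : ℝ) < a := by exact_mod_cast h.one_le
    exact Nat.ceil_pos.2 (by positivity)
  omega

theorem exists_list_coloring [Fintype 𝒞] (c k : ℕ) {ε : ℝ} (hε : 0 < ε) (n Δ a : ℕ) :
    ∃ col : ∀ N : Network 𝒞, N.V → Option 𝒞,
      (∀ N, Admissible c k ε n Δ a N →
        ∃ x, IsListColoring N.G N.L x ∧ ∀ v, col N v = some (x v)) ∧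
      Known (Admissible c k ε n Δ a) (messageBits c k n) (totalRounds c k ε n a) col := by
  classical
  -- The bound on the number of colors is only available through some network in the class; for an
  -- empty class there is nothing to do.
  by_cases hex : ∃ N : Network 𝒞, Admissible c k ε n Δ a N
  swap
  · push Not at hex
    exact ⟨fun _ _ => none, fun N hN => absurd hN (hex N),
      ⟨fun _ => [], fun _ => none, fun N hN => absurd hN (hex N), fun N hN => absurd hN (hex N)⟩⟩
  obtain ⟨N₀, hN₀⟩ := hex
  have hc := hN₀.card_colors_le_two_pow
  have hδ : 0 < min ε 1 := lt_min hε one_pos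
  have hb : 1 ≤ messageBits c k n := by
    have := Nat.mul_le_mul (by omega : 1 ≤ 200 + 2 * c + k) (one_le_bitLength n)
    unfold messageBits
    omega
  have k0 := (known_zero (Admissible (𝒞 := 𝒞) c k ε n Δ a) (messageBits c k n))
  obtain ⟨ℓ, k1, h1⟩ := k0.exists_layers (D := layerDegree ε a n) (n := n) (L := layerCount ε n)
    (x := min ε 1 / 2) hb (by positivity)
    (fun N hN S => card_peel_le hε hN.one_le (by
      have := SimpleGraph.coveredByForests_arboricity (G := N.G)
        (hN.arboricity_eq ▸ hN.one_le)
      rwa [hN.arboricity_eq] at this) hN.card_eq S)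
    (fun N hN => hN.card_eq.le) (lt_pow_layerCount hε n)
  have hlist := fun (N : Network 𝒞) (hN : Admissible c k ε n Δ a N) =>
    hN.layerDegree_lt_card hε
  have hDs := layerDegree_lt_two_pow_scale ε a n
  have hs1 := one_le_scale ε a n
  have hsl := scale_le_two_mul_bitLength ε a n
  have hl := one_le_bitLength n
  have hMl : n ^ k + 1 ≤ 2 ^ ((k + 1) * bitLength n) := succ_le_two_pow_bitLength
  have hq := classPrime_le_two_pow hs1 hl hsl
  have hqs := (exists_class_prime (scale ε a n)).choose_spec
  change (classPrime (scale ε a n)).Prime ∧ _ ≤ classPrime (scale ε a n) ∧ _ at hqs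
  have hTl : 128 * (Nat.log 2 n + 1) ≤ (128 + 2 * c) * bitLength n :=
    Nat.mul_le_mul_right _ (Nat.le_add_right _ _)
  have hbits : messageBits c k n = (200 + 2 * c + k) * bitLength n * 16 := rfl
  unfold totalRounds
  generalize messageBits c k n = b at *
  generalize classPrime (scale ε a n) = q at *
  generalize scale ε a n = s at *
  generalize layerDegree ε a n = D at *
  generalize layerCount ε n = Λ at *
  generalize bitLength n = l at *
  have hD4 := mul_pow_four_le hDs
  obtain ⟨p, hp⟩ : ∃ p, p = (200 + 2 * c + k) * l := ⟨_, rfl⟩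
  have hpl : 200 * l + 2 * c * l + k * l = p := by rw [hp]; ring
  -- A common bound for all numbers that occur in messages. A report together with a class and a bit
  -- is encoded below m^16, whence the factor 16 in `messageBits`.
  obtain ⟨m, hm⟩ : ∃ m, m = 2 ^ p := ⟨_, rfl⟩
  have hle : ∀ {x : ℕ}, x ≤ p → 2 ^ x ≤ m := fun h => hm ▸ Nat.pow_le_pow_right two_pos h
  have hlt : ∀ {x : ℕ}, x < p → 2 ^ x < m := fun h => hm ▸ Nat.pow_lt_pow_right one_lt_two h
  have hqm : q * q ≤ m := by
    refine (Nat.mul_le_mul hq hq).trans ?_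
    rw [← pow_add]
    exact hle (by omega)
  have h3m : 3 ≤ m := le_trans (by norm_num) (hle (by omega : 2 ≤ p))
  have hmb : m ^ 16 ≤ 2 ^ b := by rw [hm, ← pow_mul, hbits, hp]
  have hTm : (128 + 2 * c) * l < m :=
    Nat.lt_two_pow_self.trans_le (hle (by rw [add_mul]; omega))
  have hMm : n ^ k + 1 ≤ m := hMl.trans (hle (by rw [add_mul, one_mul]; omega))
  have hDm : 4096 * (D + 1) ^ 4 ≤ m := hD4.trans (hle (by omega))
  obtain ⟨col, k2, h2⟩ := k1.color_layers (fun x => x.1.1) (fun x => x.1.2) (fun x => x.2)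
    hqs.1 hDs.le hTl
    (hc.trans (Nat.pow_le_pow_right two_pos (Nat.mul_le_mul_right l (by omega)))) hD4
    hqs.2.1 h3m hmb hqm (hlt (by omega)) (hc.trans_lt (hlt (by omega))) hTm hMm hDm
    (fun N hN => hN.card_eq.le) (fun N hN v => Nat.lt_succ_of_le (hN.ident_le v))
    (fun N hN => N.ident_injective) (fun N hN v => rfl) hlist Λ h1
  rw [zero_add] at k2
  exact ⟨col, h2, k2⟩

theorem bitLength_le {n : ℕ} (hn : 2 ≤ n) : (bitLength n : ℝ) ≤ 2 * Real.logb 2 n := by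
  have h0 : (0 : ℝ) < n := by exact_mod_cast (by omega : 0 < n)
  have h1 : (Nat.log 2 n : ℝ) ≤ Real.logb 2 n := by
    rw [Real.le_logb_iff_rpow_le (by norm_num) h0, Real.rpow_natCast]
    exact_mod_cast Nat.pow_log_le_self 2 (by omega)
  have h2 : (1 : ℝ) ≤ Real.logb 2 n := by
    rw [Real.le_logb_iff_rpow_le (by norm_num) h0, Real.rpow_one]
    exact_mod_cast hn
  unfold bitLength
  push_cast
  linarith

theorem scale_le (ε : ℝ) {a : ℕ} (ha : 1 ≤ a) (n : ℕ) :
    (scale ε a n : ℝ) ≤ Real.logb 2 a + 3 := by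
  have h0 : (0 : ℝ) < a := by exact_mod_cast ha
  have h1 : layerDegree ε a n + 1 ≤ 4 * a := by
    have h2 : layerDegree ε a n ≤ ⌈(2 + min ε 1) * (a : ℝ)⌉₊ - 1 := min_le_left _ _
    have h3 : ⌈(2 + min ε 1) * (a : ℝ)⌉₊ ≤ 3 * a := by
      refine Nat.ceil_le.2 ?_
      push_cast
      exact mul_le_mul_of_nonneg_right (by linarith [min_le_right ε 1]) h0.le
    omega
  have h2 : (Nat.log 2 (layerDegree ε a n + 1) : ℝ) ≤ Real.logb 2 (4 * a) := by
    rw [Real.le_logb_iff_rpow_le (by norm_num) (by positivity), Real.rpow_natCast]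
    exact_mod_cast (Nat.pow_log_le_self 2 (by omega)).trans h1
  have h3 : Real.logb 2 (4 * a) = 2 + Real.logb 2 a := by
    rw [Real.logb_mul (by norm_num) h0.ne']
    congr 1
    rw [Real.logb_eq_iff_rpow_eq (by norm_num) (by norm_num) (by norm_num)]
    norm_num
  unfold scale
  push_cast
  linarith

/-- With y = √(log a), the scale is at most y² + 3 ≤ 3(1 + y)² ≤ 12 · 2^(2y). The seventh power of
log a is far below the bound claimed; this is the only place where the form 2^{O(√log a)} enters. -/
theorem scale_pow_le (ε : ℝ) {a : ℕ} (ha : 1 ≤ a) (n : ℕ) :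
    (scale ε a n : ℝ) ^ 7 ≤ 12 ^ 7 * (2 : ℝ) ^ (14 * √(Real.logb 2 a)) := by
  have hlog : 0 ≤ Real.logb 2 (a : ℝ) :=
    Real.logb_nonneg (by norm_num) (by exact_mod_cast ha)
  set y := √(Real.logb 2 (a : ℝ)) with hy
  have hy0 : 0 ≤ y := Real.sqrt_nonneg _
  have hy2 : Real.logb 2 (a : ℝ) = y ^ 2 := (Real.sq_sqrt hlog).symm
  have h1 : 1 + y ≤ 2 * (2 : ℝ) ^ y := by
    have h2 : y * Real.log 2 + 1 ≤ (2 : ℝ) ^ y := by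
      rw [Real.rpow_def_of_pos two_pos, mul_comm y]
      exact Real.add_one_le_exp _
    have h3 := Real.log_two_gt_d9
    nlinarith
  have h2 : (scale ε a n : ℝ) ≤ 12 * ((2 : ℝ) ^ y) ^ 2 := by
    have h3 := scale_le ε ha n
    rw [hy2] at h3
    have h4 : (1 + y) ^ 2 ≤ (2 * (2 : ℝ) ^ y) ^ 2 := pow_le_pow_left₀ (by positivity) h1 2
    nlinarith
  calc (scale ε a n : ℝ) ^ 7 ≤ (12 * ((2 : ℝ) ^ y) ^ 2) ^ 7 :=
        pow_le_pow_left₀ (Nat.cast_nonneg _) h2 7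
    _ = 12 ^ 7 * ((2 : ℝ) ^ y) ^ 14 := by ring
    _ = _ := by
      rw [← Real.rpow_natCast ((2 : ℝ) ^ y) 14, ← Real.rpow_mul (by norm_num)]
      congr 2
      push_cast
      ring

/-- The constant in the running time of a layer. -/
def roundConst (c k : ℕ) : ℕ := k + 4 + (128 + 2 * c) * 2 ^ 62

/-- The summand 2 pays for a peeling round and for announcing the colors of the layer. The power 7
is one factor `s` for the number of hash bits and six for the q² classes, as q = O(s³). -/
theorem layerRounds_add_two_le (c k n : ℕ) {s : ℕ} (hs : 1 ≤ s) :
    layerRounds (n ^ k + 1) ((128 + 2 * c) * bitLength n) (25 * s + 24) (classPrime s) + 2 ≤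
      roundConst c k * s ^ 7 * bitLength n := by
  have hl := one_le_bitLength n
  set l := bitLength n
  have h1 : Nat.log 2 (n ^ k + 1) ≤ (k + 1) * l := by
    calc Nat.log 2 (n ^ k + 1) ≤ Nat.log 2 (2 ^ ((k + 1) * l)) :=
          Nat.log_mono_right succ_le_two_pow_bitLength
      _ = _ := Nat.log_pow one_lt_two _
  have hs7 : 1 ≤ s ^ 7 := Nat.one_le_pow _ _ hs
  have h2 : (25 * s + 24 + 1) * (1 + classPrime s * classPrime s) + 2 ≤ 2 ^ 62 * s ^ 7 := by
    have h3 := classPrime_le hs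
    have hs6 : 1 ≤ s ^ 6 := Nat.one_le_pow _ _ hs
    have h4 : 1 + classPrime s * classPrime s ≤ 2 ^ 55 * s ^ 6 := by
      calc 1 + classPrime s * classPrime s ≤ s ^ 6 + (2 ^ 27 * s ^ 3) * (2 ^ 27 * s ^ 3) :=
            Nat.add_le_add hs6 (Nat.mul_le_mul h3 h3)
        _ = (2 ^ 54 + 1) * s ^ 6 := by ring
        _ ≤ 2 ^ 55 * s ^ 6 := Nat.mul_le_mul_right _ (by norm_num)
    calc (25 * s + 24 + 1) * (1 + classPrime s * classPrime s) + 2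
        ≤ (50 * s) * (2 ^ 55 * s ^ 6) + 2 * s ^ 7 :=
          Nat.add_le_add (Nat.mul_le_mul (by omega) h4) (by omega)
      _ = (50 * 2 ^ 55 + 2) * s ^ 7 := by ring
      _ ≤ _ := Nat.mul_le_mul_right _ (by norm_num)
  unfold layerRounds roundConst
  have h5 : (128 + 2 * c) * l * ((25 * s + 24 + 1) * (1 + classPrime s * classPrime s) + 2) ≤
      (128 + 2 * c) * l * (2 ^ 62 * s ^ 7) := Nat.mul_le_mul_left _ h2
  have h6 : (k + 4) * l * 1 ≤ (k + 4) * l * s ^ 7 := Nat.mul_le_mul_left _ hs7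
  calc _ ≤ (k + 4) * l * 1 +
        (128 + 2 * c) * l * ((25 * s + 24 + 1) * (1 + classPrime s * classPrime s) + 2) := by
        nlinarith
    _ ≤ (k + 4) * l * s ^ 7 + (128 + 2 * c) * l * (2 ^ 62 * s ^ 7) := Nat.add_le_add h6 h5
    _ = _ := by ring

/-- The constant in the total running time. -/
noncomputable def totalConst (c k : ℕ) : ℝ := 12 ^ 8 * roundConst c k

/-- The constant 12^8 consists of 12^7 from `scale_pow_le`, a factor 3 for rounding up 2/δ, and a
factor 2 for each of the two occurrences of `bitLength n`. -/
theorem totalRounds_le (c k : ℕ) {ε : ℝ} (hε : 0 < ε) {n a : ℕ} (hn : 2 ≤ n) (ha : 1 ≤ a) :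
    (totalRounds c k ε n a : ℝ) ≤
      max 1 (1 / ε) * (totalConst c k * (2 : ℝ) ^ (totalConst c k * √(Real.logb 2 (a : ℝ)))) *
        Real.logb 2 n ^ 2 := by
  set s := scale ε a n with hs
  have hs1 : 1 ≤ s := Nat.le_add_left _ _
  have h1 : totalRounds c k ε n a ≤
      layerCount ε n * (roundConst c k * s ^ 7 * bitLength n) := by
    unfold totalRounds
    refine le_trans (le_of_eq ?_) (Nat.mul_le_mul_left _ (layerRounds_add_two_le c k n hs1))
    ring
  have h2 : (totalRounds c k ε n a : ℝ) ≤
      (⌈2 / min ε 1⌉₊ * bitLength n) * (roundConst c k * (s : ℝ) ^ 7 * bitLength n) := by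
    unfold layerCount at h1
    exact_mod_cast h1
  have hδ : 0 < min ε 1 := lt_min hε one_pos
  have h3 : (⌈2 / min ε 1⌉₊ : ℝ) ≤ 3 * max 1 (1 / ε) := by
    have h4 := (Nat.ceil_lt_add_one (by positivity : 0 ≤ 2 / min ε 1)).le
    have h5 : 1 / min ε 1 ≤ max 1 (1 / ε) := by
      rcases le_total ε 1 with h | h
      · rw [min_eq_left h]; exact le_max_right _ _
      · rw [min_eq_right h, div_one]; exact le_max_left _ _
    have h6 : 2 / min ε 1 = 2 * (1 / min ε 1) := by ring
    have h7 := le_max_left 1 (1 / ε)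
    linarith
  have hl := bitLength_le hn
  have hl0 : (0 : ℝ) ≤ bitLength n := Nat.cast_nonneg _
  have hsp := scale_pow_le ε ha n
  have hK1 : (14 : ℝ) ≤ totalConst c k := by
    unfold totalConst
    have : (1 : ℝ) ≤ roundConst c k := by
      have : 1 ≤ roundConst c k := by unfold roundConst; omega
      exact_mod_cast this
    nlinarith
  have h8 : (2 : ℝ) ^ (14 * √(Real.logb 2 (a : ℝ))) ≤
      (2 : ℝ) ^ (totalConst c k * √(Real.logb 2 (a : ℝ))) :=
    Real.rpow_le_rpow_of_exponent_le (by norm_num)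
      (mul_le_mul_of_nonneg_right hK1 (Real.sqrt_nonneg _))
  set E := (2 : ℝ) ^ (totalConst c k * √(Real.logb 2 (a : ℝ)))
  have h9 : (s : ℝ) ^ 7 ≤ 12 ^ 7 * E := hsp.trans (mul_le_mul_of_nonneg_left h8 (by positivity))
  have hlog0 : 0 ≤ Real.logb 2 (n : ℝ) := by linarith
  calc (totalRounds c k ε n a : ℝ)
      ≤ (⌈2 / min ε 1⌉₊ * bitLength n) * (roundConst c k * (s : ℝ) ^ 7 * bitLength n) := h2
    _ ≤ ((3 * max 1 (1 / ε)) * (2 * Real.logb 2 n)) *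
        (roundConst c k * (12 ^ 7 * E) * (2 * Real.logb 2 n)) := by gcongr
    _ = _ := by unfold totalConst; ring

end Network

/-- The color space has size at most `c * Δ ^ c`, and identifiers are at most `n ^ k`; the constants
`K` (running time) and `B` (message size) depend on `c` and `k` only. -/
theorem corollary5 (c k : ℕ) :
    ∃ K B : ℝ, ∀ (𝒞 : Type) [Fintype 𝒞] (ε : ℝ), 0 < ε →
      ∃ A : DistAlg 𝒞,
        ∀ (V : Type) [Fintype V] (G : SimpleGraph V) [DecidableRel G.Adj]
          (ident : V → ℕ) (L : V → Finset 𝒞),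
          1 ≤ G.arboricity →
          Function.Injective ident →
          (∀ v, ident v ≤ Fintype.card V ^ k) →
          Fintype.card 𝒞 ≤ c * G.maxDegree ^ c →
          (∀ v, ⌈(2 + ε) * (G.arboricity : ℝ)⌉₊ ≤ (L v).card) →
          A.MessagesAtMost G ident L (B * Real.logb 2 (Fintype.card V)) ∧
          A.SolvesWithin G ident L
            (max 1 (1 / ε) * (K * (2 : ℝ) ^ (K * √(Real.logb 2 (G.arboricity : ℝ)))) *
              Real.logb 2 (Fintype.card V) ^ 2) := by
  refine ⟨Network.totalConst c k, (200 + 2 * c + k) * 2 * 16, fun 𝒞 _ ε hε => ?_⟩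
  obtain ⟨A, hA⟩ := Network.exists_distAlg (𝒞 := 𝒞) (Network.Admissible c k ε)
    (fun n _ _ => Network.messageBits c k n) (fun n _ a => Network.totalRounds c k ε n a)
    (Network.exists_list_coloring c k hε)
  refine ⟨A, fun V _ G _ ident L ha hinj hid hC hL => ?_⟩
  have hn := Network.two_le_card_of_arboricity ha
  obtain ⟨h1, x, hx, h2⟩ := hA ⟨V, inferInstance, G, inferInstance, ident, hinj, L⟩
    ⟨rfl, rfl, rfl, ha, hid, hC, hL⟩
  refine ⟨fun t u v huv => (h1 t u v huv).trans ?_, x, hx, fun v => ?_⟩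
  · have := Network.bitLength_le hn
    unfold Network.messageBits
    push_cast
    calc (200 + 2 * (c : ℝ) + k) * Network.bitLength (Fintype.card V) * 16
        ≤ (200 + 2 * (c : ℝ) + k) * (2 * Real.logb 2 (Fintype.card V)) * 16 := by gcongr
      _ = _ := by ring
  · obtain ⟨s, hs, hs'⟩ := h2 v
    exact ⟨s, hs.trans (Network.totalRounds_le c k hε hn ha), hs'⟩
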